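/- For $\operatorname{Im}\mu>0$ let $\Lambda_\mu=2\mathbb Z+2\mu\mathbb Z$, let $\wp(\cdot|\mu)$ be the Weierstrass function with period lattice $\Lambda_\mu$ (half-periods $1,\mu$), with invariants $g_2(\mu),g_3(\mu)$, and let $J(\mu)=g_2^3/(g_2^3-27g_3^2)$. Put $$\theta_1(v|\mu)=-i\sum_{k\in\mathbb Z}(-1)^k e^{(k+\frac12)^2\pi i\mu}e^{(2k+1)\pi i v},\quad \theta_3(v|\mu)=\sum_{k\in\mathbb Z}e^{k^2\pi i\mu}e^{2k\pi i v},\quad \vartheta_2(\mu)=\sum_{k\in\mathbb Z}e^{(k+\frac12)^2\pi i\mu}.$$ Let $\varrho$ be the purely imaginary number with $-i\varrho>1$ and $J(\varrho)=\frac{73^3}{2^4 3^7}$ (so $-i\varrho\approx1.563401922$). Consider the relation $$\Xi(u,s):\qquad \pm2\,\frac{\theta_3(\frac12u|i)}{\theta_1(\frac12u|i)}\,\wp'(u|i)\,\wp'(s|\varrho)=\pi^6\vartheta_2^6(i)\,\vartheta_2^6(\varrho)\,\frac{6\wp(s|\varrho)+5\pi^2\vartheta_2^4(\varrho)}{12\wp(s|\varrho)+7\pi^2\vartheta_2^4(\varrho)}$$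 (one of the two signs holds) between $u,s\in\mathbb C$ with $2u\notin\Lambda_i$, $2s\notin\Lambda_\varrho$. Then: 1. $\Xi$ depends only on $u$ mod $\Lambda_i$ and $s$ mod $\Lambda_\varrho$, and it defines a finitely-sheeted mutual cover of the two tori: if $C$ is the closure in $\mathbb C/\Lambda_i\times\mathbb C/\Lambda_\varrho$ of the set of all pairs satisfying $\Xi$, then each of the projections $C\to\mathbb C/\Lambda_i$ and $C\to\mathbb C/\Lambda_\varrho$ is a continuous, open and closed surjection with finite fibres which, off a finite subset of the base, is a covering map with a constant finite number of sheets. 2. Through every pair $(u_0,s_0)$ satisfying $\Xi$ there passes a holomorphic branch $u=u(s)$ of $\Xi$, and every holomorphic branch $u=u(s)$ of $\Xi$ on an open set $D$ has $\frac{du}{ds}\ne0$ on $D$. Along every such branch the linear transformation $\Psi=\sqrt{\frac{du}{ds}}\,\psi$ (with any holomorphic branch of the square root on $D$) transforms the equations $$\Psi_{uu}=-\wp(2u|i)\,\Psi,\qquad \psi_{ss}=-\left\{\wp(2s|\varrho)+\tfrac13\pi^2\vartheta_2^4(\varrho)\right\}\psi$$ into each other: if $\Psi(u(s))=\sqrt{u'(s)}\,\psi(s)$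 on $D$, then $\Psi$ is a holomorphic solution of the first equation on $u(D)$ if and only if $\psi$ is a holomorphic solution of the second one on $D$. -/

import Mathlib

open Complex

noncomputable section

/-- The periods `2, 2μ` (half-periods `1, μ`), so that the Weierstrass functions of this pair are
`℘(·|μ)` and `℘'(·|μ)`. -/
def torusPeriods (μ : UpperHalfPlane) : PeriodPair where
  ω₁ := 2
  ω₂ := 2 * (μ : ℂ)
  indep := by
    rw [LinearIndependent.pair_iff]
    intro a b h
    have him := congrArg Complex.im h
    have hre := congrArg Complex.re h
    have hμ : 0 < (μ : ℂ).im := μ.im_pos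
    simp at him hre
    have hb : b = 0 := by
      rcases him with hb | hb
      · exact hb
      · exact absurd hb μ.im_ne_zero
    subst hb
    simpa using hre

/-- The Weierstrass function `℘(z|μ)`. -/
def wp (μ : UpperHalfPlane) (z : ℂ) : ℂ := (torusPeriods μ).weierstrassP z

/-- The derivative `℘'(z|μ)` of the Weierstrass function. -/
def wpDeriv (μ : UpperHalfPlane) (z : ℂ) : ℂ := (torusPeriods μ).derivWeierstrassP z

/-- The period lattice `2ℤ + 2μℤ`. -/
def periodLattice (μ : UpperHalfPlane) : AddSubgroup ℂ := (torusPeriods μ).lattice.toAddSubgroup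

/-- The torus `ℂ / (2ℤ + 2μℤ)`, with the quotient topology. -/
abbrev Torus (μ : UpperHalfPlane) : Type := ℂ ⧸ periodLattice μ

/-- Klein's invariant `J(μ) = g₂³ / (g₂³ - 27 g₃²)`, normalized by `J(i) = 1`. -/
def kleinJ (μ : UpperHalfPlane) : ℂ :=
  (torusPeriods μ).g₂ ^ 3 / ((torusPeriods μ).g₂ ^ 3 - 27 * (torusPeriods μ).g₃ ^ 2)

/-- The Jacobi theta function `θ₁(v|μ)`. -/
def theta1 (v : ℂ) (μ : UpperHalfPlane) : ℂ :=
  -I * ∑' k : ℤ, (-1) ^ k * exp (((k : ℂ) + 1 / 2) ^ 2 * Real.pi * I * μ) *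
    exp ((2 * (k : ℂ) + 1) * Real.pi * I * v)

/-- The Jacobi theta function `θ₃(v|μ)`. -/
def theta3 (v : ℂ) (μ : UpperHalfPlane) : ℂ :=
  ∑' k : ℤ, exp ((k : ℂ) ^ 2 * Real.pi * I * μ) * exp (2 * (k : ℂ) * Real.pi * I * v)

/-- The Jacobi theta constant `ϑ₂(μ)`. -/
def thetaConst2 (μ : UpperHalfPlane) : ℂ :=
  ∑' k : ℤ, exp (((k : ℂ) + 1 / 2) ^ 2 * Real.pi * I * μ)

/-- The relation `Ξ(u, s)` between a point `u` of the lemniscatic torus and a point `s` of the torus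
of modulus `ϱ`, at points where neither `u` nor `s` is a half-period (i.e. at regular points of the
two differential equations); one of the two signs is taken. -/
def transcendentalRelation (ϱ : UpperHalfPlane) (u s : ℂ) : Prop :=
  2 * u ∉ periodLattice UpperHalfPlane.I ∧ 2 * s ∉ periodLattice ϱ ∧
    ∃ ε : ℂ, (ε = 1 ∨ ε = -1) ∧
      ε * 2 * (theta3 (u / 2) UpperHalfPlane.I / theta1 (u / 2) UpperHalfPlane.I) *
          wpDeriv UpperHalfPlane.I u * wpDeriv ϱ s =
        (Real.pi : ℂ) ^ 6 * thetaConst2 UpperHalfPlane.I ^ 6 * thetaConst2 ϱ ^ 6 *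
          ((6 * wp ϱ s + 5 * (Real.pi : ℂ) ^ 2 * thetaConst2 ϱ ^ 4) /
            (12 * wp ϱ s + 7 * (Real.pi : ℂ) ^ 2 * thetaConst2 ϱ ^ 4))

/-- The curve defined by `Ξ` in the product of the two compact tori: the closure of the set of the
regular points of the relation. -/
def coverCurve (ϱ : UpperHalfPlane) : Set (Torus UpperHalfPlane.I × Torus ϱ) :=
  closure {p | ∃ u s : ℂ, transcendentalRelation ϱ u s ∧
    p = ((u : Torus UpperHalfPlane.I), (s : Torus ϱ))}

/-- A finitely-sheeted (branched) cover: a continuous open and closed surjection with finite fibres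
which, away from finitely many points of the base, is a covering map with a constant number
of sheets. -/
def IsFinitelySheetedCover {X T : Type*} [TopologicalSpace X] [TopologicalSpace T]
    (p : X → T) : Prop :=
  Continuous p ∧ IsOpenMap p ∧ IsClosedMap p ∧ Function.Surjective p ∧
    (∀ t, (p ⁻¹' {t}).Finite) ∧
    ∃ B : Set T, B.Finite ∧ IsCoveringMapOn p Bᶜ ∧ ∃ n : ℕ, 0 < n ∧ ∀ t ∉ B, (p ⁻¹' {t}).ncard = n

/-- `y` is a holomorphic solution of `y'' = Q y` on `U` (used for open sets `U`). -/
def IsSolutionOn (Q : ℂ → ℂ) (U : Set ℂ) (y : ℂ → ℂ) : Prop :=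
  DifferentiableOn ℂ y U ∧ ∀ z ∈ U, deriv (deriv y) z = Q z * y z

/-- `u = u(s)` is a holomorphic branch, on the open set `D`, of the multivalued function defined
by `Ξ(u, s)`. -/
def IsBranchOn (ϱ : UpperHalfPlane) (D : Set ℂ) (u : ℂ → ℂ) : Prop :=
  IsOpen D ∧ DifferentiableOn ℂ u D ∧ ∀ s ∈ D, transcendentalRelation ϱ (u s) s

end

/-! Write e = ℘(1|i), k = π²ϑ₂⁴(ϱ), X = ℘(u|i)/e and z = ℘(s|ϱ). The square of the theta quotient in
Ξ is X, and the value of J puts the roots of the cubic of ϱ at 17k/12, -7k/12, -10k/12. Squaring Ξ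
removes the sign and leaves an equation F(u) = G(s) between elliptic functions, with F = 4X²(X² - 1)
and G = k³(z + 10k/12)/((z - 17k/12)(z + 7k/12)³); this is `transcendentalRelation_iff`.

The relation is special because of its ramification. Both F and G take the values 0 and ∞ exactly at
the half-periods, and both F + 1 and, locally, G + 1 are squares of functions whose derivatives do
not vanish at regular points. So F and G ramify only over ∞, 0, -1, and doubly over -1.
Conceptually, both differential equations are pullbacks of one equation on the sphere with three
singular points and exponent differences 0, 0, 1/2, and u(s) is the correspondence between the two
pullbacks. The proof does not construct that equation; it verifies the Schwarzian relation between
the two potentials directly.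

Four ingredients carry the argument. Jacobi's derivative formula `deriv_thetaOdd_zero` ties theta
constants to ℘ (`weierstrassP_sub_eq_thetaRatio_sq`) and so gives the roots of the two cubics.
Liouville's theorem gives the zeros of ℘' and the duplication formula
`PeriodPair.weierstrassP_two_mul`, needed because the potentials are ℘ at doubled arguments. On a
branch, comparing the square roots of F + 1 and G + 1 yields 16 ℘(u) u'² H(s) = 9k³
(`branch_derivative`), with H = (z - 17k/12)(z + 7k/12); two further differentiations and
`schwarzian_identity` yield the transformation of the equations. Finally the closure of Ξ is the
whole fibre product of F and G over the sphere (`coverCurve_eq`), and a projection of such a fibre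
product of compact surfaces is a branched cover (`isFinitelySheetedCover_of_fibreProduct`). -/

noncomputable section

/-! ### Theta functions: duplication of the modulus. -/

theorem hasSum_jacobiTheta₂_mul (x y : ℂ) {τ : ℂ} (hτ : 0 < τ.im) :
    HasSum (fun p : ℤ × ℤ => jacobiTheta₂_term p.1 x τ * jacobiTheta₂_term p.2 y τ)
      (jacobiTheta₂ x τ * jacobiTheta₂ y τ) := by
  have hx := (summable_jacobiTheta₂_term_iff x τ).mpr hτ
  have hy := (summable_jacobiTheta₂_term_iff y τ).mpr hτ
  have hxy : Summable fun p : ℤ × ℤ => jacobiTheta₂_term p.1 x τ * jacobiTheta₂_term p.2 y τ :=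
    summable_mul_of_summable_norm (f := fun m => jacobiTheta₂_term m x τ)
      (g := fun n => jacobiTheta₂_term n y τ) hx.norm hy.norm
  exact HasSum.mul (f := fun m => jacobiTheta₂_term m x τ) (g := fun n => jacobiTheta₂_term n y τ)
    (hasSum_jacobiTheta₂_term x hτ) (hasSum_jacobiTheta₂_term y hτ) hxy

/-- Duplication of the modulus in a product of two theta functions. -/
theorem jacobiTheta₂_mul (x y : ℂ) {τ : ℂ} (hτ : 0 < τ.im) :
    jacobiTheta₂ x τ * jacobiTheta₂ y τ =
      jacobiTheta₂ (x + y) (2 * τ) * jacobiTheta₂ (x - y) (2 * τ) +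
      exp (Real.pi * I * τ + 2 * Real.pi * I * x) *
        (jacobiTheta₂ (x + y + τ) (2 * τ) * jacobiTheta₂ (x - y + τ) (2 * τ)) := by
  have h2τ : 0 < (2 * τ).im := by simpa using hτ
  -- Index pairs (m, n) split by the parity of m + n; `g₁` parametrizes the even class and `g₂` the
  -- odd one, which diagonalizes the quadratic form m² + n².
  let g₁ : ℤ × ℤ → ℤ × ℤ := fun p => (p.1 + p.2, p.1 - p.2)
  let g₂ : ℤ × ℤ → ℤ × ℤ := fun p => (p.1 + p.2 + 1, p.1 - p.2)
  have hg₁ : Function.Injective g₁ := by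
    rintro ⟨a, b⟩ ⟨c, d⟩ h
    simp only [g₁, Prod.mk.injEq] at h ⊢
    omega
  have hg₂ : Function.Injective g₂ := by
    rintro ⟨a, b⟩ ⟨c, d⟩ h
    simp only [g₂, Prod.mk.injEq] at h ⊢
    omega
  have hc : IsCompl (Set.range g₁) (Set.range g₂) := by
    constructor
    · rw [Set.disjoint_left]
      rintro _ ⟨⟨a, b⟩, rfl⟩ ⟨⟨c, d⟩, h⟩
      simp only [g₁, g₂, Prod.mk.injEq] at h
      omega
    · rw [codisjoint_iff_le_sup]
      rintro ⟨m, n⟩ -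
      rcases Int.even_or_odd' (m + n) with ⟨a, ha | ha⟩
      · exact Or.inl ⟨(a, m - a), by simp only [g₁, Prod.mk.injEq]; omega⟩
      · exact Or.inr ⟨(a, a - n), by simp only [g₂, Prod.mk.injEq]; omega⟩
  have h₁ := hasSum_jacobiTheta₂_mul (x + y) (x - y) h2τ
  have h₂ := (hasSum_jacobiTheta₂_mul (x + y + τ) (x - y + τ) h2τ).mul_left
    (exp (Real.pi * I * τ + 2 * Real.pi * I * x))
  refine (hasSum_jacobiTheta₂_mul x y hτ).unique (HasSum.add_isCompl hc ?_ ?_)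
  · refine (hg₁.hasSum_range_iff (f := fun p : ℤ × ℤ =>
      jacobiTheta₂_term p.1 x τ * jacobiTheta₂_term p.2 y τ)).mpr ?_
    refine h₁.congr_fun fun p => ?_
    simp only [Function.comp, g₁, jacobiTheta₂_term, ← Complex.exp_add]
    congr 1
    push_cast
    ring
  · refine (hg₂.hasSum_range_iff (f := fun p : ℤ × ℤ =>
      jacobiTheta₂_term p.1 x τ * jacobiTheta₂_term p.2 y τ)).mpr ?_
    refine h₂.congr_fun fun p => ?_
    simp only [Function.comp, g₂, jacobiTheta₂_term, ← Complex.exp_add]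
    congr 1
    push_cast
    ring

/-- The odd theta function, for a complex modulus. -/
def thetaOdd (τ v : ℂ) : ℂ :=
  -I * exp (Real.pi * I * τ / 4 + Real.pi * I * v) * jacobiTheta₂ (v + 1 / 2 + τ / 2) τ

/-- The theta constant `ϑ₂`, for a complex modulus. -/
def thetaNull2 (τ : ℂ) : ℂ := exp (Real.pi * I * τ / 4) * jacobiTheta₂ (τ / 2) τ

/-- The theta constant `ϑ₃`, for a complex modulus. -/
def thetaNull3 (τ : ℂ) : ℂ := jacobiTheta₂ 0 τ

/-- The theta constant `ϑ₄`, for a complex modulus. -/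
def thetaNull4 (τ : ℂ) : ℂ := jacobiTheta₂ (1 / 2) τ

theorem theta3_eq (v : ℂ) (μ : UpperHalfPlane) : theta3 v μ = jacobiTheta₂ v μ := by
  refine tsum_congr fun k => ?_
  rw [jacobiTheta₂_term, ← Complex.exp_add]
  congr 1
  ring

theorem neg_one_zpow_eq_exp (k : ℤ) : (-1 : ℂ) ^ k = exp (k * (Real.pi * I)) := by
  rw [Complex.exp_int_mul, Complex.exp_pi_mul_I]

theorem theta1_eq (v : ℂ) (μ : UpperHalfPlane) : theta1 v μ = thetaOdd μ v := by
  have h := tsum_mul_left (L := .unconditional ℤ) (f := fun k => jacobiTheta₂_term k (v + 1 / 2 + μ / 2) μ)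
    (a := exp (Real.pi * I * μ / 4 + Real.pi * I * v))
  rw [theta1, thetaOdd, jacobiTheta₂, mul_assoc (-I), ← h]
  congr 1
  refine tsum_congr fun k => ?_
  rw [jacobiTheta₂_term, neg_one_zpow_eq_exp]
  simp only [← Complex.exp_add]
  congr 1
  ring

theorem thetaConst2_eq (μ : UpperHalfPlane) : thetaConst2 μ = thetaNull2 μ := by
  have h := tsum_mul_left (L := .unconditional ℤ) (f := fun k => jacobiTheta₂_term k (μ / 2) μ)
    (a := exp (Real.pi * I * μ / 4))
  rw [thetaConst2, thetaNull2, jacobiTheta₂, ← h]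
  refine tsum_congr fun k => ?_
  rw [jacobiTheta₂_term]
  simp only [← Complex.exp_add]
  congr 1
  ring

theorem exp_pi_mul_I_div_two : exp (Real.pi * I * (1 / 2)) = I := by
  rw [show (Real.pi : ℂ) * I * (1 / 2) = Real.pi / 2 * I by ring, Complex.exp_pi_div_two_mul_I]

theorem thetaOdd_neg (τ v : ℂ) : thetaOdd τ (-v) = -thetaOdd τ v := by
  have h := jacobiTheta₂_add_left' (v - 1 / 2 - τ / 2) τ
  have h1 : jacobiTheta₂ (-v + 1 / 2 + τ / 2) τ = jacobiTheta₂ (v - 1 / 2 - τ / 2) τ := by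
    rw [← jacobiTheta₂_neg_left]; congr 1; ring
  have h2 : jacobiTheta₂ (v + 1 / 2 + τ / 2) τ = jacobiTheta₂ (v - 1 / 2 - τ / 2 + τ) τ := by
    rw [← jacobiTheta₂_add_left (v - 1 / 2 - τ / 2 + τ)]; congr 1; ring
  rw [thetaOdd, thetaOdd, h1, h2, h,
    show -Real.pi * I * (τ + 2 * (v - 1 / 2 - τ / 2)) = -2 * (Real.pi * I * v) + Real.pi * I by ring,
    show Real.pi * I * τ / 4 + Real.pi * I * -v = (Real.pi * I * τ / 4 + Real.pi * I * v) +
      (-2 * (Real.pi * I * v)) by ring, Complex.exp_add _ (-2 * _), Complex.exp_add _ (_ * I),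
    Complex.exp_pi_mul_I]
  ring

theorem thetaOdd_zero (τ : ℂ) : thetaOdd τ 0 = 0 := by
  have h := thetaOdd_neg τ 0
  rw [neg_zero] at h
  linear_combination h / 2

/-- Oddness of `thetaOdd` forces this zero. It removes the second term from two of the duplication
identities below, and later makes `thetaRatio` vanish at 1 + μ. -/
theorem jacobiTheta₂_half_period (τ : ℂ) : jacobiTheta₂ (1 / 2 + τ / 2) τ = 0 := by
  have h := thetaOdd_zero τ
  simpa [thetaOdd, Complex.exp_ne_zero] using h

theorem thetaOdd_add_one (τ v : ℂ) : thetaOdd τ (v + 1) = -thetaOdd τ v := by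
  rw [thetaOdd, thetaOdd, show v + 1 + 1 / 2 + τ / 2 = v + 1 / 2 + τ / 2 + 1 by ring,
    jacobiTheta₂_add_left, mul_add, mul_one, ← add_assoc, Complex.exp_add _ (_ * I),
    Complex.exp_pi_mul_I]
  ring

theorem thetaOdd_add_self (τ v : ℂ) :
    thetaOdd τ (v + τ) = -exp (-Real.pi * I * (τ + 2 * v)) * thetaOdd τ v := by
  rw [thetaOdd, thetaOdd, show v + τ + 1 / 2 + τ / 2 = v + 1 / 2 + τ / 2 + τ by ring,
    jacobiTheta₂_add_left',
    show -Real.pi * I * (τ + 2 * (v + 1 / 2 + τ / 2)) = -Real.pi * I * (τ + 2 * v) +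
      -(Real.pi * I * τ) + -(Real.pi * I) by ring,
    show Real.pi * I * τ / 4 + Real.pi * I * (v + τ) = (Real.pi * I * τ / 4 + Real.pi * I * v) +
      (Real.pi * I * τ) by ring]
  simp only [Complex.exp_add _ (-(Real.pi * I)), Complex.exp_add _ (-(Real.pi * I * τ)),
    Complex.exp_add _ (Real.pi * I * τ), Complex.exp_neg, Complex.exp_pi_mul_I]
  field_simp [Complex.exp_ne_zero]

theorem differentiable_thetaOdd {τ : ℂ} (hτ : 0 < τ.im) : Differentiable ℂ (thetaOdd τ) := by
  intro v
  unfold thetaOdd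
  have h : DifferentiableAt ℂ (fun v => jacobiTheta₂ (v + 1 / 2 + τ / 2) τ) v :=
    (differentiableAt_jacobiTheta₂_fst (v + 1 / 2 + τ / 2) hτ).comp v
      (f := fun v : ℂ => v + 1 / 2 + τ / 2) (by fun_prop)
  fun_prop

theorem thetaOdd_half (τ : ℂ) : thetaOdd τ (1 / 2) = thetaNull2 τ := by
  rw [thetaOdd, thetaNull2, show (1 : ℂ) / 2 + 1 / 2 + τ / 2 = τ / 2 + 1 by ring,
    jacobiTheta₂_add_left, Complex.exp_add, exp_pi_mul_I_div_two]
  linear_combination (-exp (Real.pi * I * τ / 4) * jacobiTheta₂ (τ / 2) τ) * I_mul_I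

/-- This identity, `thetaNull2_sq` and `deriv_thetaOdd_mul` are the three duplications whose
combination leaves `jacobiQuotient` unchanged under τ ↦ 2τ. -/
theorem thetaNull3_mul_thetaNull4 {τ : ℂ} (hτ : 0 < τ.im) :
    thetaNull3 τ * thetaNull4 τ = thetaNull4 (2 * τ) ^ 2 := by
  have h := jacobiTheta₂_mul (1 / 2) 0 hτ
  have h0 := jacobiTheta₂_half_period (2 * τ)
  rw [mul_div_cancel_left₀ τ (two_ne_zero' ℂ)] at h0
  rw [add_zero, sub_zero, h0] at h
  rw [thetaNull3, thetaNull4, thetaNull4]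
  linear_combination h

/-- With x = y = τ/2 the two terms of the duplication coincide by quasi-periodicity, whence the
factor 2. -/
theorem thetaNull2_sq {τ : ℂ} (hτ : 0 < τ.im) :
    thetaNull2 τ ^ 2 = 2 * thetaNull2 (2 * τ) * thetaNull3 (2 * τ) := by
  have h := jacobiTheta₂_mul (τ / 2) (τ / 2) hτ
  have h0 := jacobiTheta₂_add_left' 0 (2 * τ)
  rw [show τ / 2 + τ / 2 = τ by ring, sub_self, show τ + τ = 0 + 2 * τ by ring, h0, zero_add] at h
  have e1 : exp (Real.pi * I * τ + 2 * Real.pi * I * (τ / 2)) *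
      exp (-Real.pi * I * (2 * τ + 2 * 0)) = 1 := by
    rw [← Complex.exp_add, ← Complex.exp_zero]; congr 1; ring
  have e2 : exp (Real.pi * I * τ / 4) ^ 2 = exp (Real.pi * I * (2 * τ) / 4) := by
    rw [← Complex.exp_nat_mul]; congr 1; push_cast; ring
  rw [thetaNull2, thetaNull2, thetaNull3, mul_pow, e2, mul_div_cancel_left₀ τ (two_ne_zero' ℂ)]
  linear_combination exp (Real.pi * I * (2 * τ) / 4) * h +
    exp (Real.pi * I * (2 * τ) / 4) * jacobiTheta₂ 0 (2 * τ) * jacobiTheta₂ τ (2 * τ) * e1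

theorem thetaOdd_mul (v : ℂ) {τ : ℂ} (hτ : 0 < τ.im) :
    thetaOdd τ v * (exp (Real.pi * I * τ / 4 + Real.pi * I * v) * jacobiTheta₂ (v + τ / 2) τ) =
      thetaNull4 (2 * τ) * thetaOdd (2 * τ) (2 * v) := by
  have h := jacobiTheta₂_mul (v + 1 / 2 + τ / 2) (v + τ / 2) hτ
  have h0 := jacobiTheta₂_half_period (2 * τ)
  rw [mul_div_cancel_left₀ τ (two_ne_zero' ℂ)] at h0
  rw [show v + 1 / 2 + τ / 2 - (v + τ / 2) = 1 / 2 by ring, h0] at h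
  have e2 : exp (Real.pi * I * τ / 4 + Real.pi * I * v) ^ 2 =
      exp (Real.pi * I * (2 * τ) / 4 + Real.pi * I * (2 * v)) := by
    rw [← Complex.exp_nat_mul]; congr 1; push_cast; ring
  rw [thetaOdd, thetaOdd, thetaNull4, ← e2, show 2 * v + 1 / 2 + 2 * τ / 2 =
    v + 1 / 2 + τ / 2 + (v + τ / 2) by ring]
  linear_combination (-I * exp (Real.pi * I * τ / 4 + Real.pi * I * v) ^ 2) * h

/-- Differentiation of `thetaOdd_mul` at v = 0; the factors vanishing there leave one term on each
side, and the inner factor 2v supplies the 2. -/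
theorem deriv_thetaOdd_mul {τ : ℂ} (hτ : 0 < τ.im) :
    deriv (thetaOdd τ) 0 * thetaNull2 τ =
      2 * thetaNull4 (2 * τ) * deriv (thetaOdd (2 * τ)) 0 := by
  have h2τ : 0 < (2 * τ).im := by simpa using hτ
  have hg : DifferentiableAt ℂ (fun v => exp (Real.pi * I * τ / 4 + Real.pi * I * v) *
      jacobiTheta₂ (v + τ / 2) τ) 0 := by
    have h : DifferentiableAt ℂ (fun v => jacobiTheta₂ (v + τ / 2) τ) 0 :=
      (differentiableAt_jacobiTheta₂_fst (0 + τ / 2) hτ).comp 0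
        (f := fun v : ℂ => v + τ / 2) (by fun_prop)
    fun_prop
  have h1 := (differentiable_thetaOdd hτ 0).hasDerivAt.mul hg.hasDerivAt
  have h2 : HasDerivAt (fun v => thetaNull4 (2 * τ) * thetaOdd (2 * τ) (2 * v))
      (thetaNull4 (2 * τ) * (deriv (thetaOdd (2 * τ)) 0 * 2)) 0 := by
    refine HasDerivAt.const_mul _ ?_
    have h3 : HasDerivAt (thetaOdd (2 * τ)) (deriv (thetaOdd (2 * τ)) 0) (2 * (0 : ℂ)) := by
      rw [mul_zero]; exact (differentiable_thetaOdd h2τ 0).hasDerivAt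
    exact h3.comp 0 (by simpa using (hasDerivAt_id (0 : ℂ)).const_mul 2)
  have h3 := h1.unique (h2.congr_of_eventuallyEq (Filter.Eventually.of_forall fun v =>
    thetaOdd_mul v hτ))
  rw [thetaOdd_zero] at h3
  simp only [mul_zero, add_zero, zero_add, zero_mul] at h3
  rw [thetaNull2]
  linear_combination h3

/-! ### Error bounds for theta series and zeros of the odd theta function. -/

/-- The leading term of the series of the odd theta function. -/
def thetaOddLead (τ v : ℂ) : ℂ :=
  -I * exp (Real.pi * I * τ / 4) * (exp (Real.pi * I * v) - exp (-(Real.pi * I * v)))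

/-- The relative size of the remaining terms of the theta series. -/
def thetaErr (r : ℝ) : ℝ := 2 * (r / (1 - r) ^ 2) + r / (1 - r)

theorem norm_pow_sub_pow_le {x y : ℂ} {M : ℝ} (hx : ‖x‖ ≤ M) (hy : ‖y‖ ≤ M) (n : ℕ) :
    ‖x ^ (n + 1) - y ^ (n + 1)‖ ≤ (n + 1) * M ^ n * ‖x - y‖ := by
  have hM : 0 ≤ M := (norm_nonneg x).trans hx
  rw [← geom_sum₂_mul, norm_mul]
  refine mul_le_mul_of_nonneg_right ?_ (norm_nonneg _)
  calc ‖∑ i ∈ Finset.range (n + 1), x ^ i * y ^ (n + 1 - 1 - i)‖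
      ≤ ∑ i ∈ Finset.range (n + 1), M ^ n := by
        refine norm_sum_le_of_le _ fun i hi => ?_
        have hi' : i ≤ n := Nat.lt_succ_iff.mp (Finset.mem_range.mp hi)
        rw [norm_mul, norm_pow, norm_pow]
        calc ‖x‖ ^ i * ‖y‖ ^ (n + 1 - 1 - i) ≤ M ^ i * M ^ (n + 1 - 1 - i) := by gcongr
          _ = M ^ n := by rw [← pow_add]; congr 1; omega
    _ = (n + 1) * M ^ n := by simp

/-- The terms of index j and -j-1 are paired, so that every summand is a difference of odd powers
and hence divisible by the leading one. -/
theorem hasSum_thetaOdd {τ : ℂ} (hτ : 0 < τ.im) (v : ℂ) :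
    HasSum (fun j : ℕ => -I * (-1) ^ j * exp (Real.pi * I * τ / 4) *
      exp (Real.pi * I * τ * (j ^ 2 + j)) *
      (exp (Real.pi * I * v) ^ (2 * j + 1) - exp (-(Real.pi * I * v)) ^ (2 * j + 1)))
      (thetaOdd τ v) := by
  have h := ((hasSum_jacobiTheta₂_term (v + 1 / 2 + τ / 2) hτ).mul_left
    (-I * exp (Real.pi * I * τ / 4 + Real.pi * I * v))).nat_add_neg_add_one
  refine h.congr_fun fun j => ?_
  have hj : ((-1 : ℂ)) ^ j = exp (j * (Real.pi * I)) := by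
    rw [Complex.exp_nat_mul, Complex.exp_pi_mul_I]
  have hj' : ((-1 : ℂ)) ^ j = -exp (-((j + 1) * (Real.pi * I))) := by
    have he : -exp (-((j + 1) * (Real.pi * I))) =
        exp (-((j + 1) * (Real.pi * I)) + Real.pi * I) := by
      rw [Complex.exp_add, Complex.exp_pi_mul_I]; ring
    rw [hj, he, Complex.exp_eq_exp_iff_exists_int]
    exact ⟨j, by push_cast; ring⟩
  rw [mul_sub]
  rw [sub_eq_add_neg]
  congr 1
  · rw [hj, jacobiTheta₂_term, ← Complex.exp_nat_mul]
    simp only [mul_assoc, ← Complex.exp_add]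
    congr 2
    push_cast
    ring
  · rw [hj', jacobiTheta₂_term, ← Complex.exp_nat_mul]
    simp only [mul_assoc, mul_neg, neg_mul, neg_neg, ← Complex.exp_add]
    congr 3
    push_cast
    ring

theorem hasSum_thetaErr {r : ℝ} (h0 : 0 ≤ r) (h1 : r < 1) :
    HasSum (fun j : ℕ => (2 * ((j : ℝ) + 1) + 1) * r ^ (j + 1)) (thetaErr r) := by
  have hr : ‖r‖ < 1 := by rwa [Real.norm_of_nonneg h0]
  have h2 := (hasSum_nat_add_iff' (f := fun n : ℕ => (n : ℝ) * r ^ n) 1).mpr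
    (hasSum_coe_mul_geometric_of_norm_lt_one hr)
  have h3 := (hasSum_geometric_of_lt_one h0 h1).mul_left r
  simp only [Finset.range_one, Finset.sum_singleton, Nat.cast_zero, zero_mul, sub_zero] at h2
  refine ((h2.mul_left 2).add h3).congr_fun fun j => ?_
  push_cast
  ring

/-- Because x - y divides x^(2j+1) - y^(2j+1), the error is bounded relative to the leading term,
even near its zeros. In the strip |Im v| ≤ Im τ/2 the powers of x and y grow at most like r^(-j),
against coefficients of size r^(j²+j). The relative form yields both the zeros of `thetaOdd` and its
derivative at 0. -/
theorem norm_thetaOdd_sub_lead_le {τ : ℂ} (hτ : 0 < τ.im) {v : ℂ} (hv : |v.im| ≤ τ.im / 2) :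
    ‖thetaOdd τ v - thetaOddLead τ v‖ ≤
      thetaErr (Real.exp (-(Real.pi * τ.im))) * ‖thetaOddLead τ v‖ := by
  set r := Real.exp (-(Real.pi * τ.im)) with hr
  have hr1 : r < 1 := by
    rw [hr, Real.exp_lt_one_iff]
    have := mul_pos Real.pi_pos hτ
    linarith
  have h := (hasSum_nat_add_iff' 1).mpr (hasSum_thetaOdd hτ v)
  have hlead : ∑ i ∈ Finset.range 1, (-I * (-1) ^ i * exp (Real.pi * I * τ / 4) *
      exp (Real.pi * I * τ * ((i : ℂ) ^ 2 + i)) *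
      (exp (Real.pi * I * v) ^ (2 * i + 1) - exp (-(Real.pi * I * v)) ^ (2 * i + 1))) =
      thetaOddLead τ v := by
    simp [thetaOddLead]
  rw [hlead] at h
  refine h.norm_le_of_bounded ((hasSum_thetaErr (Real.exp_pos _).le hr1).mul_right _) fun j => ?_
  have hM := Real.exp_pos (Real.pi * τ.im / 2)
  have hv1 : Real.pi * |v.im| ≤ Real.pi * (τ.im / 2) :=
    mul_le_mul_of_nonneg_left hv Real.pi_pos.le
  have hb1 := mul_le_mul_of_nonneg_left (neg_abs_le v.im) Real.pi_pos.le
  have hb2 := mul_le_mul_of_nonneg_left (le_abs_self v.im) Real.pi_pos.le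
  have hx : ‖exp (Real.pi * I * v)‖ ≤ Real.exp (Real.pi * τ.im / 2) := by
    rw [Complex.norm_exp]
    refine Real.exp_le_exp.mpr ?_
    simp
    linarith
  have hy : ‖exp (-(Real.pi * I * v))‖ ≤ Real.exp (Real.pi * τ.im / 2) := by
    rw [Complex.norm_exp]
    refine Real.exp_le_exp.mpr ?_
    simp
    linarith
  have hp := norm_pow_sub_pow_le hx hy (2 * (j + 1))
  have hn : ‖exp (Real.pi * I * τ * (((j + 1 : ℕ) : ℂ) ^ 2 + (j + 1 : ℕ)))‖ =
      r ^ ((j + 1) ^ 2 + (j + 1)) := by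
    rw [Complex.norm_exp, hr, ← Real.exp_nat_mul]
    congr 1
    rw [show (Real.pi * I * τ * (((j + 1 : ℕ) : ℂ) ^ 2 + (j + 1 : ℕ))) =
      (((Real.pi * ((j + 1 : ℕ) ^ 2 + (j + 1 : ℕ)) : ℝ) : ℂ)) * (τ * I) by push_cast; ring,
      Complex.re_ofReal_mul, Complex.mul_I_re]
    push_cast
    ring
  have hMr : Real.exp (Real.pi * τ.im / 2) ^ (2 * (j + 1)) * r ^ (j + 1) = 1 := by
    rw [hr, ← Real.exp_nat_mul, ← Real.exp_nat_mul, ← Real.exp_add, ← Real.exp_zero]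
    congr 1
    push_cast
    ring
  have hW : ‖thetaOddLead τ v‖ = ‖exp (Real.pi * I * τ / 4)‖ *
      ‖exp (Real.pi * I * v) - exp (-(Real.pi * I * v))‖ := by
    simp [thetaOddLead]
  rw [norm_mul, norm_mul, norm_mul, norm_mul, hn, hW]
  simp only [norm_neg, norm_I, norm_pow, norm_one, one_pow, one_mul]
  set D := ‖exp (Real.pi * I * v) - exp (-(Real.pi * I * v))‖
  set E := ‖exp (Real.pi * I * τ / 4)‖
  have hr0 : 0 < r := Real.exp_pos _
  calc E * r ^ ((j + 1) ^ 2 + (j + 1)) *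
        ‖exp (Real.pi * I * v) ^ (2 * (j + 1) + 1) - exp (-(Real.pi * I * v)) ^ (2 * (j + 1) + 1)‖
      ≤ E * r ^ ((j + 1) ^ 2 + (j + 1)) * ((((2 * (j + 1) : ℕ) : ℝ) + 1) *
        Real.exp (Real.pi * τ.im / 2) ^ (2 * (j + 1)) * D) := by gcongr
    _ = (2 * (j + 1 : ℝ) + 1) * r ^ ((j + 1) ^ 2) * (E * D) *
        (Real.exp (Real.pi * τ.im / 2) ^ (2 * (j + 1)) * r ^ (j + 1)) := by
        rw [pow_add]; push_cast; ring
    _ ≤ (2 * (j + 1 : ℝ) + 1) * r ^ (j + 1) * (E * D) := by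
        rw [hMr, mul_one]
        have : r ^ ((j + 1) ^ 2) ≤ r ^ (j + 1) :=
          pow_le_pow_of_le_one hr0.le hr1.le (Nat.le_self_pow two_ne_zero _)
        gcongr

/-- The bound comes from π > 3 and e³ > 20; 1/20 is small enough to make `thetaErr` less than 1/4.
-/
theorem exp_neg_pi_mul_lt {y : ℝ} (hy : 1 ≤ y) : Real.exp (-(Real.pi * y)) < 1 / 20 := by
  have h1 : Real.exp (-(Real.pi * y)) ≤ Real.exp (-3) := by
    refine Real.exp_le_exp.mpr ?_
    nlinarith [Real.pi_gt_three]
  have h2 : Real.exp (-3) < 1 / 20 := by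
    rw [Real.exp_neg, inv_eq_one_div]
    refine one_div_lt_one_div_of_lt (by norm_num) ?_
    have h := Real.exp_one_gt_d9
    calc (20 : ℝ) < 2.7182818283 ^ 3 := by norm_num
      _ ≤ Real.exp 1 ^ 3 := by gcongr
      _ = Real.exp 3 := by rw [← Real.exp_nat_mul]; norm_num
  linarith

theorem thetaErr_lt {r : ℝ} (h0 : 0 ≤ r) (h1 : r < 1 / 20) : thetaErr r < 1 / 4 := by
  have h2 : r / (1 - r) ≤ 1 / 19 := by
    rw [div_le_div_iff₀ (by linarith) (by norm_num)]; linarith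
  have h3 : r / (1 - r) ^ 2 ≤ 20 / 361 := by
    rw [div_le_div_iff₀ (by nlinarith) (by norm_num)]; nlinarith
  rw [thetaErr]
  linarith

theorem exp_eq_exp_neg_iff (v : ℂ) :
    exp (Real.pi * I * v) - exp (-(Real.pi * I * v)) = 0 ↔ ∃ m : ℤ, v = m := by
  rw [sub_eq_zero, Complex.exp_eq_exp_iff_exists_int]
  have hpi : (Real.pi : ℂ) * I ≠ 0 := mul_ne_zero (by exact_mod_cast Real.pi_ne_zero) I_ne_zero
  refine exists_congr fun m => ⟨fun h => ?_, fun h => ?_⟩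
  · refine mul_left_cancel₀ (mul_ne_zero two_ne_zero hpi) ?_
    linear_combination h
  · rw [h]; ring

/-- At a zero the leading term is at most a quarter of itself in norm, so it vanishes too, and its
zeros are the integers. -/
theorem exists_int_of_thetaOdd_eq_zero {τ : ℂ} (hτ : 1 ≤ τ.im) {v : ℂ} (hv : |v.im| ≤ τ.im / 2)
    (h : thetaOdd τ v = 0) : ∃ m : ℤ, v = m := by
  have h1 := norm_thetaOdd_sub_lead_le (by linarith) hv
  have h2 := thetaErr_lt (Real.exp_pos _).le (exp_neg_pi_mul_lt hτ)
  rw [h, zero_sub, norm_neg] at h1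
  have h3 : ‖thetaOddLead τ v‖ = 0 := by
    nlinarith [norm_nonneg (thetaOddLead τ v)]
  rw [norm_eq_zero, thetaOddLead] at h3
  refine (exp_eq_exp_neg_iff v).mp ?_
  simpa [Complex.exp_ne_zero] using h3

theorem thetaOdd_sub_int_mul_eq_zero {τ : ℂ} (v : ℂ) (n : ℤ) :
    thetaOdd τ (v + n * τ) = 0 ↔ thetaOdd τ v = 0 := by
  induction n using Int.induction_on with
  | zero => simp
  | succ k ih =>
    rw [← ih, show v + ((k : ℤ) + 1 : ℤ) * τ = v + ((k : ℤ) : ℂ) * τ + τ by push_cast; ring,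
      thetaOdd_add_self]
    simp [Complex.exp_ne_zero]
  | pred k ih =>
    rw [← ih, show v + ((-(k : ℤ) : ℤ) : ℂ) * τ = v + ((-(k : ℤ) - 1 : ℤ) : ℂ) * τ + τ by
      push_cast; ring, thetaOdd_add_self]
    simp [Complex.exp_ne_zero]

/-- The zeros of the odd theta function. -/
theorem exists_int_add_of_thetaOdd_eq_zero {τ : ℂ} (hτ : 1 ≤ τ.im) {v : ℂ}
    (h : thetaOdd τ v = 0) : ∃ m n : ℤ, v = m + n * τ := by
  -- Subtracting n periods τ brings v into the strip where the leading term dominates.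
  set n := round (v.im / τ.im)
  have hn : |(v + ((-n : ℤ) : ℂ) * τ).im| ≤ τ.im / 2 := by
    have h1 := abs_sub_round (v.im / τ.im)
    have h2 : (v + ((-n : ℤ) : ℂ) * τ).im = (v.im / τ.im - n) * τ.im := by
      have : τ.im ≠ 0 := by linarith
      simp
      field_simp
      ring
    rw [h2, abs_mul, abs_of_pos (by linarith : 0 < τ.im)]
    nlinarith
  obtain ⟨m, hm⟩ := exists_int_of_thetaOdd_eq_zero hτ hn
    ((thetaOdd_sub_int_mul_eq_zero v (-n)).mpr h)
  refine ⟨m, n, ?_⟩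
  rw [← hm]
  push_cast
  ring

/-- Both functions vanish at 0, so the relative bound passes to difference quotients and then to the
limit. -/
theorem norm_deriv_thetaOdd_sub_le {τ : ℂ} (hτ : 0 < τ.im) :
    ‖deriv (thetaOdd τ) 0 - 2 * Real.pi * exp (Real.pi * I * τ / 4)‖ ≤
      thetaErr (Real.exp (-(Real.pi * τ.im))) * ‖2 * Real.pi * exp (Real.pi * I * τ / 4)‖ := by
  have hW : HasDerivAt (thetaOddLead τ) (2 * Real.pi * exp (Real.pi * I * τ / 4)) 0 := by
    have h1 : HasDerivAt (fun v : ℂ => Real.pi * I * v) (Real.pi * I) 0 := by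
      simpa using (hasDerivAt_id (0 : ℂ)).const_mul (Real.pi * I)
    have h2 := (h1.cexp.sub h1.neg.cexp).const_mul (-I * exp (Real.pi * I * τ / 4))
    refine HasDerivAt.congr_deriv h2 ?_
    simp only [Pi.neg_apply, mul_zero, neg_zero, Complex.exp_zero]
    linear_combination (-2 * Real.pi * exp (Real.pi * I * τ / 4)) * I_mul_I
  have h1 := (differentiable_thetaOdd hτ 0).hasDerivAt.sub hW
  have hlead : thetaOddLead τ 0 = 0 := by simp [thetaOddLead]
  refine le_of_tendsto_of_tendsto (hasDerivAt_iff_tendsto_slope.mp h1).norm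
    ((hasDerivAt_iff_tendsto_slope.mp hW).norm.const_mul _) ?_
  have hnear : ∀ᶠ v : ℂ in nhds 0, |v.im| < τ.im / 2 := by
    have hc : ContinuousAt (fun v : ℂ => |v.im|) 0 := by fun_prop
    exact hc.eventually_lt_const (by simpa using by linarith)
  filter_upwards [hnear.filter_mono nhdsWithin_le_nhds] with v hv
  have h2 := norm_thetaOdd_sub_lead_le hτ hv.le
  simp only [slope_def_field, Pi.sub_apply, thetaOdd_zero, hlead, sub_zero, norm_div]
  rw [← mul_div_assoc]
  gcongr

theorem norm_thetaNull2_sub_le {τ : ℂ} (hτ : 0 < τ.im) :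
    ‖thetaNull2 τ - 2 * exp (Real.pi * I * τ / 4)‖ ≤
      thetaErr (Real.exp (-(Real.pi * τ.im))) * ‖2 * exp (Real.pi * I * τ / 4)‖ := by
  have h := norm_thetaOdd_sub_lead_le (v := 1 / 2) hτ (by simp; linarith)
  have h2 : thetaOddLead τ (1 / 2) = 2 * exp (Real.pi * I * τ / 4) := by
    rw [thetaOddLead, Complex.exp_neg, exp_pi_mul_I_div_two, Complex.inv_I]
    linear_combination (-2 * exp (Real.pi * I * τ / 4)) * I_mul_I
  rwa [thetaOdd_half, h2] at h

theorem norm_thetaNull3_sub_le {τ : ℂ} (hτ : 0 < τ.im) :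
    ‖thetaNull3 τ - 1‖ ≤
      2 / (1 - Real.exp (-(Real.pi * τ.im))) * Real.exp (-(Real.pi * τ.im)) := by
  have h := norm_jacobiTheta_sub_one_le hτ
  rwa [jacobiTheta_eq_jacobiTheta₂, neg_mul] at h

/-- Since n² ≡ n mod 2, ϑ₄(τ) = ϑ₃(τ + 1), and the bound for ϑ₃ depends only on Im τ. -/
theorem norm_thetaNull4_sub_le {τ : ℂ} (hτ : 0 < τ.im) :
    ‖thetaNull4 τ - 1‖ ≤
      2 / (1 - Real.exp (-(Real.pi * τ.im))) * Real.exp (-(Real.pi * τ.im)) := by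
  have h := norm_thetaNull3_sub_le (τ := τ + 1) (by simpa using hτ)
  have h2 : thetaNull3 (τ + 1) = thetaNull4 τ := by
    refine tsum_congr fun n => ?_
    rw [jacobiTheta₂_term, jacobiTheta₂_term, Complex.exp_eq_exp_iff_exists_int]
    obtain ⟨m, hm⟩ := Int.even_or_odd' (n ^ 2 - n) |>.imp fun m h =>
      h.resolve_right fun h => by
        have := Int.even_mul_pred_self n
        rw [Int.even_iff] at this
        have h3 : n ^ 2 - n = n * (n - 1) := by ring
        omega
    refine ⟨m, ?_⟩
    have hm' : (n : ℂ) ^ 2 - n = 2 * m := by exact_mod_cast hm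
    linear_combination (Real.pi * I) * hm'
  simpa [h2] using h

theorem norm_thetaNull4_ge {τ : ℂ} (hτ : 1 ≤ τ.im) : 17 / 19 ≤ ‖thetaNull4 τ‖ := by
  have h := norm_thetaNull4_sub_le (τ := τ) (by linarith)
  have hr := exp_neg_pi_mul_lt hτ
  set r := Real.exp (-(Real.pi * τ.im))
  have h0 : 0 < r := Real.exp_pos _
  have h2 : 2 / (1 - r) * r ≤ 2 / 19 := by
    rw [div_mul_eq_mul_div, div_le_div_iff₀ (by linarith) (by norm_num)]
    linarith
  have h3 := norm_sub_norm_le (1 : ℂ) (thetaNull4 τ)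
  rw [norm_sub_rev, norm_one] at h3
  linarith

theorem norm_thetaNull3_ge {τ : ℂ} (hτ : 1 ≤ τ.im) : 17 / 19 ≤ ‖thetaNull3 τ‖ := by
  have h := norm_thetaNull3_sub_le (τ := τ) (by linarith)
  have hr := exp_neg_pi_mul_lt hτ
  set r := Real.exp (-(Real.pi * τ.im))
  have h0 : 0 < r := Real.exp_pos _
  have h2 : 2 / (1 - r) * r ≤ 2 / 19 := by
    rw [div_mul_eq_mul_div, div_le_div_iff₀ (by linarith) (by norm_num)]
    linarith
  have h3 := norm_sub_norm_le (1 : ℂ) (thetaNull3 τ)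
  rw [norm_sub_rev, norm_one] at h3
  linarith

theorem thetaNull3_ne_zero {τ : ℂ} (hτ : 1 ≤ τ.im) : thetaNull3 τ ≠ 0 := by
  intro h
  have := norm_thetaNull3_ge hτ
  rw [h, norm_zero] at this
  norm_num at this

theorem thetaNull4_ne_zero {τ : ℂ} (hτ : 1 ≤ τ.im) : thetaNull4 τ ≠ 0 := by
  intro h
  have := norm_thetaNull4_ge hτ
  rw [h, norm_zero] at this
  norm_num at this

theorem thetaNull2_ne_zero {τ : ℂ} (hτ : 1 ≤ τ.im) : thetaNull2 τ ≠ 0 := by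
  intro h
  have h1 := norm_thetaNull2_sub_le (τ := τ) (by linarith)
  have h2 := thetaErr_lt (Real.exp_pos _).le (exp_neg_pi_mul_lt hτ)
  rw [h, zero_sub, norm_neg] at h1
  have h3 : 0 < ‖2 * exp (Real.pi * I * τ / 4)‖ := by simp [Complex.exp_ne_zero]
  nlinarith

/-- Together with |ϑ₄| ≥ 17/19 this separates the wanted solution of J from its competitor, in
`exists_real_gaps`. -/
theorem norm_thetaNull2_le {τ : ℂ} (hτ : 1 ≤ τ.im) : ‖thetaNull2 τ‖ ≤ 5 / 4 := by
  have h1 := norm_thetaNull2_sub_le (τ := τ) (by linarith)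
  have h2 := thetaErr_lt (Real.exp_pos _).le (exp_neg_pi_mul_lt hτ)
  have h3 := norm_le_norm_add_norm_sub' (thetaNull2 τ) (2 * exp (Real.pi * I * τ / 4))
  -- The fourth power of this norm is r < 1/20 < 1/16.
  have h4 : ‖exp (Real.pi * I * τ / 4)‖ ≤ 1 / 2 := by
    have h5 : ‖exp (Real.pi * I * τ / 4)‖ ^ 4 = Real.exp (-(Real.pi * τ.im)) := by
      rw [← norm_pow, ← Complex.exp_nat_mul, Complex.norm_exp]
      congr 1
      rw [show ((4 : ℕ) : ℂ) * (Real.pi * I * τ / 4) = (Real.pi : ℂ) * (τ * I) by push_cast; ring,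
        Complex.re_ofReal_mul, Complex.mul_I_re]
      ring
    by_contra! h6
    have h7 : (1 / 2 : ℝ) ^ 4 < ‖exp (Real.pi * I * τ / 4)‖ ^ 4 := by gcongr
    have := exp_neg_pi_mul_lt hτ
    rw [h5] at h7
    norm_num at h7
    linarith
  rw [norm_mul, Complex.norm_two] at h1 h3
  nlinarith [norm_nonneg (exp (Real.pi * I * τ / 4))]

theorem im_two_pow_mul (τ : ℂ) (n : ℕ) : (2 ^ n * τ).im = 2 ^ n * τ.im := by
  rw [show (2 : ℂ) ^ n = ((2 ^ n : ℝ) : ℂ) by push_cast; rfl, Complex.im_ofReal_mul]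

theorem one_le_im_two_pow_mul {τ : ℂ} (hτ : 1 ≤ τ.im) (n : ℕ) : 1 ≤ (2 ^ n * τ).im := by
  rw [im_two_pow_mul]
  have : (1 : ℝ) ≤ 2 ^ n := one_le_pow₀ (by norm_num)
  nlinarith

/-! ### Jacobi's derivative formula. -/

/-- The quotient that Jacobi's derivative formula asserts to be `π`. -/
def jacobiQuotient (τ : ℂ) : ℂ :=
  deriv (thetaOdd τ) 0 / (thetaNull2 τ * thetaNull3 τ * thetaNull4 τ)

theorem jacobiQuotient_two_mul {τ : ℂ} (hτ : 1 ≤ τ.im) :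
    jacobiQuotient (2 * τ) = jacobiQuotient τ := by
  have hτ0 : 0 < τ.im := by linarith
  have hτ2 : 1 ≤ (2 * τ).im := by simpa using one_le_im_two_pow_mul hτ 1
  have a2 := thetaNull2_ne_zero hτ
  have a3 := thetaNull3_ne_zero hτ
  have a4 := thetaNull4_ne_zero hτ
  have b2 := thetaNull2_ne_zero hτ2
  have b3 := thetaNull3_ne_zero hτ2
  have b4 := thetaNull4_ne_zero hτ2
  have h1 := deriv_thetaOdd_mul hτ0
  have h2 := thetaNull2_sq hτ0
  have h3 := thetaNull3_mul_thetaNull4 hτ0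
  rw [jacobiQuotient, jacobiQuotient, div_eq_div_iff (by simp [*]) (by simp [*])]
  refine mul_left_cancel₀ (mul_ne_zero two_ne_zero b4) ?_
  linear_combination (-thetaNull2 τ * thetaNull3 τ * thetaNull4 τ) * h1 +
    (deriv (thetaOdd τ) 0 * thetaNull3 τ * thetaNull4 τ) * h2 +
    (2 * deriv (thetaOdd τ) 0 * thetaNull2 (2 * τ) * thetaNull3 (2 * τ)) * h3

theorem jacobiQuotient_two_pow_mul {τ : ℂ} (hτ : 1 ≤ τ.im) (n : ℕ) :
    jacobiQuotient (2 ^ n * τ) = jacobiQuotient τ := by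
  induction n with
  | zero => simp
  | succ n ih =>
    rw [← ih, pow_succ', mul_assoc, jacobiQuotient_two_mul (one_le_im_two_pow_mul hτ n)]

theorem tendsto_exp_neg_pi_two_pow {τ : ℂ} (hτ : 1 ≤ τ.im) :
    Filter.Tendsto (fun n : ℕ => Real.exp (-(Real.pi * (2 ^ n * τ).im))) Filter.atTop (nhds 0) := by
  refine Real.tendsto_exp_neg_atTop_nhds_zero.comp ?_
  simp only [im_two_pow_mul, mul_left_comm Real.pi]
  exact (tendsto_pow_atTop_atTop_of_one_lt one_lt_two).atTop_mul_const
    (mul_pos Real.pi_pos (by linarith))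

theorem tendsto_thetaErr : Filter.Tendsto thetaErr (nhds 0) (nhds 0) := by
  have h : ContinuousAt thetaErr 0 := by
    unfold thetaErr
    fun_prop (disch := norm_num)
  simpa [ContinuousAt, thetaErr] using h

/-- **Jacobi's derivative formula** `θ₁'(0) = π ϑ₂ ϑ₃ ϑ₄`. -/
theorem deriv_thetaOdd_zero {τ : ℂ} (hτ : 1 ≤ τ.im) :
    deriv (thetaOdd τ) 0 = Real.pi * (thetaNull2 τ * thetaNull3 τ * thetaNull4 τ) := by
  -- The quotient is constant along 2ⁿτ. There θ₁'(0) ~ 2πE, ϑ₂ ~ 2E and ϑ₃, ϑ₄ → 1, with E = exp(πi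
  -- 2ⁿτ/4), so the constant is π.
  have hr := tendsto_exp_neg_pi_two_pow hτ
  have hpos : ∀ n : ℕ, 0 < (2 ^ n * τ).im := fun n => by linarith [one_le_im_two_pow_mul hτ n]
  have hE : ∀ n : ℕ, exp (Real.pi * I * (2 ^ n * τ) / 4) ≠ 0 := fun n => Complex.exp_ne_zero _
  have herr := tendsto_thetaErr.comp hr
  have h1 : Filter.Tendsto (fun n : ℕ => deriv (thetaOdd (2 ^ n * τ)) 0 /
      (2 * Real.pi * exp (Real.pi * I * (2 ^ n * τ) / 4))) Filter.atTop (nhds 1) := by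
    rw [tendsto_iff_norm_sub_tendsto_zero]
    refine squeeze_zero (fun _ => norm_nonneg _) (fun n => ?_) herr
    have h := norm_deriv_thetaOdd_sub_le (hpos n)
    have hne : 2 * Real.pi * exp (Real.pi * I * (2 ^ n * τ) / 4) ≠ 0 := by
      simp [hE, Real.pi_ne_zero]
    rw [div_sub_one hne, norm_div, div_le_iff₀ (norm_pos_iff.mpr hne)]
    exact h
  have h2 : Filter.Tendsto (fun n : ℕ => thetaNull2 (2 ^ n * τ) /
      (2 * exp (Real.pi * I * (2 ^ n * τ) / 4))) Filter.atTop (nhds 1) := by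
    rw [tendsto_iff_norm_sub_tendsto_zero]
    refine squeeze_zero (fun _ => norm_nonneg _) (fun n => ?_) herr
    have h := norm_thetaNull2_sub_le (hpos n)
    have hne : 2 * exp (Real.pi * I * (2 ^ n * τ) / 4) ≠ 0 := by simp [hE]
    rw [div_sub_one hne, norm_div, div_le_iff₀ (norm_pos_iff.mpr hne)]
    exact h
  have hb : Filter.Tendsto (fun n : ℕ => 2 / (1 - Real.exp (-(Real.pi * (2 ^ n * τ).im))) *
      Real.exp (-(Real.pi * (2 ^ n * τ).im))) Filter.atTop (nhds 0) := by
    have h : ContinuousAt (fun r : ℝ => 2 / (1 - r) * r) 0 := by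
      fun_prop (disch := norm_num)
    have h' : Filter.Tendsto (fun r : ℝ => 2 / (1 - r) * r) (nhds 0) (nhds 0) := by
      simpa [ContinuousAt] using h
    exact h'.comp hr
  have h3 : Filter.Tendsto (fun n : ℕ => thetaNull3 (2 ^ n * τ)) Filter.atTop (nhds 1) := by
    rw [tendsto_iff_norm_sub_tendsto_zero]
    exact squeeze_zero (fun _ => norm_nonneg _) (fun n => norm_thetaNull3_sub_le (hpos n)) hb
  have h4 : Filter.Tendsto (fun n : ℕ => thetaNull4 (2 ^ n * τ)) Filter.atTop (nhds 1) := by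
    rw [tendsto_iff_norm_sub_tendsto_zero]
    exact squeeze_zero (fun _ => norm_nonneg _) (fun n => norm_thetaNull4_sub_le (hpos n)) hb
  have h5 : Filter.Tendsto (fun n : ℕ => jacobiQuotient (2 ^ n * τ)) Filter.atTop
      (nhds (Real.pi : ℂ)) := by
    have h := (h1.const_mul (Real.pi : ℂ)).div ((h2.mul h3).mul h4) (by norm_num)
    simp only [mul_one, div_one] at h
    refine h.congr fun n => ?_
    have := hE n
    have hpi : (Real.pi : ℂ) ≠ 0 := by exact_mod_cast Real.pi_ne_zero
    have b2 := thetaNull2_ne_zero (one_le_im_two_pow_mul hτ n)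
    have b3 := thetaNull3_ne_zero (one_le_im_two_pow_mul hτ n)
    have b4 := thetaNull4_ne_zero (one_le_im_two_pow_mul hτ n)
    rw [jacobiQuotient, Pi.div_apply]
    generalize exp (Real.pi * I * (2 ^ n * τ) / 4) = E at *
    generalize thetaNull2 (2 ^ n * τ) = t₂ at *
    generalize thetaNull3 (2 ^ n * τ) = t₃ at *
    generalize thetaNull4 (2 ^ n * τ) = t₄ at *
    field_simp
  simp only [jacobiQuotient_two_pow_mul hτ] at h5
  have h6 := tendsto_nhds_unique tendsto_const_nhds h5
  rw [jacobiQuotient, div_eq_iff (by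
    simp [thetaNull2_ne_zero hτ, thetaNull3_ne_zero hτ, thetaNull4_ne_zero hτ])] at h6
  exact h6

/-! ### Liouville's theorem and local behaviour of ℘ and ℘'. -/

namespace PeriodPair

open Filter Topology

variable (L : PeriodPair)

theorem order_add_of_periodic {g : ℂ → ℂ} {l : ℂ} (h : ∀ z, g (z + l) = g z) (z : ℂ) :
    meromorphicOrderAt g (z + l) = meromorphicOrderAt g z := by
  have h1 := meromorphicOrderAt_comp_add_const_eq_meromorphicOrderAt (c := l) (x := z) (f := g)
  rw [← h1]
  congr 1
  funext w
  exact h w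

/-- A doubly periodic meromorphic function without poles is constant. -/
theorem exists_eventuallyEq_const {g : ℂ → ℂ} (hg : Meromorphic g)
    (hper : ∀ l ∈ L.lattice, ∀ z, g (z + l) = g z) (hord : ∀ z, 0 ≤ meromorphicOrderAt g z) :
    ∃ c, ∀ z, ∀ᶠ w in 𝓝[≠] z, g w = c := by
  -- The normal form repairs the values of g at removable singularities; it is entire, still
  -- periodic, hence bounded and constant.
  set N := toMeromorphicNFOn g Set.univ
  have hgo : MeromorphicOn g Set.univ := fun z _ => hg z
  have hNg : ∀ z, N =ᶠ[𝓝[≠] z] g := fun z => hgo.toMeromorphicNFOn_eq_self_on_nhdsNE (Set.mem_univ z)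
  have hNa : ∀ z, AnalyticAt ℂ N z := fun z => by
    rw [← (meromorphicNFOn_toMeromorphicNFOn (f := g) (U := Set.univ)
      (Set.mem_univ z)).meromorphicOrderAt_nonneg_iff_analyticAt, meromorphicOrderAt_congr (hNg z)]
    exact hord z
  have hNd : Differentiable ℂ N := fun z => (hNa z).differentiableAt
  have hNper : ∀ z l, l ∈ L.lattice → N (z + l) = N z := by
    intro z l hl
    have h1 : Tendsto (fun w => N (w + l)) (𝓝[≠] z) (𝓝 (N (z + l))) :=
      ((hNd.continuous.comp (continuous_add_const l)).tendsto z).mono_left nhdsWithin_le_nhds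
    have h2 : Tendsto N (𝓝[≠] z) (𝓝 (N z)) := (hNd.continuous.tendsto z).mono_left nhdsWithin_le_nhds
    have hshift : Tendsto (fun w => w + l) (𝓝[≠] z) (𝓝[≠] (z + l)) := by
      refine tendsto_nhdsWithin_of_tendsto_nhds_of_eventually_within _
        (((continuous_add_const l).tendsto z).mono_left nhdsWithin_le_nhds) ?_
      filter_upwards [self_mem_nhdsWithin] with w hw h
      exact hw (add_right_cancel h)
    refine tendsto_nhds_unique_of_eventuallyEq h1 h2 ?_
    filter_upwards [hNg z, hshift.eventually (hNg (z + l))] with w hw1 hw2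
    rw [hw2, hw1, hper l hl]
  refine ⟨N 0, fun z => ?_⟩
  filter_upwards [hNg z] with w hw
  rw [← hw]
  exact hNd.apply_eq_apply_of_bounded
    (IsZLattice.isCompact_range_of_periodic L.lattice _ hNd.continuous hNper).isBounded w 0

/-- A meromorphic function symmetric about `h` with at most a simple pole at `h` has no pole. -/
theorem order_nonneg_of_symmetric {g : ℂ → ℂ} {h : ℂ} (hg : MeromorphicAt g h)
    (hsymm : ∀ z, g (2 * h - z) = g z)
    (hlim : Tendsto (fun z => (z - h) ^ 2 * g z) (𝓝[≠] h) (𝓝 0)) : 0 ≤ meromorphicOrderAt g h := by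
  by_contra! hneg
  obtain ⟨n, hn⟩ := WithTop.ne_top_iff_exists.mp (ne_top_of_lt hneg)
  obtain ⟨k, hk, hk0, hgk⟩ := (meromorphicOrderAt_eq_int_iff hg).mp hn.symm
  have hn0 : n < 0 := by rw [← hn] at hneg; exact_mod_cast hneg
  have hkc : Tendsto k (𝓝[≠] h) (𝓝 (k h)) := hk.continuousAt.tendsto.mono_left nhdsWithin_le_nhds
  -- The limit hypothesis excludes orders at most -2; only a simple pole is left.
  have hn1 : n = -1 := by
    by_contra hn1
    obtain ⟨m, hm⟩ : ∃ m : ℕ, n = -2 - m := ⟨(-2 - n).toNat, by omega⟩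
    have h1 : Tendsto (fun z => (z - h) ^ m * ((z - h) ^ 2 * g z)) (𝓝[≠] h) (𝓝 (0 ^ m * 0)) := by
      refine Tendsto.mul ?_ hlim
      have : Continuous fun z : ℂ => (z - h) ^ m := by fun_prop
      simpa using (this.tendsto h).mono_left nhdsWithin_le_nhds
    rw [mul_zero] at h1
    refine hk0 (tendsto_nhds_unique_of_eventuallyEq hkc h1 ?_)
    filter_upwards [hgk, self_mem_nhdsWithin] with z hz hzh
    have hz0 : z - h ≠ 0 := sub_ne_zero.mpr hzh
    rw [hz, hm, smul_eq_mul, ← mul_assoc, ← mul_assoc, ← pow_add, ← zpow_natCast, ← zpow_add₀ hz0]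
    have : ((m + 2 : ℕ) : ℤ) + (-2 - m) = 0 := by push_cast; ring
    rw [this, zpow_zero, one_mul]
  subst hn1
  -- The reflection changes the sign of z - h, so symmetry forces the coefficient of the simple pole
  -- to equal its negative.
  have hrefl : Tendsto (fun z => 2 * h - z) (𝓝[≠] h) (𝓝[≠] h) := by
    refine tendsto_nhdsWithin_of_tendsto_nhds_of_eventually_within _ ?_ ?_
    · have : Continuous fun z : ℂ => 2 * h - z := by fun_prop
      have h1 := (this.tendsto h).mono_left (nhdsWithin_le_nhds (s := {h}ᶜ))
      rwa [show 2 * h - h = h by ring] at h1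
    · filter_upwards [self_mem_nhdsWithin] with z hz hz'
      refine hz ?_
      simp only [Set.mem_singleton_iff] at hz' ⊢
      linear_combination -hz'
  have h2 := (hkc.comp hrefl).neg
  have h3 : k h = -k h := by
    refine tendsto_nhds_unique_of_eventuallyEq hkc h2 ?_
    filter_upwards [hgk, hrefl.eventually hgk, self_mem_nhdsWithin] with z h4 h5 hzh
    have hz0 : z - h ≠ 0 := sub_ne_zero.mpr hzh
    rw [hsymm, h4, smul_eq_mul, smul_eq_mul, zpow_neg_one, zpow_neg_one,
      show 2 * h - z - h = -(z - h) by ring, inv_neg] at h5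
    have := mul_left_cancel₀ (inv_ne_zero hz0) (h5.trans (neg_mul_comm _ _))
    simpa using this
  exact hk0 (by linear_combination h3 / 2)

theorem tendsto_weierstrassPExcept_zero : Tendsto (L.weierstrassPExcept 0) (𝓝 0) (𝓝 0) := by
  have h := (L.analyticAt_weierstrassPExcept 0).continuousAt.tendsto
  rwa [L.weierstrassPExcept_zero] at h

theorem weierstrassP_eq_add (z : ℂ) :
    L.weierstrassP z = L.weierstrassPExcept 0 z + 1 / z ^ 2 := by
  have h := L.weierstrassPExcept_add 0 z
  simpa using h.symm

theorem derivWeierstrassP_eq_sub (z : ℂ) :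
    L.derivWeierstrassP z = L.derivWeierstrassPExcept 0 z - 2 / z ^ 3 := by
  have h := L.derivWeierstrassPExcept_sub 0 z
  simpa using h.symm

theorem tendsto_sq_mul_weierstrassP :
    Tendsto (fun z => z ^ 2 * L.weierstrassP z) (𝓝[≠] 0) (𝓝 1) := by
  have h1 : Tendsto (fun z : ℂ => z ^ 2 * L.weierstrassPExcept 0 z + 1) (𝓝 0) (𝓝 1) := by
    have h2 : Tendsto (fun z : ℂ => z ^ 2) (𝓝 0) (𝓝 0) := by
      simpa using (continuous_pow (M := ℂ) 2).tendsto 0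
    simpa using (h2.mul L.tendsto_weierstrassPExcept_zero).add_const 1
  refine (h1.mono_left nhdsWithin_le_nhds).congr' ?_
  filter_upwards [self_mem_nhdsWithin] with z hz
  have hz0 : z ≠ 0 := hz
  rw [L.weierstrassP_eq_add]
  field_simp

theorem tendsto_cube_mul_derivWeierstrassP :
    Tendsto (fun z => z ^ 3 * L.derivWeierstrassP z) (𝓝[≠] 0) (𝓝 (-2)) := by
  have h1 : Tendsto (fun z : ℂ => z ^ 3 * L.derivWeierstrassPExcept 0 z - 2) (𝓝 0) (𝓝 (-2)) := by
    have h2 : Tendsto (fun z : ℂ => z ^ 3) (𝓝 0) (𝓝 0) := by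
      simpa using (continuous_pow (M := ℂ) 3).tendsto 0
    simpa using (h2.mul (L.analyticAt_derivWeierstrassPExcept 0).continuousAt.tendsto).sub_const 2
  refine (h1.mono_left nhdsWithin_le_nhds).congr' ?_
  filter_upwards [self_mem_nhdsWithin] with z hz
  have hz0 : z ≠ 0 := hz
  rw [L.derivWeierstrassP_eq_sub]
  field_simp

theorem tendsto_weierstrassP_cobounded {l : ℂ} (hl : l ∈ L.lattice) :
    Tendsto L.weierstrassP (𝓝[≠] l) (Bornology.cobounded ℂ) := by
  refine tendsto_cobounded_of_meromorphicOrderAt_neg ?_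
  rw [L.order_weierstrassP l hl]
  decide

theorem countable_lattice : (L.lattice : Set ℂ).Countable := by
  have : Countable L.lattice := L.latticeEquivProd.toEquiv.countable_iff.mpr inferInstance
  exact Set.to_countable _

theorem isPreconnected_compl_lattice : IsPreconnected (L.lattice : Set ℂ)ᶜ := by
  refine (L.countable_lattice.isPathConnected_compl_of_one_lt_rank ?_).isConnected.isPreconnected
  rw [Complex.rank_real_complex]
  exact Cardinal.one_lt_two

theorem eventually_notMem_lattice (z : ℂ) : ∀ᶠ w in 𝓝[≠] z, w ∉ L.lattice := by
  filter_upwards [mem_nhdsWithin_of_mem_nhds (L.compl_lattice_sdiff_singleton_mem_nhds z),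
    self_mem_nhdsWithin] with w hw hwz hwl
  exact hw ⟨hwl, hwz⟩

theorem eventually_notMem_lattice_of_notMem {z : ℂ} (hz : z ∉ L.lattice) :
    ∀ᶠ w in 𝓝 z, w ∉ L.lattice :=
  L.isClosed_lattice.isOpen_compl.mem_nhds hz

theorem hasDerivAt_weierstrassP {z : ℂ} (hz : z ∉ L.lattice) :
    HasDerivAt L.weierstrassP (L.derivWeierstrassP z) z := by
  have h := (L.analyticOnNhd_weierstrassP z hz).differentiableAt.hasDerivAt
  rwa [L.deriv_weierstrassP] at h

/-- The complement of the countable lattice is connected, so a local zero set would spread up to the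
origin and contradict the triple pole there. -/
theorem not_eventually_derivWeierstrassP_eq_zero {z : ℂ} (hz : z ∉ L.lattice) :
    ¬ ∀ᶠ w in 𝓝 z, L.derivWeierstrassP w = 0 := by
  intro h
  have h1 := L.analyticOnNhd_derivWeierstrassP.eqOn_zero_of_preconnected_of_eventuallyEq_zero
    L.isPreconnected_compl_lattice hz h
  have h2 : Tendsto (fun z => z ^ 3 * L.derivWeierstrassP z) (𝓝[≠] 0) (𝓝 0) := by
    refine tendsto_const_nhds.congr' ?_
    filter_upwards [L.eventually_notMem_lattice 0] with w hw
    rw [h1 hw]; simp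
  have := tendsto_nhds_unique h2 L.tendsto_cube_mul_derivWeierstrassP
  norm_num at this

theorem eventually_derivWeierstrassP_ne_zero {z : ℂ} (hz : z ∉ L.lattice) :
    ∀ᶠ w in 𝓝[≠] z, L.derivWeierstrassP w ≠ 0 := by
  rcases (L.analyticOnNhd_derivWeierstrassP z hz).eventually_eq_zero_or_eventually_ne_zero with h | h
  · exact absurd h (L.not_eventually_derivWeierstrassP_eq_zero hz)
  · exact h

theorem eventually_weierstrassP_ne {z : ℂ} (hz : z ∉ L.lattice) (c : ℂ) :
    ∀ᶠ w in 𝓝[≠] z, L.weierstrassP w ≠ c := by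
  rcases ((L.analyticOnNhd_weierstrassP z hz).sub
    (analyticAt_const (v := c))).eventually_eq_zero_or_eventually_ne_zero with h | h
  · refine absurd ?_ (L.not_eventually_derivWeierstrassP_eq_zero hz)
    have h1 : L.weierstrassP =ᶠ[𝓝 z] fun _ => c := by
      filter_upwards [h] with w hw
      exact sub_eq_zero.mp hw
    filter_upwards [h1.deriv] with w hw
    rw [← L.deriv_weierstrassP, hw, deriv_const]
  · filter_upwards [h] with w hw
    exact sub_ne_zero.mp hw

/-- Differentiating the cubic equation gives the formula multiplied by 2℘'. Zeros of ℘' are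
isolated, so the formula extends to them by continuity. -/
theorem hasDerivAt_derivWeierstrassP {z : ℂ} (hz : z ∉ L.lattice) :
    HasDerivAt L.derivWeierstrassP (6 * L.weierstrassP z ^ 2 - L.g₂ / 2) z := by
  have hd := (L.analyticOnNhd_derivWeierstrassP z hz).differentiableAt.hasDerivAt
  have key : ∀ᶠ w in 𝓝[≠] z, deriv L.derivWeierstrassP w = 6 * L.weierstrassP w ^ 2 - L.g₂ / 2 := by
    filter_upwards [L.eventually_derivWeierstrassP_ne_zero hz, L.eventually_notMem_lattice z]
      with w hw hwl
    have h1 := (L.analyticOnNhd_derivWeierstrassP w hwl).differentiableAt.hasDerivAt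
    have h2 := L.hasDerivAt_weierstrassP hwl
    have h3 := (((h2.pow 3).const_mul 4).sub (h2.const_mul L.g₂)).sub_const L.g₃
    have h4 : (fun w => L.derivWeierstrassP w ^ 2) =ᶠ[𝓝 w]
        fun w => 4 * L.weierstrassP w ^ 3 - L.g₂ * L.weierstrassP w - L.g₃ := by
      filter_upwards [L.eventually_notMem_lattice_of_notMem hwl] with v hv
      exact L.derivWeierstrassP_sq v hv
    have h5 := (h1.pow 2).unique (h3.congr_of_eventuallyEq h4)
    refine mul_left_cancel₀ hw ?_
    simp only [Nat.cast_ofNat, Nat.reduceSub, pow_one] at h5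
    linear_combination h5 / 2
  have hc1 : Tendsto (deriv L.derivWeierstrassP) (𝓝[≠] z) (𝓝 (deriv L.derivWeierstrassP z)) :=
    (L.analyticOnNhd_derivWeierstrassP z hz).deriv.continuousAt.tendsto.mono_left nhdsWithin_le_nhds
  have hc2 : Tendsto (fun w => 6 * L.weierstrassP w ^ 2 - L.g₂ / 2) (𝓝[≠] z)
      (𝓝 (6 * L.weierstrassP z ^ 2 - L.g₂ / 2)) :=
    ((((L.analyticOnNhd_weierstrassP z hz).continuousAt.tendsto.pow 2).const_mul 6).sub_const
      _).mono_left nhdsWithin_le_nhds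
  rwa [tendsto_nhds_unique_of_eventuallyEq hc1 hc2 key] at hd

theorem derivWeierstrassP_eq_zero_of_two_mul_mem {h : ℂ} (hh : 2 * h ∈ L.lattice) :
    L.derivWeierstrassP h = 0 := by
  have h1 := L.derivWeierstrassP_add_coe (-h) ⟨2 * h, hh⟩
  rw [L.derivWeierstrassP_neg, show -h + 2 * h = h by ring] at h1
  linear_combination h1 / 2

theorem weierstrassP_add_mem {l : ℂ} (hl : l ∈ L.lattice) (z : ℂ) :
    L.weierstrassP (z + l) = L.weierstrassP z := L.weierstrassP_add_coe z ⟨l, hl⟩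

theorem derivWeierstrassP_add_mem {l : ℂ} (hl : l ∈ L.lattice) (z : ℂ) :
    L.derivWeierstrassP (z + l) = L.derivWeierstrassP z := L.derivWeierstrassP_add_coe z ⟨l, hl⟩

theorem meromorphic_weierstrassP_comp {f : ℂ → ℂ} (hf : ∀ z, AnalyticAt ℂ f z) :
    Meromorphic fun z => L.weierstrassP (f z) :=
  fun z => (L.meromorphic_weierstrassP (f z)).comp_analyticAt (hf z)

end PeriodPair

/-! ### Zeros of ℘' and the duplication formula. -/

namespace PeriodPair

open Filter Topology

variable (L : PeriodPair)

theorem tendsto_sub_nhdsNE (a : ℂ) : Tendsto (fun z : ℂ => z - a) (𝓝[≠] a) (𝓝[≠] 0) := by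
  refine tendsto_nhdsWithin_of_tendsto_nhds_of_eventually_within _ ?_ ?_
  · have : Continuous fun z : ℂ => z - a := by fun_prop
    simpa using (this.tendsto a).mono_left (nhdsWithin_le_nhds (s := {a}ᶜ))
  · filter_upwards [self_mem_nhdsWithin] with z hz
    exact sub_ne_zero.mpr hz

theorem tendsto_const_sub_nhdsNE (a : ℂ) : Tendsto (fun z : ℂ => a - z) (𝓝[≠] 0) (𝓝[≠] a) := by
  refine tendsto_nhdsWithin_of_tendsto_nhds_of_eventually_within _ ?_ ?_
  · have : Continuous fun z : ℂ => a - z := by fun_prop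
    simpa using (this.tendsto 0).mono_left (nhdsWithin_le_nhds (s := {0}ᶜ))
  · filter_upwards [self_mem_nhdsWithin] with z hz h
    refine hz ?_
    simp only [Set.mem_singleton_iff] at h ⊢
    linear_combination -h

theorem tendsto_two_mul_nhdsNE : Tendsto (fun z : ℂ => 2 * z) (𝓝[≠] 0) (𝓝[≠] 0) := by
  refine tendsto_nhdsWithin_of_tendsto_nhds_of_eventually_within _ ?_ ?_
  · have : Continuous fun z : ℂ => 2 * z := by fun_prop
    simpa using (this.tendsto 0).mono_left (nhdsWithin_le_nhds (s := {0}ᶜ))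
  · filter_upwards [self_mem_nhdsWithin] with z hz h
    refine hz ?_
    simpa using h

theorem exists_analyticAt_of_deriv_eq_zero {f : ℂ → ℂ} {a : ℂ} (hf : AnalyticAt ℂ f a)
    (hd : deriv f a = 0) :
    ∃ k : ℂ → ℂ, AnalyticAt ℂ k a ∧ ∀ᶠ z in 𝓝 a, f z - f a = (z - a) ^ 2 * k z := by
  have hfa : AnalyticAt ℂ (fun z => f z - f a) a := hf.sub analyticAt_const
  have h2 : ((2 : ℕ) : ℕ∞) ≤ analyticOrderAt (fun z => f z - f a) a := by
    rw [natCast_le_analyticOrderAt_iff_iteratedDeriv_eq_zero hfa]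
    intro i hi
    interval_cases i
    · simp
    · simp [iteratedDeriv_one, hd]
  obtain ⟨k, hk, h⟩ := (natCast_le_analyticOrderAt hfa).mp h2
  exact ⟨k, hk, by simpa [smul_eq_mul] using h⟩

/-- At a zero `a` of `℘'`, the translate of `℘ - ℘(a)` by `a` is a multiple of its inverse. -/
theorem exists_mul_translate_eq {a : ℂ} (ha : a ∉ L.lattice) (hd : L.derivWeierstrassP a = 0) :
    ∃ C : ℂ, C ≠ 0 ∧ 2 * C = 6 * L.weierstrassP a ^ 2 - L.g₂ / 2 ∧ ∀ z, ∀ᶠ w in 𝓝[≠] z,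
      (L.weierstrassP w - L.weierstrassP a) * (L.weierstrassP (w - a) - L.weierstrassP a) = C := by
  set c := L.weierstrassP a with hc
  obtain ⟨k, hk, hfk⟩ := exists_analyticAt_of_deriv_eq_zero (L.analyticOnNhd_weierstrassP a ha)
    (by rw [L.deriv_weierstrassP, hd])
  rw [← hc] at hfk
  -- Poles are possible only at 0 and a modulo the lattice. At a the double zero of ℘ - ℘(a) cancels
  -- the double pole of the translate, and w ↦ a - w carries this to 0. Nothing here presupposes
  -- that a is a half-period.
  set F : ℂ → ℂ := fun w => (L.weierstrassP w - c) * (L.weierstrassP (w - a) - c) with hF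
  have hFmer : Meromorphic F := by
    intro z
    exact ((L.meromorphic_weierstrassP z).sub (MeromorphicAt.const c z)).mul
      ((L.meromorphic_weierstrassP_comp (f := fun w => w - a) (fun z => by fun_prop) z).sub
        (MeromorphicAt.const c z))
  have hFper : ∀ l ∈ L.lattice, ∀ z, F (z + l) = F z := by
    intro l hl z
    simp only [hF]
    rw [L.weierstrassP_add_mem hl, show z + l - a = z - a + l by ring, L.weierstrassP_add_mem hl]
  have hlim_a : Tendsto F (𝓝[≠] a) (𝓝 (k a)) := by
    have h1 := L.tendsto_sq_mul_weierstrassP.comp (tendsto_sub_nhdsNE a)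
    have h2 : Tendsto (fun z : ℂ => (z - a) ^ 2 * c) (𝓝[≠] a) (𝓝 0) := by
      have : Continuous fun z : ℂ => (z - a) ^ 2 * c := by fun_prop
      simpa using (this.tendsto a).mono_left (nhdsWithin_le_nhds (s := {a}ᶜ))
    have h3 := (hk.continuousAt.tendsto.mono_left
      (nhdsWithin_le_nhds (s := {a}ᶜ))).mul (h1.sub h2)
    rw [sub_zero, mul_one] at h3
    refine h3.congr' ?_
    filter_upwards [hfk.filter_mono nhdsWithin_le_nhds] with z hz
    simp only [hF, Function.comp, hz]
    ring
  have hFrefl : ∀ z, F (a - z) = F z := by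
    intro z
    simp only [hF]
    rw [show a - z - a = -z by ring, L.weierstrassP_neg, ← L.weierstrassP_neg (a - z), neg_sub]
    ring
  have hlim_0 : Tendsto F (𝓝[≠] 0) (𝓝 (k a)) :=
    (hlim_a.comp (tendsto_const_sub_nhdsNE a)).congr fun z => hFrefl z
  have hord : ∀ z, 0 ≤ meromorphicOrderAt F z := by
    intro z
    by_cases hz : z ∈ L.lattice
    · have h1 := order_add_of_periodic (hFper z hz) 0
      rw [zero_add] at h1
      rw [h1]
      exact (tendsto_nhds_iff_meromorphicOrderAt_nonneg (hFmer 0)).mp ⟨_, hlim_0⟩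
    by_cases hza : z - a ∈ L.lattice
    · have h1 := order_add_of_periodic (hFper _ hza) a
      rw [add_sub_cancel] at h1
      rw [h1]
      exact (tendsto_nhds_iff_meromorphicOrderAt_nonneg (hFmer a)).mp ⟨_, hlim_a⟩
    · refine AnalyticAt.meromorphicOrderAt_nonneg ?_
      have h1 := L.analyticOnNhd_weierstrassP z hz
      have h2 : AnalyticAt ℂ (fun w => L.weierstrassP (w - a)) z :=
        (L.analyticOnNhd_weierstrassP (z - a) hza).comp (f := fun w => w - a) (by fun_prop)
      exact (h1.sub analyticAt_const).mul (h2.sub analyticAt_const)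
  obtain ⟨C, hC⟩ := L.exists_eventuallyEq_const hFmer hFper hord
  have hCk : C = k a := tendsto_nhds_unique (tendsto_const_nhds.congr'
    ((hC a).mono fun w hw => hw.symm)) hlim_a
  refine ⟨C, fun hC0 => ?_, ?_, hC⟩
  · have h1 := ((L.tendsto_weierstrassP_cobounded L.lattice.zero_mem).comp
      (tendsto_sub_nhdsNE a)).eventually_ne_cobounded c
    obtain ⟨w, h2, h3, h4⟩ := (h1.and ((hC a).and (L.eventually_weierstrassP_ne ha c))).exists
    rw [hC0] at h3
    exact mul_ne_zero (sub_ne_zero.mpr h4) (sub_ne_zero.mpr h2) h3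
  · have h1 := L.hasDerivAt_derivWeierstrassP ha
    rw [← hc] at h1
    -- From ℘ - ℘(a) = (z - a)²k(z) one reads off ℘''(a) = 2k(a), and k(a) is the constant C.
    have h2 : L.derivWeierstrassP =ᶠ[𝓝 a] fun z => 2 * (z - a) * k z + (z - a) ^ 2 * deriv k z := by
      have h3 := hfk.eventually_nhds
      filter_upwards [h3, hk.eventually_analyticAt, L.eventually_notMem_lattice_of_notMem ha]
        with z hz hkz hzl
      have h4 := (L.hasDerivAt_weierstrassP hzl).sub_const c
      have h5 := (((hasDerivAt_id z).sub_const a).pow 2).mul hkz.differentiableAt.hasDerivAt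
      have h6 := h4.unique (h5.congr_of_eventuallyEq hz)
      simpa using h6
    have h3 : HasDerivAt (fun z => 2 * (z - a) * k z + (z - a) ^ 2 * deriv k z) (2 * k a) a := by
      have h4 := ((((hasDerivAt_id a).sub_const a).const_mul 2).mul
        hk.differentiableAt.hasDerivAt).add
        ((((hasDerivAt_id a).sub_const a).pow 2).mul hk.deriv.differentiableAt.hasDerivAt)
      refine HasDerivAt.congr_deriv h4 ?_
      simp
    rw [hCk]
    exact (h3.congr_of_eventuallyEq h2).unique h1

/-- The zeros of `℘'` are half-periods. -/
theorem two_mul_mem_of_derivWeierstrassP_eq_zero {a : ℂ} (ha : a ∉ L.lattice)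
    (hd : L.derivWeierstrassP a = 0) : 2 * a ∈ L.lattice := by
  by_contra h2a
  obtain ⟨C, hC0, -, hC⟩ := L.exists_mul_translate_eq ha hd
  set c := L.weierstrassP a
  -- By evenness the translate by -a satisfies the same identity. Hence ℘(w - a) = ℘(w + a) near a;
  -- the left side has a pole at w = a, the right side has none unless 2a is a period.
  have hneg : ∀ᶠ w in 𝓝[≠] a, (L.weierstrassP w - c) * (L.weierstrassP (w + a) - c) = C := by
    have h1 : Tendsto (fun w : ℂ => -w) (𝓝[≠] a) (𝓝[≠] (-a)) := by
      refine tendsto_nhdsWithin_of_tendsto_nhds_of_eventually_within _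
        ((continuous_neg.tendsto a).mono_left nhdsWithin_le_nhds) ?_
      filter_upwards [self_mem_nhdsWithin] with z hz h
      exact hz (neg_injective h)
    filter_upwards [h1.eventually (hC (-a))] with w hw
    rwa [show -w - a = -(w + a) by ring, L.weierstrassP_neg, L.weierstrassP_neg] at hw
  have h1 : Tendsto (fun w => L.weierstrassP (w - a)) (𝓝[≠] a) (Bornology.cobounded ℂ) :=
    (L.tendsto_weierstrassP_cobounded L.lattice.zero_mem).comp (tendsto_sub_nhdsNE a)
  have h2 : Tendsto (fun w => L.weierstrassP (w + a)) (𝓝[≠] a) (𝓝 (L.weierstrassP (2 * a))) := by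
    have h3 : Tendsto (fun w : ℂ => w + a) (𝓝[≠] a) (𝓝 (2 * a)) := by
      rw [two_mul]
      exact ((continuous_add_const a).tendsto a).mono_left nhdsWithin_le_nhds
    exact (L.analyticOnNhd_weierstrassP _ h2a).continuousAt.tendsto.comp h3
  have h3 : Tendsto (fun w => L.weierstrassP (w - a)) (𝓝[≠] a) (𝓝 (L.weierstrassP (2 * a))) := by
    refine h2.congr' ?_
    filter_upwards [hneg, hC a] with w h4 h5
    have h6 : L.weierstrassP w - c ≠ 0 := fun h => hC0 (by rw [← h4, h, zero_mul])
    have h7 := mul_left_cancel₀ h6 (h4.trans h5.symm)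
    linear_combination h7
  exact h3.not_tendsto (Metric.disjoint_nhds_cobounded _) h1

theorem derivWeierstrassP_eq_zero_iff {a : ℂ} (ha : a ∉ L.lattice) :
    L.derivWeierstrassP a = 0 ↔ 2 * a ∈ L.lattice :=
  ⟨L.two_mul_mem_of_derivWeierstrassP_eq_zero ha, L.derivWeierstrassP_eq_zero_of_two_mul_mem⟩

theorem notMem_lattice_of_two_mul {a : ℂ} (ha : 2 * a ∉ L.lattice) : a ∉ L.lattice := by
  intro h
  refine ha ?_
  rw [two_mul]
  exact L.lattice.add_mem h h

/-- The duplication formula for `℘`. -/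
theorem weierstrassP_two_mul {u : ℂ} (hu : 2 * u ∉ L.lattice) :
    L.weierstrassP (2 * u) * L.derivWeierstrassP u ^ 2 =
      (L.weierstrassP u ^ 2 + L.g₂ / 4) ^ 2 + 2 * L.g₃ * L.weierstrassP u := by
  set num : ℂ → ℂ := fun u => (L.weierstrassP u ^ 2 + L.g₂ / 4) ^ 2 + 2 * L.g₃ * L.weierstrassP u
    with hnum
  set g : ℂ → ℂ := fun u => L.weierstrassP (2 * u) - num u / L.derivWeierstrassP u ^ 2 with hg
  have hPm := L.meromorphic_weierstrassP
  have hDm := L.meromorphic_derivWeierstrassP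
  have hnumm : Meromorphic num := by
    simp only [hnum]
    fun_prop
  have hgm : Meromorphic g := fun z =>
    (L.meromorphic_weierstrassP_comp (f := fun u => 2 * u) (fun z => by fun_prop) z).sub
      ((hnumm z).div ((hDm z).pow 2))
  have hgper : ∀ l ∈ L.lattice, ∀ z, g (z + l) = g z := by
    intro l hl z
    simp only [hg, hnum]
    rw [L.weierstrassP_add_mem hl, L.derivWeierstrassP_add_mem hl, mul_add, two_mul l, ← add_assoc,
      L.weierstrassP_add_mem hl, L.weierstrassP_add_mem hl]
  have hlim0 : Tendsto g (𝓝[≠] 0) (𝓝 0) := by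
    -- With E the regular part of ℘ at 0, the cubic equation turns g into E(2z) - E(z)/4 minus a
    -- quotient whose numerator tends to 0 after clearing poles.
    have hE : Tendsto (L.weierstrassPExcept 0) (𝓝[≠] 0) (𝓝 0) :=
      L.tendsto_weierstrassPExcept_zero.mono_left nhdsWithin_le_nhds
    have hE2 := hE.comp tendsto_two_mul_nhdsNE
    have hx := L.tendsto_sq_mul_weierstrassP
    have hp := L.tendsto_cube_mul_derivWeierstrassP
    have hz : Tendsto (fun z : ℂ => z) (𝓝[≠] 0) (𝓝 0) := tendsto_id.mono_left nhdsWithin_le_nhds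
    have hT := ((((hz.pow 2).mul (hx.pow 2)).const_mul (3 / 4 * L.g₂)).add
      (((hz.pow 4).mul hx).const_mul (9 / 4 * L.g₃))).add ((hz.pow 6).mul_const (L.g₂ ^ 2 / 16))
    have hR := hT.div (hp.pow 2) (by norm_num)
    have h := (hE2.sub (hE.const_mul (1 / 4))).sub hR
    norm_num at h
    refine h.congr' ?_
    filter_upwards [self_mem_nhdsWithin, L.eventually_notMem_lattice 0,
      (hp.eventually_ne (by norm_num : (-2 : ℂ) ≠ 0))] with z hz0 hzl hpz
    have hz0 : z ≠ 0 := hz0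
    have hp0 : L.derivWeierstrassP z ≠ 0 := right_ne_zero_of_mul hpz
    have hsq := L.derivWeierstrassP_sq z hzl
    have h1 := L.weierstrassP_eq_add (2 * z)
    have h2 := L.weierstrassP_eq_add z
    simp only [hg, hnum, h1]
    have h3 : L.weierstrassPExcept 0 z = L.weierstrassP z - 1 / z ^ 2 := by rw [h2]; ring
    rw [h3]
    generalize L.weierstrassP z = x at *
    generalize L.derivWeierstrassP z = p at *
    field_simp
    linear_combination (-256 * x * z ^ 2) * hsq
  -- Half-periods are centres of symmetry of g, so it suffices to cancel the double poles there.
  have hcenter : ∀ h, 2 * h ∈ L.lattice → ∀ z, g (2 * h - z) = g z := by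
    intro h hh z
    simp only [hg, hnum]
    rw [show 2 * (2 * h - z) = -(2 * z) + 2 * h + 2 * h by ring, L.weierstrassP_add_mem hh,
      L.weierstrassP_add_mem hh, show 2 * h - z = -z + 2 * h by ring, L.weierstrassP_add_mem hh,
      L.derivWeierstrassP_add_mem hh, L.weierstrassP_neg, L.weierstrassP_neg,
      L.derivWeierstrassP_neg, neg_sq]
  have hord : ∀ z, 0 ≤ meromorphicOrderAt g z := by
    intro z
    by_cases hz : z ∈ L.lattice
    · have h1 := order_add_of_periodic (hgper z hz) 0
      rw [zero_add] at h1
      rw [h1]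
      exact (tendsto_nhds_iff_meromorphicOrderAt_nonneg (hgm 0)).mp ⟨_, hlim0⟩
    by_cases hz2 : 2 * z ∈ L.lattice
    · refine order_nonneg_of_symmetric (hgm z) (hcenter z hz2) ?_
      have hd := L.derivWeierstrassP_eq_zero_of_two_mul_mem hz2
      obtain ⟨C, hC0, hC, -⟩ := L.exists_mul_translate_eq hz hd
      have h1 := (L.tendsto_sq_mul_weierstrassP.comp
        (tendsto_two_mul_nhdsNE.comp (tendsto_sub_nhdsNE z))).const_mul (1 / 4)
      have hder := hasDerivAt_iff_tendsto_slope.mp (L.hasDerivAt_derivWeierstrassP hz)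
      rw [← hC] at hder
      have hnumc : Tendsto num (𝓝[≠] z) (𝓝 (num z)) := by
        have hPc := (L.analyticOnNhd_weierstrassP z hz).continuousAt
        have : ContinuousAt num z := by simp only [hnum]; fun_prop
        exact this.tendsto.mono_left nhdsWithin_le_nhds
      have h2 := hnumc.div (hder.pow 2) (by simpa using hC0)
      have h3 := h1.sub h2
      -- At a half-period ℘(2w) ~ 1/(4(w - z)²) and ℘'(w) ~ 2C(w - z); the leading coefficients
      -- agree because ℘(z) is a root of the cubic.
      have hval : 1 / 4 * 1 - num z / (2 * C) ^ 2 = 0 := by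
        have hsq := L.derivWeierstrassP_sq z hz
        rw [hd] at hsq
        rw [sub_eq_zero, eq_div_iff (by simpa using hC0), hC]
        simp only [hnum]
        linear_combination (-2 * L.weierstrassP z) * hsq
      rw [hval] at h3
      refine h3.congr' ?_
      filter_upwards [self_mem_nhdsWithin, L.eventually_derivWeierstrassP_ne_zero hz] with w hw hw0
      have hwz : w - z ≠ 0 := sub_ne_zero.mpr hw
      have h4 : L.weierstrassP (2 * w) = L.weierstrassP (2 * (w - z)) := by
        rw [← L.weierstrassP_add_mem hz2 (2 * (w - z))]; congr 1; ring
      simp only [Function.comp, hg, h4, Pi.div_apply, slope_def_field, hd, sub_zero]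
      field_simp
      ring
    · refine AnalyticAt.meromorphicOrderAt_nonneg ?_
      have h1 := L.analyticOnNhd_weierstrassP z hz
      have h2 := L.analyticOnNhd_derivWeierstrassP z hz
      have h3 : AnalyticAt ℂ (fun w => L.weierstrassP (2 * w)) z :=
        (L.analyticOnNhd_weierstrassP (2 * z) hz2).comp (f := fun w => 2 * w) (by fun_prop)
      have h4 : L.derivWeierstrassP z ≠ 0 := fun h => hz2 ((L.derivWeierstrassP_eq_zero_iff hz).mp h)
      simp only [hg, hnum]
      have h5 : L.derivWeierstrassP z ^ 2 ≠ 0 := pow_ne_zero 2 h4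
      fun_prop (disch := assumption)
  obtain ⟨C, hC⟩ := L.exists_eventuallyEq_const hgm hgper hord
  have hC0 : C = 0 := tendsto_nhds_unique (tendsto_const_nhds.congr'
    ((hC 0).mono fun w hw => hw.symm)) hlim0
  have hu1 := L.notMem_lattice_of_two_mul hu
  have h4 : L.derivWeierstrassP u ≠ 0 := fun h => hu ((L.derivWeierstrassP_eq_zero_iff hu1).mp h)
  have hcont : ContinuousAt g u := by
    have h1 := (L.analyticOnNhd_weierstrassP u hu1).continuousAt
    have h2 := (L.analyticOnNhd_derivWeierstrassP u hu1).continuousAt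
    have h3 : ContinuousAt (fun w => L.weierstrassP (2 * w)) u :=
      ContinuousAt.comp (f := fun w => 2 * w) (L.analyticOnNhd_weierstrassP (2 * u) hu).continuousAt
        (by fun_prop)
    have h5 : L.derivWeierstrassP u ^ 2 ≠ 0 := pow_ne_zero 2 h4
    simp only [hg, hnum]
    fun_prop (disch := assumption)
  have h6 : g u = 0 := by
    have h7 : Tendsto g (𝓝[≠] u) (𝓝 (g u)) := hcont.tendsto.mono_left nhdsWithin_le_nhds
    rw [← hC0]
    exact tendsto_nhds_unique h7 (tendsto_const_nhds.congr' ((hC u).mono fun w hw => hw.symm))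
  simp only [hg] at h6
  rwa [sub_eq_zero, eq_div_iff (pow_ne_zero 2 h4)] at h6

end PeriodPair

open Filter Topology

/-! ### ℘ through theta functions, and the half-period values for i and ϱ. -/

theorem mem_lattice_torusPeriods {μ : UpperHalfPlane} {l : ℂ} :
    l ∈ (torusPeriods μ).lattice ↔ ∃ m n : ℤ, l = 2 * m + 2 * n * μ := by
  rw [PeriodPair.mem_lattice]
  refine exists_congr fun m => exists_congr fun n => ?_
  rw [show (torusPeriods μ).ω₁ = 2 from rfl, show (torusPeriods μ).ω₂ = 2 * (μ : ℂ) from rfl, eq_comm]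
  constructor <;> intro h <;> linear_combination h

theorem int_add_mul_eq_zero {μ : UpperHalfPlane} {a b : ℝ} (h : (a : ℂ) + b * μ = 0) :
    a = 0 ∧ b = 0 := by
  have him := congrArg Complex.im h
  have hre := congrArg Complex.re h
  have hμ : (μ : ℂ).im ≠ 0 := μ.im_pos.ne'
  simp only [add_im, ofReal_im, im_ofReal_mul, zero_add, zero_im, mul_eq_zero, add_re, ofReal_re,
    re_ofReal_mul, zero_re] at him hre
  have hb : b = 0 := him.resolve_right hμ
  exact ⟨by simpa [hb] using hre, hb⟩

theorem int_add_int_mul_mem_iff {μ : UpperHalfPlane} (a b : ℤ) :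
    (a : ℂ) + b * μ ∈ (torusPeriods μ).lattice ↔ Even a ∧ Even b := by
  rw [mem_lattice_torusPeriods]
  constructor
  · rintro ⟨m, n, h⟩
    have h1 := int_add_mul_eq_zero (μ := μ) (a := a - 2 * m) (b := b - 2 * n)
      (by push_cast; linear_combination h)
    have h2 : a = 2 * m := by exact_mod_cast sub_eq_zero.mp h1.1
    have h3 : b = 2 * n := by exact_mod_cast sub_eq_zero.mp h1.2
    exact ⟨by rw [h2]; exact even_two_mul m, by rw [h3]; exact even_two_mul n⟩
  · rintro ⟨⟨m, hm⟩, ⟨n, hn⟩⟩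
    exact ⟨m, n, by rw [hm, hn]; push_cast; ring⟩

theorem one_notMem_lattice (μ : UpperHalfPlane) : (1 : ℂ) ∉ (torusPeriods μ).lattice := by
  have h := (int_add_int_mul_mem_iff (μ := μ) 1 0).not
  simpa using h

theorem coe_notMem_lattice (μ : UpperHalfPlane) : (μ : ℂ) ∉ (torusPeriods μ).lattice := by
  have h := (int_add_int_mul_mem_iff (μ := μ) 0 1).not
  simpa using h

theorem one_add_coe_notMem_lattice (μ : UpperHalfPlane) :
    (1 + μ : ℂ) ∉ (torusPeriods μ).lattice := by
  have h := (int_add_int_mul_mem_iff (μ := μ) 1 1).not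
  simpa using h

theorem two_mul_one_mem_lattice (μ : UpperHalfPlane) : 2 * (1 : ℂ) ∈ (torusPeriods μ).lattice :=
  mem_lattice_torusPeriods.mpr ⟨1, 0, by simp⟩

theorem two_mul_coe_mem_lattice (μ : UpperHalfPlane) : 2 * (μ : ℂ) ∈ (torusPeriods μ).lattice :=
  mem_lattice_torusPeriods.mpr ⟨0, 1, by simp⟩

theorem two_mul_one_add_coe_mem_lattice (μ : UpperHalfPlane) :
    2 * (1 + μ : ℂ) ∈ (torusPeriods μ).lattice :=
  mem_lattice_torusPeriods.mpr ⟨1, 1, by push_cast; ring⟩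

theorem periodic_of_generators {μ : UpperHalfPlane} {g : ℂ → ℂ} (h1 : ∀ z, g (z + 2) = g z)
    (h2 : ∀ z, g (z + 2 * μ) = g z) : ∀ l ∈ (torusPeriods μ).lattice, ∀ z, g (z + l) = g z := by
  intro l hl
  induction hl using Submodule.span_induction with
  | mem x hx =>
    rcases hx with rfl | rfl
    · exact h1
    · exact h2
  | zero => simp
  | add x y _ _ hx hy => intro z; rw [← add_assoc, hy, hx]
  | smul n x _ hx =>
    have hn : ∀ k : ℕ, ∀ z, g (z + k * x) = g z := by
      intro k
      induction k with
      | zero => simp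
      | succ k ih => intro z; rw [← ih z, ← hx (z + k * x)]; congr 1; push_cast; ring
    intro z
    rw [zsmul_eq_mul]
    rcases Int.eq_nat_or_neg n with ⟨k, rfl | rfl⟩
    · simpa using hn k z
    · rw [← hn k]; congr 1; push_cast; ring

/-- The quotient `θ₃ / θ₁` at `u / 2`. -/
def thetaRatio (μ : UpperHalfPlane) (u : ℂ) : ℂ := jacobiTheta₂ (u / 2) μ / thetaOdd μ (u / 2)

theorem thetaRatio_eq (μ : UpperHalfPlane) (u : ℂ) :
    theta3 (u / 2) μ / theta1 (u / 2) μ = thetaRatio μ u := by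
  rw [theta3_eq, theta1_eq, thetaRatio]

/-- The quotient itself changes sign under u ↦ u + 2 and u ↦ u + 2μ; this is why Ξ needs both signs
to live on the torus. -/
theorem thetaRatio_sq_periodic (μ : UpperHalfPlane) :
    ∀ l ∈ (torusPeriods μ).lattice, ∀ u, thetaRatio μ (u + l) ^ 2 = thetaRatio μ u ^ 2 := by
  refine periodic_of_generators (g := fun u => thetaRatio μ u ^ 2) (fun u => ?_) fun u => ?_
  · simp only [thetaRatio, show (u + 2) / 2 = u / 2 + 1 by ring, jacobiTheta₂_add_left,
      thetaOdd_add_one, div_neg, neg_sq]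
  · simp only [thetaRatio, show (u + 2 * μ) / 2 = u / 2 + μ by ring, jacobiTheta₂_add_left',
      thetaOdd_add_self, neg_mul, div_neg, neg_sq]
    rw [mul_div_mul_left _ _ (Complex.exp_ne_zero _)]

theorem thetaRatio_neg (μ : UpperHalfPlane) (u : ℂ) : thetaRatio μ (-u) = -thetaRatio μ u := by
  rw [thetaRatio, thetaRatio, neg_div, jacobiTheta₂_neg_left, thetaOdd_neg, div_neg]

theorem thetaOdd_ne_zero {μ : UpperHalfPlane} (hμ : 1 ≤ μ.im) {u : ℂ}
    (hu : u ∉ (torusPeriods μ).lattice) : thetaOdd μ (u / 2) ≠ 0 := by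
  intro h
  obtain ⟨m, n, hmn⟩ := exists_int_add_of_thetaOdd_eq_zero hμ h
  exact hu (mem_lattice_torusPeriods.mpr ⟨m, n, by linear_combination 2 * hmn⟩)

theorem differentiable_jacobiTheta₂_half (μ : UpperHalfPlane) :
    Differentiable ℂ fun u : ℂ => jacobiTheta₂ (u / 2) μ := fun u =>
  (differentiableAt_jacobiTheta₂_fst (u / 2) μ.im_pos).comp u (f := fun u : ℂ => u / 2) (by fun_prop)

theorem differentiable_thetaOdd_half (μ : UpperHalfPlane) :
    Differentiable ℂ fun u : ℂ => thetaOdd μ (u / 2) :=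
  (differentiable_thetaOdd μ.im_pos).comp (f := fun u : ℂ => u / 2) (by fun_prop)

theorem analyticAt_thetaRatio {μ : UpperHalfPlane} (hμ : 1 ≤ μ.im) {u : ℂ}
    (hu : u ∉ (torusPeriods μ).lattice) : AnalyticAt ℂ (thetaRatio μ) u :=
  ((differentiable_jacobiTheta₂_half μ).analyticAt u).div
    ((differentiable_thetaOdd_half μ).analyticAt u) (thetaOdd_ne_zero hμ hu)

/-- Jacobi's formula enters here: the factor ϑ₃ of θ₁'(0) cancels the value of the numerator. -/
theorem tendsto_mul_thetaRatio {μ : UpperHalfPlane} (hμ : 1 ≤ μ.im) :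
    Tendsto (fun u => u * thetaRatio μ u) (𝓝[≠] 0)
      (𝓝 (2 / (Real.pi * (thetaNull2 μ * thetaNull4 μ)))) := by
  have h2 := thetaNull2_ne_zero (τ := μ) hμ
  have h3 := thetaNull3_ne_zero (τ := μ) hμ
  have h4 := thetaNull4_ne_zero (τ := μ) hμ
  have hpi : (Real.pi : ℂ) ≠ 0 := by exact_mod_cast Real.pi_ne_zero
  have hd : HasDerivAt (fun u : ℂ => thetaOdd μ (u / 2))
      (Real.pi * (thetaNull2 μ * thetaNull3 μ * thetaNull4 μ) * (1 / 2)) 0 := by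
    have h : HasDerivAt (thetaOdd μ) (Real.pi * (thetaNull2 μ * thetaNull3 μ * thetaNull4 μ))
        ((0 : ℂ) / 2) := by
      rw [zero_div, ← deriv_thetaOdd_zero hμ]
      exact (differentiable_thetaOdd μ.im_pos 0).hasDerivAt
    exact h.comp 0 ((hasDerivAt_id (0 : ℂ)).div_const 2)
  have hs := hasDerivAt_iff_tendsto_slope.mp hd
  have hn : Tendsto (fun u : ℂ => jacobiTheta₂ (u / 2) μ) (𝓝[≠] 0) (𝓝 (thetaNull3 μ)) := by
    have h := ((differentiable_jacobiTheta₂_half μ).continuous.tendsto 0).mono_left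
      (nhdsWithin_le_nhds (s := {0}ᶜ))
    rwa [zero_div] at h
  have h := hn.div hs (by simp [h2, h3, h4, hpi])
  have hval : thetaNull3 μ / (Real.pi * (thetaNull2 μ * thetaNull3 μ * thetaNull4 μ) * (1 / 2)) =
      2 / (Real.pi * (thetaNull2 μ * thetaNull4 μ)) := by
    field_simp
  rw [hval] at h
  refine h.congr' ?_
  filter_upwards [self_mem_nhdsWithin] with u hu
  have hu0 : u ≠ 0 := hu
  rw [Pi.div_apply, slope_def_field, zero_div, thetaOdd_zero, sub_zero, sub_zero, thetaRatio,
    div_div_eq_mul_div]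
  ring

/-- `℘` in terms of theta functions. -/
theorem weierstrassP_sub_eq_thetaRatio_sq {μ : UpperHalfPlane} (hμ : 1 ≤ μ.im) {u : ℂ}
    (hu : u ∉ (torusPeriods μ).lattice) :
    (torusPeriods μ).weierstrassP u - (torusPeriods μ).weierstrassP (1 + μ) =
      (Real.pi * (thetaNull2 μ * thetaNull4 μ) / 2) ^ 2 * thetaRatio μ u ^ 2 := by
  set L := torusPeriods μ with hL
  set A : ℂ := Real.pi * (thetaNull2 μ * thetaNull4 μ) / 2 with hA
  have hA0 : A ≠ 0 := by
    simp [hA, thetaNull2_ne_zero (τ := μ) hμ, thetaNull4_ne_zero (τ := μ) hμ, Real.pi_ne_zero]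
  set g : ℂ → ℂ := fun u => L.weierstrassP u - A ^ 2 * thetaRatio μ u ^ 2 with hg
  have hRm : Meromorphic (thetaRatio μ) := fun z =>
    ((differentiable_jacobiTheta₂_half μ).analyticAt z).meromorphicAt.div
      ((differentiable_thetaOdd_half μ).analyticAt z).meromorphicAt
  have hgm : Meromorphic g := fun z =>
    (L.meromorphic_weierstrassP z).sub ((MeromorphicAt.const _ z).mul ((hRm z).pow 2))
  have hgper : ∀ l ∈ L.lattice, ∀ z, g (z + l) = g z := by
    intro l hl z
    simp only [hg]
    rw [L.weierstrassP_add_mem hl, thetaRatio_sq_periodic μ l hl]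
  have hgan : ∀ z ∉ L.lattice, AnalyticAt ℂ g z := by
    intro z hz
    have h1 := L.analyticOnNhd_weierstrassP z hz
    have h2 := analyticAt_thetaRatio hμ hz
    exact h1.sub (analyticAt_const.mul (h2.pow 2))
  have hord : ∀ z, 0 ≤ meromorphicOrderAt g z := by
    intro z
    by_cases hz : z ∈ L.lattice
    · have h1 := PeriodPair.order_add_of_periodic (hgper z hz) 0
      rw [zero_add] at h1
      rw [h1]
      -- As g is even, matching the coefficients of u⁻² is enough at the origin.
      refine PeriodPair.order_nonneg_of_symmetric (hgm 0) (fun z => ?_) ?_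
      · simp only [hg]
        rw [mul_zero, zero_sub, L.weierstrassP_neg, thetaRatio_neg, neg_sq]
      · have h2 := L.tendsto_sq_mul_weierstrassP.sub
          (((tendsto_mul_thetaRatio hμ).pow 2).const_mul (A ^ 2))
        have hval : (1 : ℂ) - A ^ 2 * (2 / (Real.pi * (thetaNull2 μ * thetaNull4 μ))) ^ 2 = 0 := by
          rw [show (Real.pi * (thetaNull2 μ * thetaNull4 μ) : ℂ) = 2 * A by rw [hA]; ring]
          field_simp
          ring
        rw [hval] at h2
        refine h2.congr fun z => ?_
        simp only [hg, sub_zero]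
        ring
    · exact (hgan z hz).meromorphicOrderAt_nonneg
  obtain ⟨C, hC⟩ := L.exists_eventuallyEq_const hgm hgper hord
  have hval : ∀ z ∉ L.lattice, g z = C := fun z hz =>
    tendsto_nhds_unique ((hgan z hz).continuousAt.tendsto.mono_left nhdsWithin_le_nhds)
      (tendsto_const_nhds.congr' ((hC z).mono fun w hw => hw.symm))
  -- The zero of θ₃ at (1 + μ)/2 identifies the additive constant as ℘(1 + μ).
  have h0 : thetaRatio μ (1 + μ) = 0 := by
    rw [thetaRatio, add_div, jacobiTheta₂_half_period, zero_div]
  have h1 := hval u hu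
  rw [← hval (1 + μ) (one_add_coe_notMem_lattice μ)] at h1
  simp only [hg, h0] at h1
  linear_combination h1

theorem thetaRatio_one (μ : UpperHalfPlane) : thetaRatio μ 1 = thetaNull4 μ / thetaNull2 μ := by
  rw [thetaRatio, thetaOdd_half, thetaNull4]

theorem thetaRatio_coe_sq (μ : UpperHalfPlane) :
    thetaRatio μ μ ^ 2 = -(thetaNull2 μ / thetaNull4 μ) ^ 2 := by
  have h1 : thetaNull2 μ = exp (Real.pi * I * μ / 4) * jacobiTheta₂ (μ / 2) μ := rfl
  have h2 : exp (Real.pi * I * μ / 4) * thetaOdd μ (μ / 2) = I * thetaNull4 μ := by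
    rw [thetaOdd, show (μ : ℂ) / 2 + 1 / 2 + μ / 2 = 1 / 2 + μ by ring, jacobiTheta₂_add_left',
      thetaNull4, ← mul_assoc, ← mul_assoc]
    congr 1
    rw [show exp (Real.pi * I * μ / 4) * (-I * exp (Real.pi * I * μ / 4 + Real.pi * I * (μ / 2))) *
      exp (-Real.pi * I * (μ + 2 * (1 / 2))) = -I * (exp (Real.pi * I * μ / 4) *
      exp (Real.pi * I * μ / 4 + Real.pi * I * (μ / 2)) *
      exp (-Real.pi * I * (μ + 2 * (1 / 2)))) by ring, ← Complex.exp_add, ← Complex.exp_add,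
      show Real.pi * I * μ / 4 + (Real.pi * I * μ / 4 + Real.pi * I * (μ / 2)) +
      -Real.pi * I * (μ + 2 * (1 / 2)) = -(Real.pi * I) by ring, Complex.exp_neg,
      Complex.exp_pi_mul_I]
    norm_num
  rw [thetaRatio, ← mul_div_mul_left _ _ (Complex.exp_ne_zero (Real.pi * I * μ / 4)), h2, ← h1,
    div_pow, mul_pow, I_sq, div_pow]
  rw [neg_one_mul, div_neg]

theorem weierstrassP_one_sub {μ : UpperHalfPlane} (hμ : 1 ≤ μ.im) :
    (torusPeriods μ).weierstrassP 1 - (torusPeriods μ).weierstrassP (1 + μ) =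
      Real.pi ^ 2 * thetaNull4 μ ^ 4 / 4 := by
  have h2 := thetaNull2_ne_zero (τ := μ) hμ
  rw [weierstrassP_sub_eq_thetaRatio_sq hμ (one_notMem_lattice μ), thetaRatio_one]
  field_simp
  ring

theorem weierstrassP_one_add_sub {μ : UpperHalfPlane} (hμ : 1 ≤ μ.im) :
    (torusPeriods μ).weierstrassP (1 + μ) - (torusPeriods μ).weierstrassP μ =
      Real.pi ^ 2 * thetaNull2 μ ^ 4 / 4 := by
  have h4 := thetaNull4_ne_zero (τ := μ) hμ
  have h := weierstrassP_sub_eq_thetaRatio_sq hμ (coe_notMem_lattice μ)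
  rw [thetaRatio_coe_sq] at h
  rw [← neg_sub, h]
  field_simp
  ring

theorem neg_conj_coe {μ : UpperHalfPlane} (hre : μ.re = 0) :
    -(starRingEnd ℂ) (μ : ℂ) = μ := by
  apply Complex.ext
  · have : (μ : ℂ).re = 0 := hre
    rw [Complex.neg_re, Complex.conj_re, this, neg_zero]
  · simp

theorem exists_real_thetaNull4 {μ : UpperHalfPlane} (hre : μ.re = 0) :
    ∃ a : ℝ, thetaNull4 μ = a := by
  refine Complex.conj_eq_iff_real.mp ?_
  rw [thetaNull4, jacobiTheta₂_conj, neg_conj_coe hre]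
  simp [map_ofNat]

theorem exists_real_thetaNull2 {μ : UpperHalfPlane} (hre : μ.re = 0) :
    ∃ a : ℝ, thetaNull2 μ = a := by
  refine Complex.conj_eq_iff_real.mp ?_
  have h := neg_conj_coe hre
  have h' : (starRingEnd ℂ) (μ : ℂ) = -μ := by rw [← h, neg_neg]; simp [h]
  rw [thetaNull2, map_mul, jacobiTheta₂_conj, h, ← Complex.exp_conj]
  congr 1
  · congr 1
    simp [h', map_ofNat]
  · rw [← jacobiTheta₂_neg_left]
    congr 1
    simp [h', neg_div, map_ofNat]

/-- The gaps `e₁ - e₂` and `e₂ - e₃` between the values of `℘` at the half-periods. -/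
theorem exists_real_gaps {μ : UpperHalfPlane} (hre : μ.re = 0) (hμ : 1 ≤ μ.im) :
    ∃ A B : ℝ, 0 < A ∧ 0 < B ∧ B < 8 * A ∧
      (torusPeriods μ).weierstrassP 1 - (torusPeriods μ).weierstrassP (1 + μ) = A ∧
      (torusPeriods μ).weierstrassP (1 + μ) - (torusPeriods μ).weierstrassP μ = B := by
  obtain ⟨a, ha⟩ := exists_real_thetaNull4 hre
  obtain ⟨b, hb⟩ := exists_real_thetaNull2 hre
  have ha0 := thetaNull4_ne_zero (τ := μ) hμ
  have hb0 := thetaNull2_ne_zero (τ := μ) hμ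
  have ha1 := norm_thetaNull4_ge (τ := μ) hμ
  have hb1 := norm_thetaNull2_le (τ := μ) hμ
  rw [ha] at ha0 ha1
  rw [hb] at hb0 hb1
  have ha0' : a ≠ 0 := by exact_mod_cast ha0
  have hb0' : b ≠ 0 := by exact_mod_cast hb0
  rw [Complex.norm_real, Real.norm_eq_abs] at ha1 hb1
  have ha2 : (17 / 19 : ℝ) ^ 4 ≤ a ^ 4 := by
    rw [← Even.pow_abs (by decide : Even 4) a]; gcongr
  have hb2 : b ^ 4 ≤ (5 / 4 : ℝ) ^ 4 := by
    rw [← Even.pow_abs (by decide : Even 4) b]; gcongr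
  have hpi := Real.pi_pos
  refine ⟨Real.pi ^ 2 * a ^ 4 / 4, Real.pi ^ 2 * b ^ 4 / 4, by positivity, by positivity, ?_, ?_, ?_⟩
  -- This crude numerical inequality is the only place where size matters; it excludes the gap ratio
  -- A/B = 1/8 in `gap_eq_of_kleinJ`.
  · have h3 : b ^ 4 < 8 * a ^ 4 := by
      have : (5 / 4 : ℝ) ^ 4 < 8 * (17 / 19 : ℝ) ^ 4 := by norm_num
      linarith
    have h4 : 0 < Real.pi ^ 2 := by positivity
    nlinarith
  · rw [weierstrassP_one_sub hμ, ha]; push_cast; rfl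
  · rw [weierstrassP_one_add_sub hμ, hb]; push_cast; rfl

theorem weierstrassP_cubic_root (L : PeriodPair) {h : ℂ} (hh : h ∉ L.lattice)
    (h2 : 2 * h ∈ L.lattice) : 4 * L.weierstrassP h ^ 3 - L.g₂ * L.weierstrassP h - L.g₃ = 0 := by
  rw [← L.derivWeierstrassP_sq h hh, L.derivWeierstrassP_eq_zero_of_two_mul_mem h2]
  simp

theorem cubic_coeffs {e₁ e₂ e₃ g₂ g₃ : ℂ} (h12 : e₁ ≠ e₂) (h23 : e₂ ≠ e₃) (h13 : e₁ ≠ e₃)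
    (h1 : 4 * e₁ ^ 3 - g₂ * e₁ - g₃ = 0) (h2 : 4 * e₂ ^ 3 - g₂ * e₂ - g₃ = 0)
    (h3 : 4 * e₃ ^ 3 - g₂ * e₃ - g₃ = 0) :
    e₁ + e₂ + e₃ = 0 ∧ g₂ = -4 * (e₁ * e₂ + e₁ * e₃ + e₂ * e₃) ∧ g₃ = 4 * e₁ * e₂ * e₃ := by
  have k12 : 4 * (e₁ ^ 2 + e₁ * e₂ + e₂ ^ 2) - g₂ = 0 := by
    refine mul_left_cancel₀ (sub_ne_zero.mpr h12) ?_
    linear_combination h1 - h2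
  have k23 : 4 * (e₂ ^ 2 + e₂ * e₃ + e₃ ^ 2) - g₂ = 0 := by
    refine mul_left_cancel₀ (sub_ne_zero.mpr h23) ?_
    linear_combination h2 - h3
  have hs : e₁ + e₂ + e₃ = 0 := by
    refine mul_left_cancel₀ (sub_ne_zero.mpr h13) ?_
    linear_combination (k12 - k23) / 4
  have hg : g₂ = -4 * (e₁ * e₂ + e₁ * e₃ + e₂ * e₃) := by
    linear_combination -k12 + 4 * (e₁ + e₂) * hs
  refine ⟨hs, hg, ?_⟩
  linear_combination -h1 + (-e₁) * hg + 4 * e₁ ^ 2 * hs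

/-- The inversion τ ↦ -1/τ exchanges ϑ₂ and ϑ₄ up to the factor (-iτ)^(1/2), and at the fixed point
i this factor is 1. -/
theorem thetaNull_I : thetaNull2 UpperHalfPlane.I = thetaNull4 UpperHalfPlane.I := by
  rw [thetaNull2, thetaNull4, UpperHalfPlane.coe_I, jacobiTheta₂_functional_equation (1 / 2) I]
  have h1 : (-I * I : ℂ) = 1 := by rw [neg_mul, I_mul_I, neg_neg]
  have h2 : (-1 / I : ℂ) = I := by rw [div_I]; ring
  rw [h1, h2, Complex.one_cpow, div_one, one_mul]
  congr 1
  · congr 1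
    rw [div_I]
    ring
  · rw [← jacobiTheta₂_neg_left]
    congr 1
    rw [div_I]
    ring

/-- The values of `℘(·|i)` at the half-periods are `e, 0, -e`. -/
theorem weierstrassP_half_periods_I :
    ∃ e : ℂ, e ≠ 0 ∧ 4 * e = Real.pi ^ 2 * thetaNull2 UpperHalfPlane.I ^ 4 ∧
      (torusPeriods UpperHalfPlane.I).g₂ = 4 * e ^ 2 ∧
      (torusPeriods UpperHalfPlane.I).g₃ = 0 ∧
      (torusPeriods UpperHalfPlane.I).weierstrassP (1 + UpperHalfPlane.I) = 0 := by
  set L := torusPeriods UpperHalfPlane.I with hL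
  have him : 1 ≤ UpperHalfPlane.I.im := by simp
  obtain ⟨A, B, hA, hB, -, h1, h2⟩ := exists_real_gaps (μ := UpperHalfPlane.I) (by simp) him
  -- Equal gaps, together with the vanishing sum of the roots, place the middle root at 0.
  have hAB : (A : ℂ) = B := by
    rw [← h1, ← h2, weierstrassP_one_sub him, weierstrassP_one_add_sub him, thetaNull_I]
  have hA0 : (A : ℂ) ≠ 0 := by exact_mod_cast hA.ne'
  have hB0 : (B : ℂ) ≠ 0 := by exact_mod_cast hB.ne'
  rw [← hL] at h1 h2
  obtain ⟨hs, hg2, hg3⟩ := cubic_coeffs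
    (e₁ := L.weierstrassP 1) (e₂ := L.weierstrassP (1 + UpperHalfPlane.I))
    (e₃ := L.weierstrassP UpperHalfPlane.I)
    (fun h => hA0 (by rw [← h1, h, sub_self])) (fun h => hB0 (by rw [← h2, h, sub_self]))
    (fun h => hA0 (by linear_combination -(h1 + h2) / 2 + h / 2 + hAB / 2))
    (weierstrassP_cubic_root L (one_notMem_lattice _) (two_mul_one_mem_lattice _))
    (weierstrassP_cubic_root L (one_add_coe_notMem_lattice _) (two_mul_one_add_coe_mem_lattice _))
    (weierstrassP_cubic_root L (coe_notMem_lattice _) (two_mul_coe_mem_lattice _))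
  have he2 : L.weierstrassP (1 + UpperHalfPlane.I) = 0 := by
    linear_combination (hs - h1 + h2 - hAB) / 3
  refine ⟨B, hB0, ?_, ?_, ?_, he2⟩
  · rw [← h2, weierstrassP_one_add_sub him]; ring
  · rw [hg2, he2]
    have h3 : L.weierstrassP 1 = B := by linear_combination h1 + he2 + hAB
    have h4 : L.weierstrassP UpperHalfPlane.I = -B := by linear_combination he2 - h2
    rw [h3, h4]; ring
  · rw [hg3, he2]; ring

/-- Fixing J leaves six values of the gap ratio A/B: 8, 1/8, -9, -1/9, -8/9, -9/8. Positivity of the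
gaps excludes the negative ones and B < 8A excludes 1/8. -/
theorem gap_eq_of_kleinJ {A B : ℝ} (hA : 0 < A) (hB : 0 < B) (hBA : B < 8 * A)
    (h : 4 * (A ^ 2 + A * B + B ^ 2) ^ 3 * (2 ^ 4 * 3 ^ 7) =
      27 * 73 ^ 3 * (A ^ 2 * B ^ 2 * (A + B) ^ 2)) : A = 8 * B := by
  have h1 : (A - 8 * B) * ((8 * A - B) * ((A + 9 * B) * (9 * A + B) * (9 * A + 8 * B) *
      (8 * A + 9 * B))) = 0 := by
    linear_combination h / 27
  rcases mul_eq_zero.mp h1 with h2 | h2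
  · linarith
  · exfalso
    have : 0 < 8 * A - B := by linarith
    have : 0 < (8 * A - B) * ((A + 9 * B) * (9 * A + B) * (9 * A + 8 * B) * (8 * A + 9 * B)) := by
      positivity
    exact this.ne' h2

/-- The invariants of the torus with `J(ϱ) = 73³ / (2⁴ 3⁷)`. -/
theorem weierstrassP_half_periods {ϱ : UpperHalfPlane} (hre : ϱ.re = 0) (him : 1 < ϱ.im)
    (hJ : kleinJ ϱ = 73 ^ 3 / (2 ^ 4 * 3 ^ 7)) :
    ∃ k : ℂ, k ≠ 0 ∧ k = Real.pi ^ 2 * thetaNull2 ϱ ^ 4 ∧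
      (∀ x, 4 * x ^ 3 - (torusPeriods ϱ).g₂ * x - (torusPeriods ϱ).g₃ =
        4 * (x - 17 * k / 12) * (x + 7 * k / 12) * (x + 10 * k / 12)) ∧
      (torusPeriods ϱ).g₂ = 73 * k ^ 2 / 12 ∧
      (torusPeriods ϱ).weierstrassP 1 = 17 * k / 12 ∧
      (torusPeriods ϱ).weierstrassP (1 + ϱ) = -7 * k / 12 ∧
      (torusPeriods ϱ).weierstrassP ϱ = -10 * k / 12 := by
  set L := torusPeriods ϱ with hL
  obtain ⟨A, B, hA, hB, hBA, h1, h2⟩ := exists_real_gaps hre him.le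
  have hA0 : (A : ℂ) ≠ 0 := by exact_mod_cast hA.ne'
  have hB0 : (B : ℂ) ≠ 0 := by exact_mod_cast hB.ne'
  have hAB0 : (A + B : ℂ) ≠ 0 := by exact_mod_cast (add_pos hA hB).ne'
  rw [← hL] at h1 h2
  obtain ⟨hs, hg2, hg3⟩ := cubic_coeffs
    (e₁ := L.weierstrassP 1) (e₂ := L.weierstrassP (1 + ϱ)) (e₃ := L.weierstrassP ϱ)
    (fun h => hA0 (by rw [← h1, h, sub_self])) (fun h => hB0 (by rw [← h2, h, sub_self]))
    (fun h => hAB0 (by linear_combination -(h1 + h2) + h))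
    (weierstrassP_cubic_root L (one_notMem_lattice _) (two_mul_one_mem_lattice _))
    (weierstrassP_cubic_root L (one_add_coe_notMem_lattice _) (two_mul_one_add_coe_mem_lattice _))
    (weierstrassP_cubic_root L (coe_notMem_lattice _) (two_mul_coe_mem_lattice _))
  have e2 : L.weierstrassP (1 + ϱ) = (B - A) / 3 := by linear_combination (hs - h1 + h2) / 3
  have e1 : L.weierstrassP 1 = (B + 2 * A) / 3 := by linear_combination h1 + e2
  have e3 : L.weierstrassP ϱ = (-2 * B - A) / 3 := by linear_combination e2 - h2
  have g2 : L.g₂ = 4 / 3 * (A ^ 2 + A * B + B ^ 2) := by rw [hg2, e1, e2, e3]; ring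
  have g3 : L.g₃ = 4 * ((B + 2 * A) / 3) * ((B - A) / 3) * ((-2 * B - A) / 3) := by
    rw [hg3, e1, e2, e3]
  have hdisc : L.g₂ ^ 3 - 27 * L.g₃ ^ 2 = 16 * (A ^ 2 * B ^ 2 * (A + B) ^ 2) := by
    rw [g2, g3]; ring
  -- With k = 4B the roots become 17k/12, -7k/12 and -10k/12.
  have hAB : A = 8 * B := by
    refine gap_eq_of_kleinJ hA hB hBA ?_
    rw [kleinJ, ← hL, hdisc, g2, div_eq_div_iff (by simp [hA0, hB0, hAB0]) (by norm_num)] at hJ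
    have h3 : (4 * (A ^ 2 + A * B + B ^ 2) ^ 3 * (2 ^ 4 * 3 ^ 7) : ℂ) =
      27 * 73 ^ 3 * (A ^ 2 * B ^ 2 * (A + B) ^ 2) := by linear_combination (27 / 16) * hJ
    exact_mod_cast h3
  have hABc : (A : ℂ) = 8 * B := by rw [hAB]; push_cast; ring
  have f1 : L.weierstrassP 1 = 17 * (4 * B) / 12 := by rw [e1, hABc]; ring
  have f2 : L.weierstrassP (1 + ϱ) = -7 * (4 * B) / 12 := by rw [e2, hABc]; ring
  have f3 : L.weierstrassP ϱ = -10 * (4 * B) / 12 := by rw [e3, hABc]; ring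
  refine ⟨4 * B, by simpa using hB0, ?_, fun x => ?_, ?_, f1, f2, f3⟩
  · rw [← h2, weierstrassP_one_add_sub him.le]; ring
  · rw [hg2, hg3, f1, f2, f3]; ring
  · rw [hg2, f1, f2, f3]; ring

/-! ### The relation Ξ as an equation between elliptic functions. -/

/-- The invariants of the lemniscatic torus, in terms of `e = ℘(1|i)`. -/
structure LemniscaticValue (e : ℂ) : Prop where
  ne_zero : e ≠ 0
  theta : 4 * e = Real.pi ^ 2 * thetaNull2 UpperHalfPlane.I ^ 4
  g₂_eq : (torusPeriods UpperHalfPlane.I).g₂ = 4 * e ^ 2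
  g₃_eq : (torusPeriods UpperHalfPlane.I).g₃ = 0
  centre : (torusPeriods UpperHalfPlane.I).weierstrassP (1 + UpperHalfPlane.I) = 0

/-- The invariants of the torus of modulus `ϱ`, in terms of `k = π² ϑ₂⁴(ϱ)`. -/
structure TorusValue (ϱ : UpperHalfPlane) (k : ℂ) : Prop where
  ne_zero : k ≠ 0
  theta : k = Real.pi ^ 2 * thetaNull2 ϱ ^ 4
  cubic : ∀ x, 4 * x ^ 3 - (torusPeriods ϱ).g₂ * x - (torusPeriods ϱ).g₃ =
    4 * (x - 17 * k / 12) * (x + 7 * k / 12) * (x + 10 * k / 12)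
  g₂_eq : (torusPeriods ϱ).g₂ = 73 * k ^ 2 / 12

theorem exists_lemniscaticValue : ∃ e, LemniscaticValue e := by
  obtain ⟨e, h1, h2, h3, h4, h5⟩ := weierstrassP_half_periods_I
  exact ⟨e, h1, h2, h3, h4, h5⟩

theorem exists_torusValue {ϱ : UpperHalfPlane} (hre : ϱ.re = 0) (him : 1 < ϱ.im)
    (hJ : kleinJ ϱ = 73 ^ 3 / (2 ^ 4 * 3 ^ 7)) : ∃ k, TorusValue ϱ k := by
  obtain ⟨k, h1, h2, h3, h4, -⟩ := weierstrassP_half_periods hre him hJ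
  exact ⟨k, h1, h2, h3, h4⟩

theorem TorusValue.g₃_eq {ϱ : UpperHalfPlane} {k : ℂ} (hk : TorusValue ϱ k) :
    (torusPeriods ϱ).g₃ = 4 * (17 * k / 12) * (7 * k / 12) * (10 * k / 12) := by
  linear_combination -hk.cubic 0

theorem wp_add_mem {μ : UpperHalfPlane} {l : ℂ} (hl : l ∈ periodLattice μ) (z : ℂ) :
    wp μ (z + l) = wp μ z := (torusPeriods μ).weierstrassP_add_mem hl z

theorem wpDeriv_ne_zero {μ : UpperHalfPlane} {z : ℂ} (hz : 2 * z ∉ periodLattice μ) :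
    wpDeriv μ z ≠ 0 := fun h =>
  hz (((torusPeriods μ).derivWeierstrassP_eq_zero_iff
    ((torusPeriods μ).notMem_lattice_of_two_mul hz)).mp h)

theorem notMem_of_two_mul_notMem {μ : UpperHalfPlane} {z : ℂ} (hz : 2 * z ∉ periodLattice μ) :
    z ∉ periodLattice μ := (torusPeriods μ).notMem_lattice_of_two_mul hz

/-- The rational function of `℘(u|i)` in the covering relation. -/
def coverF (e u : ℂ) : ℂ :=
  4 * (wp UpperHalfPlane.I u / e) ^ 2 * ((wp UpperHalfPlane.I u / e) ^ 2 - 1)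

/-- The rational function of `℘(s|ϱ)` in the covering relation. -/
def coverG (ϱ : UpperHalfPlane) (k s : ℂ) : ℂ :=
  k ^ 3 * (wp ϱ s + 10 * k / 12) / ((wp ϱ s - 17 * k / 12) * (wp ϱ s + 7 * k / 12) ^ 3)

namespace LemniscaticValue

variable {e : ℂ} (he : LemniscaticValue e)
include he

theorem wpDeriv_sq {u : ℂ} (hu : u ∉ periodLattice UpperHalfPlane.I) :
    wpDeriv UpperHalfPlane.I u ^ 2 =
      4 * wp UpperHalfPlane.I u * (wp UpperHalfPlane.I u ^ 2 - e ^ 2) := by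
  have h := (torusPeriods UpperHalfPlane.I).derivWeierstrassP_sq u hu
  rw [he.g₂_eq, he.g₃_eq] at h
  rw [wpDeriv, wp, h]
  ring

theorem wp_ne_zero {u : ℂ} (hu : 2 * u ∉ periodLattice UpperHalfPlane.I) :
    wp UpperHalfPlane.I u ≠ 0 := by
  intro h
  have h1 := he.wpDeriv_sq (notMem_of_two_mul_notMem hu)
  rw [h] at h1
  exact wpDeriv_ne_zero hu (by simpa using h1)

theorem wp_sq_sub_ne_zero {u : ℂ} (hu : 2 * u ∉ periodLattice UpperHalfPlane.I) :
    wp UpperHalfPlane.I u ^ 2 - e ^ 2 ≠ 0 := by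
  intro h
  have h1 := he.wpDeriv_sq (notMem_of_two_mul_notMem hu)
  rw [h] at h1
  exact wpDeriv_ne_zero hu (by simpa using h1)

theorem thetaRatio_sq {u : ℂ} (hu : u ∉ periodLattice UpperHalfPlane.I) :
    e * thetaRatio UpperHalfPlane.I u ^ 2 = wp UpperHalfPlane.I u := by
  have h := weierstrassP_sub_eq_thetaRatio_sq (μ := UpperHalfPlane.I) (by simp) hu
  rw [he.centre, sub_zero, ← thetaNull_I] at h
  rw [wp, h]
  linear_combination (thetaRatio UpperHalfPlane.I u ^ 2 / 4) * he.theta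

theorem wp_two_mul {u : ℂ} (hu : 2 * u ∉ periodLattice UpperHalfPlane.I) :
    wp UpperHalfPlane.I (2 * u) * (4 * wp UpperHalfPlane.I u * (wp UpperHalfPlane.I u ^ 2 - e ^ 2)) =
      (wp UpperHalfPlane.I u ^ 2 + e ^ 2) ^ 2 := by
  have h := (torusPeriods UpperHalfPlane.I).weierstrassP_two_mul hu
  rw [← he.wpDeriv_sq (notMem_of_two_mul_notMem hu)]
  rw [he.g₂_eq, he.g₃_eq] at h
  simp only [wp, wpDeriv]
  rw [h]
  ring

end LemniscaticValue

namespace TorusValue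

variable {ϱ : UpperHalfPlane} {k : ℂ} (hk : TorusValue ϱ k)
include hk

theorem wpDeriv_sq {s : ℂ} (hs : s ∉ periodLattice ϱ) :
    wpDeriv ϱ s ^ 2 =
      4 * (wp ϱ s - 17 * k / 12) * (wp ϱ s + 7 * k / 12) * (wp ϱ s + 10 * k / 12) := by
  have h := (torusPeriods ϱ).derivWeierstrassP_sq s hs
  rw [hk.cubic] at h
  exact h

theorem factors_ne_zero {s : ℂ} (hs : 2 * s ∉ periodLattice ϱ) :
    wp ϱ s - 17 * k / 12 ≠ 0 ∧ wp ϱ s + 7 * k / 12 ≠ 0 ∧ wp ϱ s + 10 * k / 12 ≠ 0 := by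
  have h1 := hk.wpDeriv_sq (notMem_of_two_mul_notMem hs)
  have h2 := pow_ne_zero 2 (wpDeriv_ne_zero hs)
  rw [h1] at h2
  refine ⟨fun h => h2 ?_, fun h => h2 ?_, fun h => h2 ?_⟩ <;> rw [h] <;> ring

theorem wp_two_mul {s : ℂ} (hs : 2 * s ∉ periodLattice ϱ) :
    wp ϱ (2 * s) *
      (4 * (wp ϱ s - 17 * k / 12) * (wp ϱ s + 7 * k / 12) * (wp ϱ s + 10 * k / 12)) =
      (wp ϱ s ^ 2 + 73 * k ^ 2 / 48) ^ 2 +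
        2 * (4 * (17 * k / 12) * (7 * k / 12) * (10 * k / 12)) * wp ϱ s := by
  have h := (torusPeriods ϱ).weierstrassP_two_mul hs
  rw [← hk.wpDeriv_sq (notMem_of_two_mul_notMem hs)]
  rw [hk.g₂_eq, hk.g₃_eq] at h
  simp only [wp, wpDeriv]
  rw [h]
  ring

end TorusValue

/-- The relation `Ξ(u, s)` as an equation between elliptic functions. -/
theorem transcendentalRelation_iff {ϱ : UpperHalfPlane} {e k : ℂ} (he : LemniscaticValue e)
    (hk : TorusValue ϱ k) (u s : ℂ) :
    transcendentalRelation ϱ u s ↔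
      2 * u ∉ periodLattice UpperHalfPlane.I ∧ 2 * s ∉ periodLattice ϱ ∧
        coverF e u = coverG ϱ k s := by
  rw [transcendentalRelation]
  refine and_congr_right fun hu => and_congr_right fun hs => ?_
  obtain ⟨n1, n2, n3⟩ := hk.factors_ne_zero hs
  have hp := he.wpDeriv_sq (notMem_of_two_mul_notMem hu)
  have hq := hk.wpDeriv_sq (notMem_of_two_mul_notMem hs)
  have hr := he.thetaRatio_sq (notMem_of_two_mul_notMem hu)
  have he0 := he.ne_zero
  have hk0 := hk.ne_zero
  have het := he.theta
  have hkt := hk.theta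
  rw [thetaRatio_eq, thetaConst2_eq, thetaConst2_eq]
  set x := wp UpperHalfPlane.I u with hx
  set z := wp ϱ s with hz
  set p := wpDeriv UpperHalfPlane.I u
  set q := wpDeriv ϱ s
  set r := thetaRatio UpperHalfPlane.I u
  set c := thetaNull2 UpperHalfPlane.I
  set d := thetaNull2 ϱ
  -- Allowing both signs is the same as equating squares, which makes the theta quotient algebraic
  -- in ℘(u|i).
  have hsign : ∀ A B : ℂ, (∃ ε : ℂ, (ε = 1 ∨ ε = -1) ∧ ε * A = B) ↔ A ^ 2 = B ^ 2 := by
    intro A B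
    rw [sq_eq_sq_iff_eq_or_eq_neg]
    constructor
    · rintro ⟨ε, rfl | rfl, h⟩
      · left; linear_combination h
      · right; linear_combination -h
    · rintro (h | h)
      · exact ⟨1, Or.inl rfl, by rw [h, one_mul]⟩
      · exact ⟨-1, Or.inr rfl, by rw [h]; ring⟩
  have hform : (∃ ε : ℂ, (ε = 1 ∨ ε = -1) ∧ ε * 2 * r * p * q =
      (Real.pi : ℂ) ^ 6 * c ^ 6 * d ^ 6 *
        ((6 * z + 5 * (Real.pi : ℂ) ^ 2 * d ^ 4) / (12 * z + 7 * (Real.pi : ℂ) ^ 2 * d ^ 4))) ↔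
      (2 * r * p * q) ^ 2 = ((Real.pi : ℂ) ^ 6 * c ^ 6 * d ^ 6 *
        ((6 * z + 5 * (Real.pi : ℂ) ^ 2 * d ^ 4) / (12 * z + 7 * (Real.pi : ℂ) ^ 2 * d ^ 4))) ^ 2 := by
    rw [← hsign]
    refine exists_congr fun ε => and_congr_right fun _ => ?_
    rw [show ε * 2 * r * p * q = ε * (2 * r * p * q) by ring]
  rw [hform, mul_assoc 5, mul_assoc 7, ← hkt]
  have hA : (2 * r * p * q) ^ 2 = 64 * (x ^ 2 * (x ^ 2 - e ^ 2) / e) *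
      ((z - 17 * k / 12) * (z + 7 * k / 12) * (z + 10 * k / 12)) := by
    have hr' : r ^ 2 = x / e := by rw [← hr]; field_simp
    rw [show (2 * r * p * q) ^ 2 = 4 * r ^ 2 * p ^ 2 * q ^ 2 by ring, hr', hp, hq]
    field_simp
    ring
  -- The sixth powers of the theta constants become cubes of 4e and k; the denominator 12z + 7k is
  -- nonzero since s is not a half-period.
  have hB : ((Real.pi : ℂ) ^ 6 * c ^ 6 * d ^ 6 * ((6 * z + 5 * k) / (12 * z + 7 * k))) ^ 2 =
      16 * e ^ 3 * k ^ 3 * (z + 10 * k / 12) ^ 2 / (z + 7 * k / 12) ^ 2 := by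
    have h1 : ((Real.pi : ℂ) ^ 6 * c ^ 6 * d ^ 6) ^ 2 = (4 * e) ^ 3 * k ^ 3 := by
      rw [het, hkt]; ring
    have h2 : (6 * z + 5 * k) / (12 * z + 7 * k) = (z + 10 * k / 12) / (2 * (z + 7 * k / 12)) := by
      have h3 : 12 * z + 7 * k ≠ 0 := fun h => n2 (by linear_combination h / 12)
      rw [div_eq_div_iff h3 (by simpa using n2)]
      ring
    rw [mul_pow, h1, h2]
    field_simp
    ring
  have hF : coverF e u = 4 * x ^ 2 * (x ^ 2 - e ^ 2) / e ^ 4 := by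
    rw [coverF, ← hx]; field_simp
  have hG : coverG ϱ k s =
      k ^ 3 * (z + 10 * k / 12) / ((z - 17 * k / 12) * (z + 7 * k / 12) ^ 3) := by
    rw [coverG]
  rw [hA, hB, hF, hG]
  generalize z - 17 * k / 12 = z₁ at *
  generalize z + 7 * k / 12 = z₂ at *
  generalize z + 10 * k / 12 = z₃ at *
  generalize x ^ 2 - e ^ 2 = y at *
  rw [eq_div_iff (by simpa using n2), div_eq_div_iff (by simpa using he0) (by simp [n1, n2])]
  constructor
  · intro h
    field_simp at h
    linear_combination h / 16
  · intro h
    field_simp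
    linear_combination 16 * h

theorem two_mul_add_mem_iff {μ : UpperHalfPlane} {l : ℂ} (hl : l ∈ periodLattice μ) (z : ℂ) :
    2 * (z + l) ∈ periodLattice μ ↔ 2 * z ∈ periodLattice μ := by
  have h2 : l + l ∈ periodLattice μ := add_mem hl hl
  rw [show 2 * (z + l) = 2 * z + (l + l) by ring]
  exact add_mem_cancel_right h2

theorem transcendentalRelation_add_iff {ϱ : UpperHalfPlane} {e k : ℂ} (he : LemniscaticValue e)
    (hk : TorusValue ϱ k) (u s : ℂ) {l l' : ℂ} (hl : l ∈ periodLattice UpperHalfPlane.I)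
    (hl' : l' ∈ periodLattice ϱ) :
    transcendentalRelation ϱ (u + l) (s + l') ↔ transcendentalRelation ϱ u s := by
  rw [transcendentalRelation_iff he hk, transcendentalRelation_iff he hk, two_mul_add_mem_iff hl,
    two_mul_add_mem_iff hl', coverF, coverF, coverG, coverG, wp_add_mem hl, wp_add_mem hl']

/-! ### Square roots of F + 1 and G + 1, and local branches. -/

theorem periodLattice_compl_eventually {μ : UpperHalfPlane} {z : ℂ} (hz : 2 * z ∉ periodLattice μ) :
    ∀ᶠ w in 𝓝 z, 2 * w ∉ periodLattice μ := by
  have h : Tendsto (fun w : ℂ => 2 * w) (𝓝 z) (𝓝 (2 * z)) :=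
    (continuous_const_mul (2 : ℂ)).tendsto z
  exact h.eventually ((torusPeriods μ).eventually_notMem_lattice_of_notMem hz)

theorem hasDerivAt_wp {μ : UpperHalfPlane} {z : ℂ} (hz : z ∉ periodLattice μ) :
    HasDerivAt (wp μ) (wpDeriv μ z) z := (torusPeriods μ).hasDerivAt_weierstrassP hz

theorem analyticAt_wp {μ : UpperHalfPlane} {z : ℂ} (hz : z ∉ periodLattice μ) :
    AnalyticAt ℂ (wp μ) z := (torusPeriods μ).analyticOnNhd_weierstrassP z hz

/-- An analytic square root of a nonvanishing analytic function, with a prescribed value. -/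
theorem AnalyticAt.exists_sqrt {h : ℂ → ℂ} {s c : ℂ} (hh : AnalyticAt ℂ h s) (h0 : h s ≠ 0)
    (hc : c ^ 2 = h s) :
    ∃ r : ℂ → ℂ, AnalyticAt ℂ r s ∧ r s = c ∧ ∀ᶠ w in 𝓝 s, r w ^ 2 = h w := by
  have hone : h s / h s = 1 := div_self h0
  have hq : AnalyticAt ℂ (fun w => h w / h s) s := hh.div analyticAt_const h0
  refine ⟨fun w => c * (h w / h s) ^ (1 / 2 : ℂ), ?_, ?_, Eventually.of_forall fun w => ?_⟩
  · refine analyticAt_const.mul (hq.cpow analyticAt_const ?_)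
    simp [hone]
  · simp [hone]
  · rw [mul_pow, hc, ← Complex.cpow_nat_mul]
    norm_num
    field_simp

/-- The square root `2℘²/e² - 1` of `F + 1`. -/
def coverA (e u : ℂ) : ℂ := 2 * (wp UpperHalfPlane.I u / e) ^ 2 - 1

/-- The product `(℘ - e₁)(℘ - e₂)` on the torus of modulus `ϱ`. -/
def coverH (ϱ : UpperHalfPlane) (k s : ℂ) : ℂ := (wp ϱ s - 17 * k / 12) * (wp ϱ s + 7 * k / 12)

/-- The numerator of a square root of `G + 1`. -/
def coverN (ϱ : UpperHalfPlane) (k s : ℂ) : ℂ := wp ϱ s ^ 2 + k * wp ϱ s / 6 - 107 * k ^ 2 / 144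

theorem coverA_sq (e u : ℂ) : coverA e u ^ 2 = coverF e u + 1 := by
  rw [coverA, coverF]; ring

theorem analyticAt_coverH {ϱ : UpperHalfPlane} {k s : ℂ} (hs : 2 * s ∉ periodLattice ϱ) :
    AnalyticAt ℂ (coverH ϱ k) s := by
  have h := analyticAt_wp (notMem_of_two_mul_notMem hs)
  exact (h.sub analyticAt_const).mul (h.add analyticAt_const)

section TorusValue

variable {ϱ : UpperHalfPlane} {k : ℂ} (hk : TorusValue ϱ k)
include hk

theorem coverH_ne_zero {s : ℂ} (hs : 2 * s ∉ periodLattice ϱ) : coverH ϱ k s ≠ 0 :=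
  mul_ne_zero (hk.factors_ne_zero hs).1 (hk.factors_ne_zero hs).2.1

/-- The numerator of G + 1, namely (z - 17k/12)(z + 7k/12)³ + k³(z + 10k/12), is the perfect square
`coverN`²; an auxiliary root r of `coverH` takes care of the denominator. -/
theorem sq_eq_coverG_add_one {s r : ℂ} (hs : 2 * s ∉ periodLattice ϱ) (hr : r ^ 2 = coverH ϱ k s) :
    (coverN ϱ k s / (r * (wp ϱ s + 7 * k / 12))) ^ 2 = coverG ϱ k s + 1 := by
  obtain ⟨h1, h2, h3⟩ := hk.factors_ne_zero hs
  rw [div_pow, mul_pow, hr, coverH, coverG, coverN, div_add_one (mul_ne_zero h1 (pow_ne_zero 3 h2)),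
    div_eq_div_iff (mul_ne_zero (mul_ne_zero h1 h2) (pow_ne_zero 2 h2))
      (mul_ne_zero h1 (pow_ne_zero 3 h2))]
  ring

/-- All other terms cancel, leaving a multiple of ℘'(s), which does not vanish at regular points.
Hence G is unramified there except over -1, and branches have nonzero derivative. -/
theorem hasDerivAt_coverB {s : ℂ} {r : ℂ → ℂ} (hs : 2 * s ∉ periodLattice ϱ)
    (hr : AnalyticAt ℂ r s) (hrh : ∀ᶠ w in 𝓝 s, r w ^ 2 = coverH ϱ k w) :
    HasDerivAt (fun w => coverN ϱ k w / (r w * (wp ϱ w + 7 * k / 12)))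
      (-(3 / 2 * k ^ 3 * wpDeriv ϱ s) / (r s * coverH ϱ k s * (wp ϱ s + 7 * k / 12))) s := by
  obtain ⟨h1, h2, h3⟩ := hk.factors_ne_zero hs
  have hz := hasDerivAt_wp (notMem_of_two_mul_notMem hs)
  have hr2 := hrh.self_of_nhds
  have hH0 := coverH_ne_zero hk hs
  have hr0 : r s ≠ 0 := fun h => hH0 (by rw [← hr2, h]; ring)
  have hrd := hr.differentiableAt.hasDerivAt
  have hHd := (hz.sub_const (17 * k / 12)).mul (hz.add_const (7 * k / 12))
  have hrr := (hrd.pow 2).unique (hHd.congr_of_eventuallyEq hrh)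
  have hNd := ((hz.pow 2).add ((hz.const_mul k).div_const 6)).sub_const (107 * k ^ 2 / 144)
  have hD := hNd.div (hrd.mul (hz.add_const (7 * k / 12))) (mul_ne_zero hr0 h2)
  refine HasDerivAt.congr_deriv hD ?_
  simp only [Nat.cast_ofNat, Nat.reduceSub, pow_one, Pi.mul_apply, Pi.add_apply, Pi.pow_apply,
    coverH] at hrr hr2 ⊢
  generalize deriv r s = r' at *
  generalize wpDeriv ϱ s = z' at *
  generalize r s = r₀ at *
  have hr' : r' = z' * (2 * wp ϱ s - 10 * k / 12) / (2 * r₀) := by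
    rw [eq_div_iff (by simpa using hr0)]
    linear_combination hrr
  rw [hr']
  generalize wp ϱ s = z at *
  have hz1 : z = 17 * k / 12 + (z - 17 * k / 12) := by ring
  rw [div_eq_div_iff (pow_ne_zero 2 (mul_ne_zero hr0 h2))
    (mul_ne_zero (mul_ne_zero hr0 (mul_ne_zero h1 h2)) h2)]
  have hcancel : z' * (2 * z - 10 * k / 12) / (2 * r₀) * (2 * r₀) = z' * (2 * z - 10 * k / 12) := by
    field_simp
  generalize z' * (2 * z - 10 * k / 12) / (2 * r₀) = t at *
  linear_combination (-(z ^ 2 + k * z / 6 - 107 * k ^ 2 / 144) * (z + 7 * k / 12) ^ 2 *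
      ((z - 17 * k / 12) * (z + 7 * k / 12)) / 2) * hcancel +
    ((z - 17 * k / 12) * (z + 7 * k / 12) * (z + 7 * k / 12) *
      ((2 * z * z' + k * z' / 6) * (z + 7 * k / 12) -
        (z ^ 2 + k * z / 6 - 107 * k ^ 2 / 144) * z') +
      3 / 2 * k ^ 3 * z' * (z + 7 * k / 12) ^ 2) * hr2

end TorusValue

theorem hasDerivAt_coverA {e u : ℂ} (hu : 2 * u ∉ periodLattice UpperHalfPlane.I) :
    HasDerivAt (coverA e)
      (4 * (wp UpperHalfPlane.I u / e) * (wpDeriv UpperHalfPlane.I u / e)) u := by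
  have hx := (hasDerivAt_wp (notMem_of_two_mul_notMem hu)).div_const e
  have h := ((hx.pow 2).const_mul 2).sub_const 1
  refine HasDerivAt.congr_deriv h ?_
  simp only [Nat.cast_ofNat, Nat.reduceSub, pow_one]
  ring

section LemniscaticValue

variable {e : ℂ} (he : LemniscaticValue e)
include he

theorem analyticAt_coverA {u : ℂ} (hu : 2 * u ∉ periodLattice UpperHalfPlane.I) :
    AnalyticAt ℂ (coverA e) u := by
  have h := analyticAt_wp (notMem_of_two_mul_notMem hu)
  exact (analyticAt_const.mul ((h.div analyticAt_const he.ne_zero).pow 2)).sub analyticAt_const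

/-- F' vanishes over -1, but the square root of F + 1 has no critical point at regular u. Working
with it makes the curve split there into smooth branches. -/
theorem deriv_coverA_ne_zero {u : ℂ} (hu : 2 * u ∉ periodLattice UpperHalfPlane.I) :
    deriv (coverA e) u ≠ 0 := by
  rw [(hasDerivAt_coverA hu).deriv]
  exact mul_ne_zero (mul_ne_zero (by norm_num) (div_ne_zero (he.wp_ne_zero hu) he.ne_zero))
    (div_ne_zero (wpDeriv_ne_zero hu) he.ne_zero)

end LemniscaticValue

/-- Near the given point Ξ reads `coverA` = ±b with b a local root of G + 1, and `coverA` is locally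
invertible. -/
theorem exists_branch {ϱ : UpperHalfPlane} {e k : ℂ} (he : LemniscaticValue e)
    (hk : TorusValue ϱ k) {u₀ s₀ : ℂ} (h : transcendentalRelation ϱ u₀ s₀) :
    ∃ (D : Set ℂ) (u : ℂ → ℂ), s₀ ∈ D ∧ u s₀ = u₀ ∧ IsBranchOn ϱ D u := by
  obtain ⟨hu, hs, hFG⟩ := (transcendentalRelation_iff he hk u₀ s₀).mp h
  obtain ⟨h1, h2, h3⟩ := hk.factors_ne_zero hs
  have hH0 := coverH_ne_zero hk hs
  -- Changing the sign of c changes the sign of the root of G + 1, so it can be matched to the value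
  -- at u₀.
  obtain ⟨c, hc⟩ : ∃ c : ℂ, c ^ 2 = coverH ϱ k s₀ ∧
      coverA e u₀ = coverN ϱ k s₀ / (c * (wp ϱ s₀ + 7 * k / 12)) := by
    obtain ⟨c, hc⟩ := IsAlgClosed.exists_pow_nat_eq (coverH ϱ k s₀) two_pos
    have hsq : coverA e u₀ ^ 2 = (coverN ϱ k s₀ / (c * (wp ϱ s₀ + 7 * k / 12))) ^ 2 := by
      rw [sq_eq_coverG_add_one hk hs hc, coverA_sq, hFG]
    rcases sq_eq_sq_iff_eq_or_eq_neg.mp hsq with h4 | h4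
    · exact ⟨c, hc, h4⟩
    · exact ⟨-c, by rw [neg_sq, hc], by rw [h4, neg_mul, div_neg]⟩
  obtain ⟨r, hra, hrs, hrh⟩ := (analyticAt_coverH hs).exists_sqrt hH0 hc.1
  have hA := analyticAt_coverA he hu
  have hA' := deriv_coverA_ne_zero he hu
  set b : ℂ → ℂ := fun w => coverN ϱ k w / (r w * (wp ϱ w + 7 * k / 12)) with hb
  have hz := analyticAt_wp (notMem_of_two_mul_notMem hs)
  have hba : AnalyticAt ℂ b s₀ := by
    have hc0 : c ≠ 0 := fun h => hH0 (by rw [← hc.1, h]; ring)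
    have hNa : AnalyticAt ℂ (coverN ϱ k) s₀ := by
      unfold coverN
      fun_prop
    exact hNa.div (hra.mul (hz.add analyticAt_const)) (mul_ne_zero (by rw [hrs]; exact hc0) h2)
  have hbs : b s₀ = coverA e u₀ := by simp only [hb]; rw [hrs, hc.2]
  set inv := hA.hasStrictDerivAt.localInverse _ _ _ hA'
  have hinva : AnalyticAt ℂ inv (b s₀) := by rw [hbs]; exact hA.analyticAt_localInverse hA'
  have hinv0 : inv (coverA e u₀) = u₀ := HasStrictFDerivAt.localInverse_apply_image ..
  have hinvr : ∀ᶠ y in 𝓝 (b s₀), coverA e (inv y) = y := by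
    rw [hbs]; exact HasStrictDerivAt.eventually_right_inverse ..
  have hcomp : AnalyticAt ℂ (fun w => inv (b w)) s₀ := hinva.comp hba
  have hus : inv (b s₀) = u₀ := by rw [hbs, hinv0]
  have hev : ∀ᶠ w in 𝓝 s₀, AnalyticAt ℂ (fun w => inv (b w)) w ∧
      transcendentalRelation ϱ (inv (b w)) w := by
    have hlat : ∀ᶠ w in 𝓝 s₀, 2 * inv (b w) ∉ periodLattice UpperHalfPlane.I := by
      have ht : Tendsto (fun w => inv (b w)) (𝓝 s₀) (𝓝 (inv (b s₀))) := hcomp.continuousAt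
      rw [hus] at ht
      exact ht.eventually (periodLattice_compl_eventually hu)
    filter_upwards [hcomp.eventually_analyticAt, hlat, periodLattice_compl_eventually hs, hrh,
      hba.continuousAt.eventually hinvr] with w e1 e2 e3 e4 e5
    refine ⟨e1, (transcendentalRelation_iff he hk _ _).mpr ⟨e2, e3, ?_⟩⟩
    have e6 := coverA_sq e (inv (b w))
    rw [e5, sq_eq_coverG_add_one hk e3 e4] at e6
    exact (add_right_cancel e6).symm
  obtain ⟨D, hD, hDo, hsD⟩ := eventually_nhds_iff.mp hev
  exact ⟨D, fun w => inv (b w), hsD, hus, hDo,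
    fun w hw => (hD w hw).1.differentiableAt.differentiableWithinAt, fun w hw => (hD w hw).2⟩

theorem IsBranchOn.analyticAt {ϱ : UpperHalfPlane} {D : Set ℂ} {u : ℂ → ℂ}
    (hu : IsBranchOn ϱ D u) {s : ℂ} (hs : s ∈ D) : AnalyticAt ℂ u s :=
  hu.2.1.analyticAt (hu.1.mem_nhds hs)

section Branch

variable {ϱ : UpperHalfPlane} {e k : ℂ} (he : LemniscaticValue e) (hk : TorusValue ϱ k)
  {D : Set ℂ} {u : ℂ → ℂ} (hu : IsBranchOn ϱ D u)
include he hk hu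

/-- On a branch the derivative of `coverA` ∘ u is, up to sign, the derivative of the root of G + 1.
Squaring and eliminating with F = G leaves a first-order equation without ℘'. -/
theorem branch_derivative {s : ℂ} (hs : s ∈ D) :
    deriv u s ≠ 0 ∧
      16 * wp UpperHalfPlane.I (u s) * deriv u s ^ 2 * coverH ϱ k s = 9 * k ^ 3 := by
  have hrel := fun w hw => (transcendentalRelation_iff he hk (u w) w).mp (hu.2.2 w hw)
  obtain ⟨hul, hsl, hFG⟩ := hrel s hs
  obtain ⟨h1, h2, h3⟩ := hk.factors_ne_zero hsl
  have hH0 := coverH_ne_zero hk hsl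
  obtain ⟨c, hc⟩ := IsAlgClosed.exists_pow_nat_eq (coverH ϱ k s) two_pos
  obtain ⟨r, hra, hrs, hrh⟩ := (analyticAt_coverH hsl).exists_sqrt hH0 hc
  have hc0 : c ≠ 0 := fun h => hH0 (by rw [← hc, h]; ring)
  have hb := hasDerivAt_coverB hk hsl hra hrh
  set b : ℂ → ℂ := fun w => coverN ϱ k w / (r w * (wp ϱ w + 7 * k / 12)) with hbdef
  have hz := analyticAt_wp (notMem_of_two_mul_notMem hsl)
  have hba : AnalyticAt ℂ b s := by
    have hNa : AnalyticAt ℂ (coverN ϱ k) s := by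
      unfold coverN
      fun_prop
    exact hNa.div (hra.mul (hz.add analyticAt_const)) (mul_ne_zero (by rw [hrs]; exact hc0) h2)
  have hua := hu.2.1.analyticAt (hu.1.mem_nhds hs)
  have haa : AnalyticAt ℂ (fun w => coverA e (u w)) s := (analyticAt_coverA he hul).comp hua
  have had : HasDerivAt (fun w => coverA e (u w)) (4 * (wp UpperHalfPlane.I (u s) / e) *
      (wpDeriv UpperHalfPlane.I (u s) / e) * deriv u s) s :=
    (hasDerivAt_coverA hul).comp s hua.differentiableAt.hasDerivAt
  have hprod : ∀ᶠ w in 𝓝 s, (coverA e (u w) - b w) * (coverA e (u w) + b w) = 0 := by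
    filter_upwards [hu.1.mem_nhds hs, hrh] with w hw hrw
    have h5 := coverA_sq e (u w)
    have h6 := sq_eq_coverG_add_one hk (hrel w hw).2.1 hrw
    rw [(hrel w hw).2.2, ← h6] at h5
    simp only [hbdef]
    linear_combination h5
  have hsq : (4 * (wp UpperHalfPlane.I (u s) / e) * (wpDeriv UpperHalfPlane.I (u s) / e) *
      deriv u s) ^ 2 = (-(3 / 2 * k ^ 3 * wpDeriv ϱ s) /
        (r s * coverH ϱ k s * (wp ϱ s + 7 * k / 12))) ^ 2 := by
    rw [sq_eq_sq_iff_eq_or_eq_neg]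
    -- The product of two analytic factors vanishes identically, so one of them does; the sign
    -- cannot vary along the branch near s.
    rcases (haa.sub hba).eventually_eq_zero_or_eventually_ne_zero with h5 | h5
    · left
      refine had.unique (hb.congr_of_eventuallyEq ?_)
      filter_upwards [h5] with w hw
      exact sub_eq_zero.mp hw
    · right
      have h6 : ∀ᶠ w in 𝓝[≠] s, coverA e (u w) + b w = 0 := by
        filter_upwards [h5, hprod.filter_mono nhdsWithin_le_nhds] with w hw hw'
        exact (mul_eq_zero.mp hw').resolve_left hw
      have h7 : ∀ᶠ w in 𝓝 s, coverA e (u w) + b w = 0 :=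
        ((haa.add hba).frequently_zero_iff_eventually_zero).mp h6.frequently
      refine had.unique (hb.neg.congr_of_eventuallyEq ?_)
      filter_upwards [h7] with w hw
      exact eq_neg_of_add_eq_zero_left hw
  have hx0 := he.wp_ne_zero hul
  have hy0 := he.wp_sq_sub_ne_zero hul
  have hp := he.wpDeriv_sq (notMem_of_two_mul_notMem hul)
  have hq := hk.wpDeriv_sq (notMem_of_two_mul_notMem hsl)
  have hq0 := wpDeriv_ne_zero hsl
  have he0 := he.ne_zero
  have hk0 := hk.ne_zero
  have hr2 := hrh.self_of_nhds
  rw [coverF, coverG, eq_div_iff (by simp [h1, h2])] at hFG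
  constructor
  · intro h0
    rw [h0, mul_zero, zero_pow two_ne_zero, eq_comm, sq_eq_zero_iff, div_eq_zero_iff] at hsq
    rcases hsq with h | h
    · simp [hk0, hq0] at h
    · rw [hrs] at h
      simp [hc0, hH0, h2] at h
  · rw [← hr2] at hH0 ⊢
    have hr0 : r s ≠ 0 := fun h => hH0 (by rw [h]; ring)
    have hh : (wp ϱ s - 17 * k / 12) * (wp ϱ s + 7 * k / 12) = r s ^ 2 := hr2.symm
    rw [← hr2] at hsq
    generalize wp UpperHalfPlane.I (u s) = x at *
    generalize wpDeriv UpperHalfPlane.I (u s) = x' at *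
    generalize deriv u s = u' at *
    generalize wp ϱ s = z at *
    generalize wpDeriv ϱ s = z' at *
    generalize r s = r₀ at *
    have h4 : 4 * x ^ 2 * (x ^ 2 - e ^ 2) * ((z - 17 * k / 12) * (z + 7 * k / 12) ^ 3) =
        e ^ 4 * (k ^ 3 * (z + 10 * k / 12)) := by
      rw [← hFG]
      field_simp
    have h5 : 16 * x ^ 2 * x' ^ 2 * u' ^ 2 * (r₀ ^ 6 * (z + 7 * k / 12) ^ 2) =
        e ^ 4 * (9 / 4 * k ^ 6 * z' ^ 2) := by
      have h6 : (4 * (x / e) * (x' / e) * u') ^ 2 = 16 * x ^ 2 * x' ^ 2 * u' ^ 2 / e ^ 4 := by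
        field_simp
        ring
      have h7 : (-(3 / 2 * k ^ 3 * z') / (r₀ * r₀ ^ 2 * (z + 7 * k / 12))) ^ 2 =
          9 / 4 * k ^ 6 * z' ^ 2 / (r₀ ^ 6 * (z + 7 * k / 12) ^ 2) := by
        rw [div_pow]
        congr 1 <;> ring
      rw [h6, h7, div_eq_div_iff (pow_ne_zero 4 he0)
        (mul_ne_zero (pow_ne_zero 6 hr0) (pow_ne_zero 2 h2))] at hsq
      linear_combination hsq
    rw [hp, hq] at h5
    have h8 : e ^ 4 * k ^ 3 * (z + 10 * k / 12) * r₀ ^ 2 ≠ 0 := by simp [he0, hk0, h3, hr0]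
    refine mul_left_cancel₀ h8 ?_
    linear_combination h5 - 16 * x * u' ^ 2 * r₀ ^ 4 * h4 +
      (64 * x ^ 3 * (x ^ 2 - e ^ 2) * u' ^ 2 * r₀ ^ 4 *
      (z + 7 * k / 12) ^ 2 + 9 * e ^ 4 * k ^ 6 * (z + 10 * k / 12)) * hh

end Branch

/-! ### The Schwarzian relation and the transformation of the equations. -/

/-- The algebraic identity behind the transformation of potentials. -/
theorem schwarzian_identity {x p u₁ u₂ u₃ z z' z₂ h m A B e k : ℂ}
    (hx : x ≠ 0) (hy : x ^ 2 - e ^ 2 ≠ 0) (hu : u₁ ≠ 0) (hk : k ≠ 0)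
    (h1 : z - 17 * k / 12 ≠ 0) (h2 : z + 7 * k / 12 ≠ 0) (h3 : z + 10 * k / 12 ≠ 0)
    (hh : h = (z - 17 * k / 12) * (z + 7 * k / 12)) (hm : m = 2 * z - 10 * k / 12)
    (hp : p ^ 2 = 4 * x * (x ^ 2 - e ^ 2))
    (hz' : z' ^ 2 = 4 * (z - 17 * k / 12) * (z + 7 * k / 12) * (z + 10 * k / 12))
    (hz₂ : z₂ = 6 * z ^ 2 - 73 * k ^ 2 / 24)
    (hFG : 4 * x ^ 2 * (x ^ 2 - e ^ 2) * ((z - 17 * k / 12) * (z + 7 * k / 12) ^ 3) =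
      e ^ 4 * (k ^ 3 * (z + 10 * k / 12)))
    (hA : A * (4 * x * (x ^ 2 - e ^ 2)) = (x ^ 2 + e ^ 2) ^ 2)
    (hB : B * (4 * (z - 17 * k / 12) * (z + 7 * k / 12) * (z + 10 * k / 12)) =
      (z ^ 2 + 73 * k ^ 2 / 48) ^ 2 +
        2 * (4 * (17 * k / 12) * (7 * k / 12) * (10 * k / 12)) * z)
    (E0 : 16 * x * u₁ ^ 2 * h = 9 * k ^ 3)
    (E1 : p * u₁ ^ 2 * h + 2 * x * u₂ * h + x * u₁ * (z' * m) = 0)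
    (E2 : (6 * x ^ 2 - 2 * e ^ 2) * u₁ ^ 3 * h + 4 * p * u₁ * u₂ * h + 2 * p * u₁ ^ 2 * (z' * m) +
      2 * x * u₃ * h + 3 * x * u₂ * (z' * m) + x * u₁ * (2 * z' ^ 2 + m * z₂) = 0) :
    B + k / 3 = u₁ ^ 2 * A + (u₃ / u₁ - 3 / 2 * (u₂ / u₁) ^ 2) / 2 := by
  have hh0 : h ≠ 0 := by rw [hh]; exact mul_ne_zero h1 h2
  -- α and β are the logarithmic derivatives of ℘(u(s)) and of H(s); logarithmic differentiation of
  -- `E0` gives 2u''/u' = -(α + β).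
  obtain ⟨α, hα⟩ : ∃ α, α = p * u₁ / x := ⟨_, rfl⟩
  obtain ⟨β, hβ⟩ : ∃ β, β = z' * m / h := ⟨_, rfl⟩
  have hα' : p * u₁ = α * x := by rw [hα]; field_simp
  have hβ' : z' * m = β * h := by rw [hβ]; field_simp
  have hL : u₂ / u₁ = -(α + β) / 2 := by
    rw [div_eq_iff hu]
    have : (2 * x * h) ≠ 0 := by simp [hx, hh0]
    refine mul_left_cancel₀ this ?_
    linear_combination E1 - u₁ * h * hα' - x * u₁ * hβ'
  obtain ⟨L, hL'⟩ : ∃ L, L = u₂ / u₁ := ⟨_, rfl⟩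
  have hu₂ : u₂ = L * u₁ := by rw [hL']; field_simp
  have hS : (u₃ / u₁ - 3 / 2 * (u₂ / u₁) ^ 2) / 2 = 5 / 16 * α ^ 2 + 3 / 16 * β ^ 2 -
      (6 * x ^ 2 - 2 * e ^ 2) * u₁ ^ 2 / (4 * x) - (2 * z' ^ 2 + m * z₂) / (4 * h) := by
    have hu₃ : u₃ / u₁ = -((6 * x ^ 2 - 2 * e ^ 2) * u₁ ^ 2 / x + 4 * α * L + 2 * α * β +
        3 * L * β + (2 * z' ^ 2 + m * z₂) / h) / 2 := by
      rw [div_eq_iff hu]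
      have hc : (2 * x * h) ≠ 0 := by simp [hx, hh0]
      refine mul_left_cancel₀ hc ?_
      have e1 : (2 * x * h) * (-((6 * x ^ 2 - 2 * e ^ 2) * u₁ ^ 2 / x + 4 * α * L + 2 * α * β +
          3 * L * β + (2 * z' ^ 2 + m * z₂) / h) / 2 * u₁) =
          -((6 * x ^ 2 - 2 * e ^ 2) * u₁ ^ 2 * h + x * h * (4 * α * L + 2 * α * β +
          3 * L * β) + x * (2 * z' ^ 2 + m * z₂)) * u₁ := by
        field_simp
        ring
      rw [e1]
      rw [hu₂] at E2
      linear_combination E2 - (4 * L * u₁ * h + 2 * u₁ * z' * m) * hα' -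
        (2 * α * x * u₁ + 3 * x * L * u₁) * hβ'
    rw [hu₃, hL', hL]
    ring
  have hα2 : α ^ 2 = 4 * (x ^ 2 - e ^ 2) * u₁ ^ 2 / x := by
    rw [hα, div_pow, mul_pow, hp]
    field_simp
  have hβ2 : β ^ 2 = 4 * (z + 10 * k / 12) * m ^ 2 / h := by
    rw [hβ, div_pow, mul_pow, hz', div_eq_div_iff (pow_ne_zero 2 hh0) hh0]
    linear_combination (-4 * (z + 10 * k / 12) * m ^ 2 * h) * hh
  have hA' : A = (x ^ 2 + e ^ 2) ^ 2 / (4 * x * (x ^ 2 - e ^ 2)) := by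
    rw [← hA, mul_div_cancel_right₀]
    simp [hx, hy]
  have hB' : B = ((z ^ 2 + 73 * k ^ 2 / 48) ^ 2 +
        2 * (4 * (17 * k / 12) * (7 * k / 12) * (10 * k / 12)) * z) /
      (4 * (z - 17 * k / 12) * (z + 7 * k / 12) * (z + 10 * k / 12)) := by
    rw [← hB, mul_div_cancel_right₀]
    simp [h1, h2, h3]
  -- All terms in ℘(u) collect to u'²e⁴/(x(x² - e²)), which `E0` and F = G convert into a function
  -- of z alone.
  have hU : u₁ ^ 2 * A + 5 / 16 * α ^ 2 - (6 * x ^ 2 - 2 * e ^ 2) * u₁ ^ 2 / (4 * x) =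
      9 / 4 * (z + 7 * k / 12) ^ 2 / (z + 10 * k / 12) := by
    have e1 : u₁ ^ 2 * A + 5 / 16 * α ^ 2 - (6 * x ^ 2 - 2 * e ^ 2) * u₁ ^ 2 / (4 * x) =
        u₁ ^ 2 * e ^ 4 / (x * (x ^ 2 - e ^ 2)) := by
      rw [hA', hα2]
      field_simp
      ring
    rw [e1, div_eq_div_iff (mul_ne_zero hx hy) h3]
    have hc : 16 * x * h * k ^ 3 ≠ 0 := by simp [hx, hh0, hk]
    refine mul_left_cancel₀ hc ?_
    linear_combination (e ^ 4 * k ^ 3 * (z + 10 * k / 12)) * E0 - 9 * k ^ 3 * hFG +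
      (-36 * k ^ 3 * x ^ 2 * (x ^ 2 - e ^ 2) * (z + 7 * k / 12) ^ 2) * hh
  rw [hS]
  -- What remains is a rational identity in z and k; the constant k/3 of the second equation is the
  -- one making it hold.
  have hV : B + k / 3 = 9 / 4 * (z + 7 * k / 12) ^ 2 / (z + 10 * k / 12) + 3 / 16 * β ^ 2 -
      (2 * z' ^ 2 + m * z₂) / (4 * h) := by
    rw [hβ2, hz', hz₂, hm, hh, hB']
    clear * - h1 h2 h3
    obtain ⟨a, ha⟩ : ∃ a, a = z - 17 * k / 12 := ⟨_, rfl⟩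
    obtain ⟨b, hb⟩ : ∃ b, b = z + 7 * k / 12 := ⟨_, rfl⟩
    obtain ⟨c, hc⟩ : ∃ c, c = z + 10 * k / 12 := ⟨_, rfl⟩
    rw [← ha] at h1
    rw [← hb] at h2
    rw [← hc] at h3
    rw [← ha, ← hb, ← hc]
    field_simp
    rw [ha, hb, hc]
    ring
  rw [hV, ← hU]
  ring

section Branch

variable {ϱ : UpperHalfPlane} {e k : ℂ} (he : LemniscaticValue e) (hk : TorusValue ϱ k)
  {D : Set ℂ} {u : ℂ → ℂ} (hu : IsBranchOn ϱ D u)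
include he hk hu

/-- The relation of `branch_derivative` holds throughout D, so it can be differentiated twice; this
produces the expressions for u'' and u''' consumed by `schwarzian_identity`. -/
theorem branch_schwarzian {s : ℂ} (hs : s ∈ D) :
    wp ϱ (2 * s) + k / 3 = deriv u s ^ 2 * wp UpperHalfPlane.I (2 * u s) +
      (deriv (deriv (deriv u)) s / deriv u s -
        3 / 2 * (deriv (deriv u) s / deriv u s) ^ 2) / 2 := by
  have hrel := fun w hw => (transcendentalRelation_iff he hk (u w) w).mp (hu.2.2 w hw)
  have hE0 := fun w hw => branch_derivative he hk hu (s := w) hw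
  have dU1 : ∀ w ∈ D, HasDerivAt (deriv u) (deriv (deriv u) w) w := fun w hw =>
    (hu.analyticAt hw).deriv.differentiableAt.hasDerivAt
  have dU2 : ∀ w ∈ D, HasDerivAt (deriv (deriv u)) (deriv (deriv (deriv u)) w) w := fun w hw =>
    (hu.analyticAt hw).deriv.deriv.differentiableAt.hasDerivAt
  have dX : ∀ w ∈ D, HasDerivAt (fun v => wp UpperHalfPlane.I (u v))
      (wpDeriv UpperHalfPlane.I (u w) * deriv u w) w := fun w hw =>
    (hasDerivAt_wp (notMem_of_two_mul_notMem (hrel w hw).1)).comp w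
      (hu.analyticAt hw).differentiableAt.hasDerivAt
  have dP : ∀ w ∈ D, HasDerivAt (fun v => wpDeriv UpperHalfPlane.I (u v))
      ((6 * wp UpperHalfPlane.I (u w) ^ 2 - 2 * e ^ 2) * deriv u w) w := fun w hw => by
    have h := ((torusPeriods UpperHalfPlane.I).hasDerivAt_derivWeierstrassP
      (notMem_of_two_mul_notMem (hrel w hw).1)).comp w
      (hu.analyticAt hw).differentiableAt.hasDerivAt
    refine HasDerivAt.congr_deriv h ?_
    rw [he.g₂_eq, wp]
    ring
  have dZ : ∀ w ∈ D, HasDerivAt (wp ϱ) (wpDeriv ϱ w) w := fun w hw =>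
    hasDerivAt_wp (notMem_of_two_mul_notMem (hrel w hw).2.1)
  have dZ' : ∀ w ∈ D, HasDerivAt (wpDeriv ϱ) (6 * wp ϱ w ^ 2 - 73 * k ^ 2 / 24) w := fun w hw => by
    have h := (torusPeriods ϱ).hasDerivAt_derivWeierstrassP
      (notMem_of_two_mul_notMem (hrel w hw).2.1)
    refine HasDerivAt.congr_deriv h ?_
    rw [hk.g₂_eq, wp]
    ring
  have dH : ∀ w ∈ D, HasDerivAt (coverH ϱ k) (wpDeriv ϱ w * (2 * wp ϱ w - 10 * k / 12)) w :=
    fun w hw => by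
    refine HasDerivAt.congr_deriv
      (((dZ w hw).sub_const (17 * k / 12)).mul ((dZ w hw).add_const (7 * k / 12))) ?_
    ring
  have E1 : ∀ w ∈ D, wpDeriv UpperHalfPlane.I (u w) * deriv u w ^ 2 * coverH ϱ k w +
      2 * wp UpperHalfPlane.I (u w) * deriv (deriv u) w * coverH ϱ k w +
      wp UpperHalfPlane.I (u w) * deriv u w * (wpDeriv ϱ w * (2 * wp ϱ w - 10 * k / 12)) = 0 := by
    intro w hw
    have h := (((dX w hw).const_mul 16).mul ((dU1 w hw).pow 2)).mul (dH w hw)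
    have h0 : HasDerivAt (fun _ : ℂ => 9 * k ^ 3) 0 w := hasDerivAt_const _ _
    have hev : (fun v => 16 * wp UpperHalfPlane.I (u v) * deriv u v ^ 2 * coverH ϱ k v) =ᶠ[𝓝 w]
        fun _ : ℂ => 9 * k ^ 3 := by
      filter_upwards [hu.1.mem_nhds hw] with v hv using (hE0 v hv).2
    have h1 := h.unique (h0.congr_of_eventuallyEq hev)
    simp only [Nat.cast_ofNat, Nat.reduceSub, pow_one, Pi.mul_apply, Pi.pow_apply] at h1
    refine mul_left_cancel₀ (hE0 w hw).1 ?_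
    linear_combination h1 / 16
  have E2 : (6 * wp UpperHalfPlane.I (u s) ^ 2 - 2 * e ^ 2) * deriv u s ^ 3 * coverH ϱ k s +
      4 * wpDeriv UpperHalfPlane.I (u s) * deriv u s * deriv (deriv u) s * coverH ϱ k s +
      2 * wpDeriv UpperHalfPlane.I (u s) * deriv u s ^ 2 *
        (wpDeriv ϱ s * (2 * wp ϱ s - 10 * k / 12)) +
      2 * wp UpperHalfPlane.I (u s) * deriv (deriv (deriv u)) s * coverH ϱ k s +
      3 * wp UpperHalfPlane.I (u s) * deriv (deriv u) s *
        (wpDeriv ϱ s * (2 * wp ϱ s - 10 * k / 12)) +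
      wp UpperHalfPlane.I (u s) * deriv u s * (2 * wpDeriv ϱ s ^ 2 +
        (2 * wp ϱ s - 10 * k / 12) * (6 * wp ϱ s ^ 2 - 73 * k ^ 2 / 24)) = 0 := by
    have h := ((((dP s hs).mul ((dU1 s hs).pow 2)).mul (dH s hs)).add
      ((((dX s hs).const_mul 2).mul (dU2 s hs)).mul (dH s hs))).add
      (((dX s hs).mul (dU1 s hs)).mul
        ((dZ' s hs).mul (((dZ s hs).const_mul 2).sub_const (10 * k / 12))))
    have h0 : HasDerivAt (fun _ : ℂ => (0 : ℂ)) 0 s := hasDerivAt_const _ _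
    have hev : (fun w => wpDeriv UpperHalfPlane.I (u w) * deriv u w ^ 2 * coverH ϱ k w +
      2 * wp UpperHalfPlane.I (u w) * deriv (deriv u) w * coverH ϱ k w +
      wp UpperHalfPlane.I (u w) * deriv u w * (wpDeriv ϱ w * (2 * wp ϱ w - 10 * k / 12))) =ᶠ[𝓝 s]
        fun _ : ℂ => (0 : ℂ) := by
      filter_upwards [hu.1.mem_nhds hs] with v hv using E1 v hv
    have h1 := h.unique (h0.congr_of_eventuallyEq hev)
    simp only [Nat.cast_ofNat, Nat.reduceSub, pow_one, Pi.mul_apply, Pi.pow_apply] at h1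
    linear_combination h1
  obtain ⟨hul, hsl, hFG⟩ := hrel s hs
  obtain ⟨h1, h2, h3⟩ := hk.factors_ne_zero hsl
  have he0 := he.ne_zero
  rw [coverF, coverG, eq_div_iff (by simp [h1, h2])] at hFG
  refine schwarzian_identity (he.wp_ne_zero hul) (he.wp_sq_sub_ne_zero hul) (hE0 s hs).1 hk.ne_zero
    h1 h2 h3 rfl rfl (he.wpDeriv_sq (notMem_of_two_mul_notMem hul))
    (hk.wpDeriv_sq (notMem_of_two_mul_notMem hsl)) rfl ?_ (he.wp_two_mul hul) (hk.wp_two_mul hsl)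
    (hE0 s hs).2 (E1 s hs) E2
  rw [← hFG]
  field_simp

end Branch

/-- A change of the independent variable in a linear equation of second order in normal form. -/
theorem isSolutionOn_iff_of_schwarzian {D : Set ℂ} {u m Ψ ψ Q q : ℂ → ℂ} (hD : IsOpen D)
    (hu : DifferentiableOn ℂ u D) (hu' : ∀ s ∈ D, deriv u s ≠ 0) (hm : DifferentiableOn ℂ m D)
    (hmu : ∀ s ∈ D, m s ^ 2 = deriv u s) (hΨ : ∀ s ∈ D, Ψ (u s) = m s * ψ s)
    (hq : ∀ s ∈ D, q s = deriv u s ^ 2 * Q (u s) - (deriv (deriv (deriv u)) s / deriv u s -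
        3 / 2 * (deriv (deriv u) s / deriv u s) ^ 2) / 2) :
    IsSolutionOn Q (u '' D) Ψ ↔ IsSolutionOn q D ψ := by
  have au : ∀ s ∈ D, AnalyticAt ℂ u s := fun s hs => hu.analyticAt (hD.mem_nhds hs)
  have am : ∀ s ∈ D, AnalyticAt ℂ m s := fun s hs => hm.analyticAt (hD.mem_nhds hs)
  have hm0 : ∀ s ∈ D, m s ≠ 0 := fun s hs h => hu' s hs (by rw [← hmu s hs, h]; ring)
  have hcomp : ∀ s ∈ D, Ψ ∘ u =ᶠ[𝓝 s] m * ψ := fun s hs => by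
    filter_upwards [hD.mem_nhds hs] with w hw using hΨ w hw
  have hopen : IsOpen (u '' D) := by
    rw [isOpen_iff_mem_nhds]
    rintro _ ⟨s, hs, rfl⟩
    rw [← (au s hs).hasStrictDerivAt.map_nhds_eq (hu' s hs)]
    exact image_mem_map (hD.mem_nhds hs)
  -- Local invertibility of u suffices: analyticity of Ψ at u(s) is equivalent to that of Ψ ∘ u = mψ
  -- at s, so u need not be injective on D.
  have hdiff : (∀ s ∈ D, AnalyticAt ℂ Ψ (u s)) ↔ ∀ s ∈ D, AnalyticAt ℂ ψ s := by
    refine forall₂_congr fun s hs => ?_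
    rw [← analyticAt_comp_iff_of_deriv_ne_zero (au s hs) (hu' s hs),
      analyticAt_congr (hcomp s hs)]
    refine ⟨fun h => ?_, fun h => (am s hs).mul h⟩
    refine (h.div (am s hs) (hm0 s hs)).congr ?_
    filter_upwards [hD.mem_nhds hs] with w hw
    simp [hm0 w hw]
  have hdΨ : DifferentiableOn ℂ Ψ (u '' D) ↔ ∀ s ∈ D, AnalyticAt ℂ Ψ (u s) :=
    ⟨fun h s hs => h.analyticAt (hopen.mem_nhds ⟨s, hs, rfl⟩), by
      rintro h _ ⟨s, hs, rfl⟩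
      exact (h s hs).differentiableAt.differentiableWithinAt⟩
  have hdψ : DifferentiableOn ℂ ψ D ↔ ∀ s ∈ D, AnalyticAt ℂ ψ s :=
    ⟨fun h s hs => h.analyticAt (hD.mem_nhds hs), fun h s hs =>
      (h s hs).differentiableAt.differentiableWithinAt⟩
  rw [IsSolutionOn, IsSolutionOn, hdΨ, hdψ, hdiff]
  refine and_congr_right fun aψ => ?_
  have aΨ := hdiff.mpr aψ
  rw [Set.forall_mem_image]
  refine forall₂_congr fun s hs => ?_
  have e1 : ∀ w ∈ D, deriv Ψ (u w) * deriv u w = deriv m w * ψ w + m w * deriv ψ w := fun w hw => by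
    have h1 := (aΨ w hw).differentiableAt.hasDerivAt.comp w (au w hw).differentiableAt.hasDerivAt
    have h2 := (am w hw).differentiableAt.hasDerivAt.mul (aψ w hw).differentiableAt.hasDerivAt
    exact h1.unique (h2.congr_of_eventuallyEq (hcomp w hw))
  have e2 : deriv (deriv Ψ) (u s) * deriv u s * deriv u s + deriv Ψ (u s) * deriv (deriv u) s =
      deriv (deriv m) s * ψ s + deriv m s * deriv ψ s +
        (deriv m s * deriv ψ s + m s * deriv (deriv ψ) s) := by
    have h1 := ((aΨ s hs).deriv.differentiableAt.hasDerivAt.comp s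
      (au s hs).differentiableAt.hasDerivAt).mul (au s hs).deriv.differentiableAt.hasDerivAt
    have h2 := ((am s hs).deriv.differentiableAt.hasDerivAt.mul
      (aψ s hs).differentiableAt.hasDerivAt).add ((am s hs).differentiableAt.hasDerivAt.mul
      (aψ s hs).deriv.differentiableAt.hasDerivAt)
    refine h1.unique (h2.congr_of_eventuallyEq ?_)
    filter_upwards [hD.mem_nhds hs] with w hw using e1 w hw
  have e3 : ∀ w ∈ D, deriv (deriv u) w = 2 * m w * deriv m w := fun w hw => by
    have h1 := (am w hw).differentiableAt.hasDerivAt.pow 2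
    have h2 := (au w hw).deriv.differentiableAt.hasDerivAt.unique (h1.congr_of_eventuallyEq (by
      filter_upwards [hD.mem_nhds hw] with v hv using (hmu v hv).symm))
    simpa using h2
  have e4 : deriv (deriv (deriv u)) s =
      2 * deriv m s * deriv m s + 2 * m s * deriv (deriv m) s := by
    have h1 := ((am s hs).differentiableAt.hasDerivAt.const_mul 2).mul
      (am s hs).deriv.differentiableAt.hasDerivAt
    refine (au s hs).deriv.deriv.differentiableAt.hasDerivAt.unique (h1.congr_of_eventuallyEq ?_)
    filter_upwards [hD.mem_nhds hs] with v hv using e3 v hv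
  have e5 := e1 s hs
  rw [hq s hs, hΨ s hs]
  rw [e3 s hs, ← hmu s hs] at e2 ⊢
  rw [← hmu s hs] at e5
  rw [e4]
  have h0 := hm0 s hs
  generalize deriv (deriv Ψ) (u s) = Y2 at *
  generalize deriv Ψ (u s) = Y1 at *
  generalize deriv (deriv ψ) s = y2 at *
  generalize deriv ψ s = y1 at *
  generalize deriv (deriv m) s = m2 at *
  generalize deriv m s = m1 at *
  -- With u' = m², half the Schwarzian of u is m''/m - 2(m'/m)², exactly the coefficient that
  -- appears once the first derivatives of Ψ and ψ are eliminated.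
  have e6 : Y2 * m s ^ 4 = m s * y2 + ψ s * (m2 - 2 * m1 ^ 2 / m s) := by
    have : Y1 * m s = (m1 * ψ s + m s * y1) / m s := by
      rw [← e5]; field_simp
    have e7 : Y2 * m s ^ 4 = m2 * ψ s + 2 * m1 * y1 + m s * y2 - 2 * m1 * (Y1 * m s) := by
      linear_combination e2
    rw [e7, this]
    field_simp
    ring
  have e8 : ((m s ^ 2) ^ 2 * Q (u s) - ((2 * m1 * m1 + 2 * m s * m2) / m s ^ 2 -
      3 / 2 * (2 * m s * m1 / m s ^ 2) ^ 2) / 2) * ψ s =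
      m s ^ 4 * Q (u s) * ψ s - ψ s * (m2 - 2 * m1 ^ 2 / m s) / m s := by
    field_simp
    ring
  rw [e8]
  constructor
  · intro h
    rw [h] at e6
    rw [eq_sub_iff_add_eq, ← mul_right_inj' h0]
    have : m s * (y2 + ψ s * (m2 - 2 * m1 ^ 2 / m s) / m s) =
      m s * y2 + ψ s * (m2 - 2 * m1 ^ 2 / m s) := by field_simp
    rw [this, ← e6]
    ring
  · intro h
    rw [h] at e6
    refine mul_right_cancel₀ (pow_ne_zero 4 h0) ?_
    rw [e6]
    field_simp
    ring

/-! ### Fibre products of branched covers. -/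

section FibreProduct

variable {E X Y Z : Type*} [TopologicalSpace E] [TopologicalSpace X] [TopologicalSpace Y]
  [TopologicalSpace Z] {p : E → X} {q : E → Y} {f : X → Z} {g : Y → Z}

/-- The base change of an open map is open. -/
theorem isOpenMap_of_fibreProduct (hi : IsInducing fun e => (p e, q e))
    (hr : ∀ x y, f x = g y ↔ ∃ e, p e = x ∧ q e = y) (hf : Continuous f) (hg : IsOpenMap g) :
    IsOpenMap p := by
  intro W hW
  rw [isOpen_iff_mem_nhds]
  rintro _ ⟨e, he, rfl⟩
  have h1 := hW.mem_nhds he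
  rw [hi.nhds_eq_comap, mem_comap] at h1
  obtain ⟨T, hT, hTW⟩ := h1
  -- A point x near p e has f x in g(V), a neighbourhood of f (p e) since g is open; it therefore
  -- lifts to a point with second coordinate in V.
  obtain ⟨U, hU, V, hV, hUV⟩ := mem_nhds_prod_iff.mp hT
  have h2 : g '' V ∈ 𝓝 (f (p e)) := by
    rw [(hr _ _).mpr ⟨e, rfl, rfl⟩]
    exact hg.image_mem_nhds hV
  filter_upwards [hU, hf.continuousAt h2] with x hx hx'
  obtain ⟨y, hy, hyx⟩ := hx'
  obtain ⟨e', rfl, rfl⟩ := (hr x y).mp hyx.symm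
  exact ⟨e', hTW (hUV ⟨hx, hy⟩), rfl⟩

/-- Fibres over a trivializing neighbourhood are in bijection, so the number of sheets is locally
constant; on a connected base it is then constant. -/
theorem IsCoveringMapOn.continuousOn_ncard {s : Set X} (h : IsCoveringMapOn p s)
    (hp : Function.Surjective p) : ContinuousOn (fun x => (p ⁻¹' {x}).ncard) s := by
  intro x hx
  obtain ⟨e, he⟩ := hp x
  have : Nonempty (p ⁻¹' {x}) := ⟨⟨e, he⟩⟩
  have hT := (h x hx).mem_toTrivialization_baseSet
  have hconst : ContinuousWithinAt (fun _ : X => (p ⁻¹' {x}).ncard) s x := continuousWithinAt_const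
  refine hconst.congr_of_eventuallyEq (eventually_nhdsWithin_of_eventually_nhds ?_) rfl
  filter_upwards [(h x hx).toTrivialization.open_baseSet.mem_nhds hT] with y hy
  exact Nat.card_congr ((h x hx).toTrivialization.preimageSingletonHomeomorph hy).toEquiv

/-- A projection of the fibre product of two branched covers of `Z` is a branched cover. -/
theorem isFinitelySheetedCover_of_fibreProduct [CompactSpace E] [T2Space E] [T2Space X]
    (hi : IsEmbedding fun e => (p e, q e)) (hr : ∀ x y, f x = g y ↔ ∃ e, p e = x ∧ q e = y)
    (hf : Continuous f) (hff : ∀ z, (f ⁻¹' {z}).Finite) (hg : IsOpenMap g)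
    (hgs : Function.Surjective g) (hgf : ∀ z, (g ⁻¹' {z}).Finite) {S : Set Z} (hS : S.Finite)
    (hinj : ∀ y, g y ∉ S → ∃ U ∈ 𝓝 y, Set.InjOn g U)
    (hconn : ∀ B : Set X, B.Finite → IsPreconnected Bᶜ) : IsFinitelySheetedCover p := by
  have hpq := hi.continuous
  have hp : Continuous p := hpq.fst
  have hq : Continuous q := hpq.snd
  have hopen := isOpenMap_of_fibreProduct hi.isInducing hr hf hg
  have hsurj : Function.Surjective p := fun x => by
    obtain ⟨y, hy⟩ := hgs (f x)
    obtain ⟨e, he, -⟩ := (hr x y).mp hy.symm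
    exact ⟨e, he⟩
  -- On a fibre of p the other projection is injective, with values in a fibre of g.
  have hfin : ∀ x, (p ⁻¹' {x}).Finite := fun x => by
    refine Set.Finite.of_finite_image (f := q) ((hgf (f x)).subset ?_) ?_
    · rintro _ ⟨e, rfl, rfl⟩
      exact ((hr _ _).mpr ⟨e, rfl, rfl⟩).symm
    · intro e he e' he' h
      exact hi.injective (Prod.ext (he.trans he'.symm) h)
  have hBf : (f ⁻¹' S).Finite := by
    rw [← Set.biUnion_preimage_singleton]
    exact hS.biUnion fun z _ => hff z
  refine ⟨hp, hopen, hp.isClosedMap, hsurj, hfin, f ⁻¹' S, hBf, ?_⟩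
  -- Off `f ⁻¹' S` local injectivity of g passes to p, since p e and q e determine e. Openness makes
  -- p a local homeomorphism there, and compactness of E makes it a covering.
  · have hcov : IsCoveringMapOn p (f ⁻¹' S)ᶜ := by
      refine IsCoveringMapOn.of_isLocalHomeomorphOn hp
        ((isLocalHomeomorphOn_iff_isOpenEmbedding_restrict _).mpr fun e he => ?_)
      have hge : g (q e) ∉ S := by
        rw [← (hr _ _).mpr ⟨e, rfl, rfl⟩]
        exact he
      obtain ⟨U, hU, hUinj⟩ := hinj (q e) hge
      obtain ⟨V, hVU, hVo, hV⟩ := mem_nhds_iff.mp hU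
      have hW : IsOpen (q ⁻¹' V) := hVo.preimage hq
      refine ⟨q ⁻¹' V, hW.mem_nhds hV, IsOpenEmbedding.of_continuous_injective_isOpenMap
        (hp.comp continuous_subtype_val) ?_ (hopen.comp hW.isOpenMap_subtype_val)⟩
      rintro ⟨e₁, h₁⟩ ⟨e₂, h₂⟩ (h : p e₁ = p e₂)
      refine Subtype.ext (hi.injective (Prod.ext h (hUinj (hVU h₁) (hVU h₂) ?_)))
      rw [← (hr _ _).mpr ⟨e₁, rfl, rfl⟩, ← (hr _ _).mpr ⟨e₂, rfl, rfl⟩, h]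
    refine ⟨hcov, ?_⟩
    rcases (f ⁻¹' S)ᶜ.eq_empty_or_nonempty with h | ⟨x, hx⟩
    · exact ⟨1, one_pos, fun t ht => absurd (show t ∈ (f ⁻¹' S)ᶜ from ht) (by simp [h])⟩
    · refine ⟨(p ⁻¹' {x}).ncard, ?_, fun t ht =>
        (hconn _ hBf).constant (hcov.continuousOn_ncard hsurj) ht hx⟩
      obtain ⟨e, he⟩ := hsurj x
      exact (Set.ncard_pos (hfin x)).mpr ⟨e, he⟩

end FibreProduct

/-- A map on a compact space with isolated, closed fibres has finite fibres. -/
theorem finite_preimage_singleton {X Z : Type*} [TopologicalSpace X] [CompactSpace X]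
    [TopologicalSpace Z] [T1Space Z] {f : X → Z} (hf : Continuous f)
    (h : ∀ x, ∀ᶠ y in 𝓝[≠] x, f y ≠ f x) (z : Z) : (f ⁻¹' {z}).Finite := by
  by_contra hinf
  obtain ⟨x, hx⟩ := Set.Infinite.exists_accPt_principal hinf
  rw [accPt_iff_frequently_nhdsNE] at hx
  have hxz : f x = z := (isClosed_singleton.preimage hf).closure_subset
    (mem_closure_iff_frequently.mpr (hx.filter_mono nhdsWithin_le_nhds))
  obtain ⟨y, hy, hy'⟩ := (hx.and_eventually (h x)).exists
  exact hy' (hy.trans hxz.symm)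

/-! ### The Riemann sphere and rational maps. -/

/-- The inversion `z ↦ 1/z` of the Riemann sphere. -/
def sphereInv (z : OnePoint ℂ) : OnePoint ℂ :=
  z.elim ((0 : ℂ) : OnePoint ℂ) fun y => if y = 0 then OnePoint.infty else ((y⁻¹ : ℂ) : OnePoint ℂ)

theorem sphereInv_infty : sphereInv OnePoint.infty = ((0 : ℂ) : OnePoint ℂ) := rfl

theorem sphereInv_zero : sphereInv ((0 : ℂ) : OnePoint ℂ) = OnePoint.infty := by
  simp [sphereInv]

theorem sphereInv_coe {y : ℂ} (hy : y ≠ 0) : sphereInv y = ((y⁻¹ : ℂ) : OnePoint ℂ) := by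
  simp [sphereInv, hy]

theorem sphereInv_involutive : Function.Involutive sphereInv := by
  intro z
  induction z using OnePoint.rec with
  | infty => rw [sphereInv_infty, sphereInv_zero]
  | coe y =>
    by_cases hy : y = 0
    · rw [hy, sphereInv_zero, sphereInv_infty]
    · rw [sphereInv_coe hy, sphereInv_coe (inv_ne_zero hy), inv_inv]

theorem tendsto_coe_cobounded :
    Tendsto ((↑) : ℂ → OnePoint ℂ) (Bornology.cobounded ℂ) (𝓝 OnePoint.infty) := by
  rw [Metric.cobounded_eq_cocompact, ← coclosedCompact_eq_cocompact]
  exact OnePoint.tendsto_coe_infty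

theorem continuous_onePoint_iff {Y : Type*} [TopologicalSpace Y] (f : OnePoint ℂ → Y) :
    Continuous f ↔ Tendsto (fun x : ℂ => f x) (Bornology.cobounded ℂ) (𝓝 (f OnePoint.infty)) ∧
      Continuous fun x : ℂ => f x := by
  rw [OnePoint.continuous_iff, Metric.cobounded_eq_cocompact, coclosedCompact_eq_cocompact]

theorem continuous_sphereInv : Continuous sphereInv := by
  rw [continuous_onePoint_iff]
  constructor
  · rw [sphereInv_infty]
    have h : Tendsto (fun x : ℂ => ((x⁻¹ : ℂ) : OnePoint ℂ)) (Bornology.cobounded ℂ)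
        (𝓝 ((0 : ℂ) : OnePoint ℂ)) :=
      (OnePoint.continuous_coe.tendsto 0).comp tendsto_inv₀_cobounded
    refine h.congr' ?_
    filter_upwards [Bornology.eventually_ne_cobounded (0 : ℂ)] with x hx
    rw [sphereInv_coe hx]
  · rw [continuous_iff_continuousAt]
    intro x
    by_cases hx : x = 0
    · subst hx
      rw [continuousAt_iff_punctured_nhds, sphereInv_zero]
      refine (tendsto_coe_cobounded.comp tendsto_inv₀_nhdsNE_zero).congr' ?_
      filter_upwards [self_mem_nhdsWithin] with y hy
      exact (sphereInv_coe hy).symm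
    · have h : ContinuousAt (fun y : ℂ => ((y⁻¹ : ℂ) : OnePoint ℂ)) x :=
        OnePoint.continuous_coe.continuousAt.comp (continuousAt_inv₀ hx)
      refine h.congr ?_
      filter_upwards [isOpen_ne.mem_nhds hx] with y hy
      exact (sphereInv_coe hy).symm

/-- The inversion as a homeomorphism. -/
def sphereInvHomeomorph : OnePoint ℂ ≃ₜ OnePoint ℂ where
  toEquiv := sphereInv_involutive.toPerm
  continuous_toFun := continuous_sphereInv
  continuous_invFun := continuous_sphereInv

/-- Continuity makes the singularity at u removable; an analytic germ is either constant, which is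
excluded, or open. -/
theorem nhds_le_map_of_eq_coe {φ : ℂ → OnePoint ℂ} {h : ℂ → ℂ} {u c : ℂ}
    (hc : ContinuousAt φ u)
    (hd : ∀ᶠ w in 𝓝[≠] u, DifferentiableAt ℂ h w ∧ φ w = h w)
    (hne : ∀ᶠ w in 𝓝[≠] u, φ w ≠ φ u) (hu : φ u = c) : 𝓝 (φ u) ≤ map φ (𝓝 u) := by
  set k := Function.update h u c with hk
  have hku : k u = c := Function.update_self ..
  have hkw : ∀ w, w ≠ u → k w = h w := fun w hw => Function.update_of_ne hw ..
  have hφ : φ =ᶠ[𝓝 u] fun w => ((k w : ℂ) : OnePoint ℂ) := by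
    filter_upwards [eventually_nhdsWithin_iff.mp hd] with w hw
    by_cases hwu : w = u
    · rw [hwu, hku, hu]
    · rw [hkw w hwu, (hw hwu).2]
  have hkc : ContinuousAt k u := by
    rw [OnePoint.isOpenEmbedding_coe.isInducing.continuousAt_iff]
    exact hc.congr hφ
  have hka : AnalyticAt ℂ k u := by
    refine analyticAt_of_differentiable_on_punctured_nhds_of_continuousAt ?_ hkc
    filter_upwards [hd, self_mem_nhdsWithin] with w hw hwu
    refine hw.1.congr_of_eventuallyEq ?_
    filter_upwards [isOpen_ne.mem_nhds hwu] with v hv using hkw v hv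
  rcases hka.eventually_constant_or_nhds_le_map_nhds with h1 | h1
  · exfalso
    obtain ⟨w, hw1, hw2, hw3⟩ := ((h1.filter_mono nhdsWithin_le_nhds).and
      (hne.and (hφ.filter_mono nhdsWithin_le_nhds))).exists
    exact hw2 (hw3.trans (by simp only [hw1, hku, hu]))
  · rw [hu, OnePoint.nhds_coe_eq, map_congr hφ, ← hku]
    have := map_mono (m := ((↑) : ℂ → OnePoint ℂ)) h1
    rwa [map_map] at this

/-- A nonconstant meromorphic function is an open map to the Riemann sphere. -/
theorem isOpenMap_of_eventually_eq_coe {φ : ℂ → OnePoint ℂ} {h : ℂ → ℂ} (hc : Continuous φ)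
    (hd : ∀ u, ∀ᶠ w in 𝓝[≠] u, DifferentiableAt ℂ h w ∧ φ w = h w)
    (hne : ∀ u, ∀ᶠ w in 𝓝[≠] u, φ w ≠ φ u) : IsOpenMap φ := by
  refine IsOpenMap.of_nhds_le fun u => ?_
  by_cases hu : φ u = OnePoint.infty
  -- At a pole the finite case is applied to 1/φ, and inversion, a homeomorphism, carries the result
  -- back.
  · have hc' : Continuous fun w => sphereInv (φ w) := continuous_sphereInv.comp hc
    have h0 : ∀ᶠ w in 𝓝 u, φ w ≠ ((0 : ℂ) : OnePoint ℂ) :=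
      hc.continuousAt.eventually_ne (by rw [hu]; exact OnePoint.infty_ne_coe 0)
    have h1 : 𝓝 (sphereInv (φ u)) ≤ map (fun w => sphereInv (φ w)) (𝓝 u) := by
      refine nhds_le_map_of_eq_coe (h := fun w => (h w)⁻¹) (c := 0) hc'.continuousAt ?_ ?_
        (by rw [hu, sphereInv_infty])
      · filter_upwards [hd u, h0.filter_mono nhdsWithin_le_nhds] with w hw hw0
        rw [hw.2] at hw0 ⊢
        have hw0' : h w ≠ 0 := fun h => hw0 (by rw [h])
        exact ⟨hw.1.inv hw0', sphereInv_coe hw0'⟩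
      · filter_upwards [hne u] with w hw
        exact sphereInv_involutive.injective.ne hw
    have h2 := map_mono (m := sphereInv) h1
    rw [map_map] at h2
    have h3 : map sphereInv (𝓝 (sphereInv (φ u))) = 𝓝 (φ u) := by
      have := sphereInvHomeomorph.map_nhds_eq (sphereInv (φ u))
      rw [show sphereInvHomeomorph (sphereInv (φ u)) = φ u from sphereInv_involutive _] at this
      exact this
    rw [h3] at h2
    refine h2.trans (le_of_eq (congrArg (fun ψ => map ψ (𝓝 u)) ?_))
    funext w
    exact sphereInv_involutive _
  · obtain ⟨c, hc'⟩ := OnePoint.ne_infty_iff_exists.mp hu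
    exact nhds_le_map_of_eq_coe hc.continuousAt (hd u) (hne u) hc'.symm

/-- The point `a : b` of the Riemann sphere. -/
def sphereQuot (a b : ℂ) : OnePoint ℂ :=
  if b = 0 then OnePoint.infty else ((a / b : ℂ) : OnePoint ℂ)

theorem sphereQuot_zero (a : ℂ) : sphereQuot a 0 = OnePoint.infty := if_pos rfl

theorem sphereQuot_of_ne {a b : ℂ} (hb : b ≠ 0) : sphereQuot a b = ((a / b : ℂ) : OnePoint ℂ) :=
  if_neg hb

theorem sphereQuot_eq_sphereInv {a b : ℂ} (ha : a ≠ 0) :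
    sphereQuot a b = sphereInv ((b / a : ℂ) : OnePoint ℂ) := by
  by_cases hb : b = 0
  · rw [hb, sphereQuot_zero, zero_div, sphereInv_zero]
  · rw [sphereQuot_of_ne hb, sphereInv_coe (div_ne_zero hb ha), inv_div]

theorem sphereQuot_mul_left {a b c : ℂ} (hc : c ≠ 0) :
    sphereQuot (c * a) (c * b) = sphereQuot a b := by
  by_cases hb : b = 0
  · rw [hb, mul_zero, sphereQuot_zero, sphereQuot_zero]
  · rw [sphereQuot_of_ne hb, sphereQuot_of_ne (mul_ne_zero hc hb), mul_div_mul_left _ _ hc]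

theorem ContinuousAt.sphereQuot {X : Type*} [TopologicalSpace X] {a b : X → ℂ} {x : X}
    (ha : ContinuousAt a x) (hb : ContinuousAt b x) (h : a x ≠ 0 ∨ b x ≠ 0) :
    ContinuousAt (fun y => sphereQuot (a y) (b y)) x := by
  rcases h with h | h
  · have h1 : ContinuousAt (fun y => sphereInv ((b y / a y : ℂ) : OnePoint ℂ)) x :=
      (continuous_sphereInv.comp OnePoint.continuous_coe).continuousAt.comp (hb.div ha h)
    refine h1.congr ?_
    filter_upwards [ha.eventually_ne h] with y hy using (sphereQuot_eq_sphereInv hy).symm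
  · have h1 : ContinuousAt (fun y => ((a y / b y : ℂ) : OnePoint ℂ)) x :=
      OnePoint.continuous_coe.continuousAt.comp (ha.div hb h)
    refine h1.congr ?_
    filter_upwards [hb.eventually_ne h] with y hy using (sphereQuot_of_ne hy).symm

open Polynomial in
/-- The rational self-map `P/Q` of the Riemann sphere, with value `c` at infinity. -/
def sphereRat (c : OnePoint ℂ) (P Q : ℂ[X]) (z : OnePoint ℂ) : OnePoint ℂ :=
  z.elim c fun y => sphereQuot (P.eval y) (Q.eval y)

section SphereRat

open Polynomial

variable {c : OnePoint ℂ} {P Q : ℂ[X]}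

theorem sphereRat_infty : sphereRat c P Q OnePoint.infty = c := rfl

theorem sphereRat_coe (y : ℂ) : sphereRat c P Q y = sphereQuot (P.eval y) (Q.eval y) := rfl

/-- The functions a and b represent P/Q in the coordinate v = 1/z without common zero at v = 0,
which gives continuity at infinity. -/
theorem continuous_sphereRat (hPQ : ∀ z, P.eval z ≠ 0 ∨ Q.eval z ≠ 0) {a b : ℂ → ℂ}
    (ha : ContinuousAt a 0) (hb : ContinuousAt b 0) (hab : a 0 ≠ 0 ∨ b 0 ≠ 0)
    (hc : c = sphereQuot (a 0) (b 0))
    (hinv : ∀ v, v ≠ 0 → sphereQuot (P.eval v⁻¹) (Q.eval v⁻¹) = sphereQuot (a v) (b v)) :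
    Continuous (sphereRat c P Q) := by
  rw [continuous_onePoint_iff]
  constructor
  · rw [sphereRat_infty, hc]
    refine ((ha.sphereQuot hb hab).tendsto.comp tendsto_inv₀_cobounded).congr' ?_
    filter_upwards [Bornology.eventually_ne_cobounded (0 : ℂ)] with x hx
    rw [sphereRat_coe]
    exact (by simpa using hinv x⁻¹ (inv_ne_zero hx) : _ = _).symm
  · rw [continuous_iff_continuousAt]
    exact fun z => P.continuous.continuousAt.sphereQuot Q.continuous.continuousAt (hPQ z)

theorem finite_sphereRat_preimage (hQ : Q ≠ 0) (hPQ : ∀ c' : ℂ, P - C c' * Q ≠ 0)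
    (z : OnePoint ℂ) : (sphereRat c P Q ⁻¹' {z}).Finite := by
  have hcase : ∃ R : ℂ[X], R ≠ 0 ∧
      ∀ y : ℂ, sphereQuot (P.eval y) (Q.eval y) = z → R.eval y = 0 := by
    induction z using OnePoint.rec with
    | infty =>
      refine ⟨Q, hQ, fun y hy => ?_⟩
      by_contra h
      rw [sphereQuot_of_ne h] at hy
      exact OnePoint.coe_ne_infty _ hy
    | coe d =>
      refine ⟨P - C d * Q, hPQ d, fun y hy => ?_⟩
      by_cases h : Q.eval y = 0
      · rw [h, sphereQuot_zero] at hy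
        exact absurd hy (OnePoint.infty_ne_coe _)
      · rw [sphereQuot_of_ne h, OnePoint.coe_eq_coe, div_eq_iff h] at hy
        simp [hy]
  obtain ⟨R, hR, hRz⟩ := hcase
  refine ((R.roots.toFinset.finite_toSet.image ((↑) : ℂ → OnePoint ℂ)).insert
    OnePoint.infty).subset fun w hw => ?_
  induction w using OnePoint.rec with
  | infty => exact Set.mem_insert _ _
  | coe y =>
    refine Set.mem_insert_of_mem _ ⟨y, ?_, rfl⟩
    simp only [Finset.mem_coe, Multiset.mem_toFinset, mem_roots hR]
    exact hRz y hw

end SphereRat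

theorem HasStrictDerivAt.exists_injOn {f : ℂ → ℂ} {f' a : ℂ} (hf : HasStrictDerivAt f f' a)
    (h : f' ≠ 0) : ∃ U ∈ 𝓝 a, Set.InjOn f U := by
  have h1 := HasStrictFDerivAt.eventually_left_inverse
    (hf.hasStrictFDerivAt_equiv h)
  refine ⟨_, h1, fun x hx y hy hxy => ?_⟩
  rw [Set.mem_ofPred_eq] at hx hy
  rw [← hx, hxy, hy]

/-! ### The torus as a quotient and functions on it. -/

section Torus

variable (μ : UpperHalfPlane)

theorem isClosed_periodLattice : IsClosed (periodLattice μ : Set ℂ) := by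
  have : DiscreteTopology (periodLattice μ) :=
    inferInstanceAs (DiscreteTopology (torusPeriods μ).lattice)
  exact AddSubgroup.isClosed_of_discrete

instance torus_t2Space : T2Space (Torus μ) := by
  have := isClosed_periodLattice μ
  infer_instance

theorem torus_coe_eq_coe_iff {z w : ℂ} :
    ((z : Torus μ) = (w : Torus μ)) ↔ ∃ l ∈ periodLattice μ, w = z + l := by
  rw [QuotientAddGroup.eq]
  exact ⟨fun h => ⟨_, h, by ring⟩, by rintro ⟨l, hl, rfl⟩; simpa using hl⟩

theorem continuous_torus_coe : Continuous fun z : ℂ => (z : Torus μ) :=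
  QuotientAddGroup.continuous_mk

theorem isOpenMap_torus_coe : IsOpenMap fun z : ℂ => (z : Torus μ) :=
  QuotientAddGroup.isOpenMap_coe

theorem torus_coe_surjective : Function.Surjective fun z : ℂ => (z : Torus μ) :=
  QuotientAddGroup.mk_surjective

instance torus_compactSpace : CompactSpace (Torus μ) := by
  have h := IsZLattice.isCompact_range_of_periodic (torusPeriods μ).lattice
    (fun z : ℂ => (z : Torus μ)) (continuous_torus_coe μ)
    (fun z w hw => ((torus_coe_eq_coe_iff μ).mpr ⟨w, hw, rfl⟩).symm)
  rw [(torus_coe_surjective μ).range_eq] at h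
  exact ⟨h⟩

/-- The preimage of a finite set in ℂ is countable, and the plane minus a countable set is
path-connected. -/
theorem isPreconnected_torus_compl {B : Set (Torus μ)} (hB : B.Finite) : IsPreconnected Bᶜ := by
  have h1 : ((fun z : ℂ => (z : Torus μ)) ⁻¹' B).Countable := by
    rw [← Set.biUnion_preimage_singleton]
    refine hB.countable.biUnion fun b _ => ?_
    obtain ⟨z, rfl⟩ := torus_coe_surjective μ b
    refine ((torusPeriods μ).countable_lattice.image fun l => z + l).mono fun w hw => ?_
    obtain ⟨l, hl, rfl⟩ := (torus_coe_eq_coe_iff μ).mp (Set.mem_singleton_iff.mp hw).symm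
    exact ⟨l, hl, rfl⟩
  have h2 := (h1.isPathConnected_compl_of_one_lt_rank (by
    rw [Complex.rank_real_complex]; norm_num)).isConnected.isPreconnected
  have h3 := h2.image _ (continuous_torus_coe μ).continuousOn
  rwa [← Set.preimage_compl, Set.image_preimage_eq _ (torus_coe_surjective μ)] at h3

/-- The map on the torus induced by a periodic function. -/
def periodicLift {Z : Type*} (φ : ℂ → Z) (t : Torus μ) : Z := φ (Quotient.out t)

variable {μ} {Z : Type*} {φ : ℂ → Z}
  (hφ : ∀ z, ∀ l ∈ periodLattice μ, φ (z + l) = φ z)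
include hφ

theorem periodicLift_coe (z : ℂ) : periodicLift μ φ (z : Torus μ) = φ z := by
  have h : ((z : ℂ) : Torus μ) = ((Quotient.out (z : Torus μ) : ℂ) : Torus μ) :=
    (QuotientAddGroup.out_eq' _).symm
  obtain ⟨l, hl, h1⟩ := (torus_coe_eq_coe_iff μ).mp h
  rw [periodicLift, h1, hφ z l hl]

theorem periodicLift_comp_coe : periodicLift μ φ ∘ (fun z : ℂ => (z : Torus μ)) = φ :=
  funext (periodicLift_coe hφ)

theorem exists_injOn_periodicLift {z : ℂ} (h : ∃ U ∈ 𝓝 z, Set.InjOn φ U) :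
    ∃ U ∈ 𝓝 (z : Torus μ), Set.InjOn (periodicLift μ φ) U := by
  obtain ⟨U, hU, hinj⟩ := h
  refine ⟨_, (isOpenMap_torus_coe μ).image_mem_nhds hU, ?_⟩
  rintro _ ⟨x, hx, rfl⟩ _ ⟨y, hy, rfl⟩ hxy
  simp only [periodicLift_coe hφ] at hxy
  rw [hinj hx hy hxy]

theorem eventually_periodicLift_ne (hne : ∀ u, ∀ᶠ w in 𝓝[≠] u, φ w ≠ φ u) (t : Torus μ) :
    ∀ᶠ t' in 𝓝[≠] t, periodicLift μ φ t' ≠ periodicLift μ φ t := by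
  obtain ⟨z, rfl⟩ := torus_coe_surjective μ t
  have h := (isOpenMap_torus_coe μ).image_mem_nhds (eventually_nhdsWithin_iff.mp (hne z))
  rw [eventually_nhdsWithin_iff]
  filter_upwards [h]
  rintro _ ⟨w, hw, rfl⟩ hwz
  simp only [periodicLift_coe hφ]
  exact hw fun h => hwz (by rw [Set.mem_singleton_iff.mp h]; rfl)

variable [TopologicalSpace Z]

theorem continuous_periodicLift (hc : Continuous φ) : Continuous (periodicLift μ φ) := by
  rw [(QuotientAddGroup.isOpenQuotientMap_mk (N := periodLattice μ)).isQuotientMap.continuous_iff]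
  exact (periodicLift_comp_coe hφ).symm ▸ hc

theorem isOpenMap_periodicLift (ho : IsOpenMap φ) : IsOpenMap (periodicLift μ φ) := by
  intro W hW
  have h := ho _ (hW.preimage (continuous_torus_coe μ))
  rwa [← periodicLift_comp_coe hφ, Set.image_comp,
    Set.image_preimage_eq _ (torus_coe_surjective μ)] at h

end Torus

/-- An open continuous map from a nonempty compact space to a connected Hausdorff space is onto. -/
theorem surjective_of_isOpenMap {X Z : Type*} [TopologicalSpace X] [CompactSpace X] [Nonempty X]
    [TopologicalSpace Z] [T2Space Z] [PreconnectedSpace Z] {f : X → Z} (hc : Continuous f)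
    (ho : IsOpenMap f) : Function.Surjective f :=
  Set.range_eq_univ.mp (IsClopen.eq_univ ⟨(isCompact_range hc).isClosed, ho.isOpen_range⟩
    (Set.range_nonempty f))

/-! ### ℘ and its rational functions as maps from the torus to the sphere. -/

open Classical in
/-- The Weierstrass function as a map to the Riemann sphere. -/
def sphereWp (μ : UpperHalfPlane) (z : ℂ) : OnePoint ℂ :=
  if z ∈ periodLattice μ then OnePoint.infty else ((wp μ z : ℂ) : OnePoint ℂ)

section SphereWp

variable {μ : UpperHalfPlane}

theorem sphereWp_of_mem {z : ℂ} (hz : z ∈ periodLattice μ) : sphereWp μ z = OnePoint.infty :=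
  if_pos hz

theorem sphereWp_of_notMem {z : ℂ} (hz : z ∉ periodLattice μ) :
    sphereWp μ z = ((wp μ z : ℂ) : OnePoint ℂ) := if_neg hz

theorem sphereWp_add_mem (z l : ℂ) (hl : l ∈ periodLattice μ) :
    sphereWp μ (z + l) = sphereWp μ z := by
  by_cases hz : z ∈ periodLattice μ
  · rw [sphereWp_of_mem hz, sphereWp_of_mem (add_mem hz hl)]
  · rw [sphereWp_of_notMem hz, sphereWp_of_notMem (by rwa [add_mem_cancel_right hl]),
      wp_add_mem hl]

theorem eventually_sphereWp_ne (u : ℂ) (v : OnePoint ℂ) : ∀ᶠ w in 𝓝[≠] u, sphereWp μ w ≠ v := by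
  have hl : ∀ᶠ w in 𝓝[≠] u, w ∉ periodLattice μ := (torusPeriods μ).eventually_notMem_lattice u
  induction v using OnePoint.rec with
  | infty =>
    filter_upwards [hl] with w hw
    rw [sphereWp_of_notMem hw]
    exact OnePoint.coe_ne_infty _
  | coe c =>
    have hc : ∀ᶠ w in 𝓝[≠] u, wp μ w ≠ c := by
      by_cases hu : u ∈ periodLattice μ
      · exact ((torusPeriods μ).tendsto_weierstrassP_cobounded hu).eventually_ne_cobounded c
      · exact (torusPeriods μ).eventually_weierstrassP_ne hu c
    filter_upwards [hl, hc] with w hw hwc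
    rw [sphereWp_of_notMem hw, Ne, OnePoint.coe_eq_coe]
    exact hwc

theorem eventually_sphereWp_notMem (u : ℂ) {T : Set (OnePoint ℂ)} (hT : T.Finite) :
    ∀ᶠ w in 𝓝[≠] u, sphereWp μ w ∉ T := by
  filter_upwards [(eventually_all_finite hT).mpr fun v _ => eventually_sphereWp_ne u v] with w hw h
  exact hw _ h rfl

theorem continuous_sphereWp : Continuous (sphereWp μ) := by
  rw [continuous_iff_continuousAt]
  intro u
  by_cases hu : u ∈ periodLattice μ
  · rw [continuousAt_iff_punctured_nhds, sphereWp_of_mem hu]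
    refine (tendsto_coe_cobounded.comp
      ((torusPeriods μ).tendsto_weierstrassP_cobounded hu)).congr' ?_
    filter_upwards [(torusPeriods μ).eventually_notMem_lattice u] with w hw
    exact (sphereWp_of_notMem hw).symm
  · have h : ContinuousAt (fun w => ((wp μ w : ℂ) : OnePoint ℂ)) u :=
      OnePoint.continuous_coe.continuousAt.comp (hasDerivAt_wp hu).continuousAt
    refine h.congr ?_
    filter_upwards [(torusPeriods μ).eventually_notMem_lattice_of_notMem hu] with w hw
    exact (sphereWp_of_notMem hw).symm

end SphereWp

section EllipticMap

open Polynomial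

/-- The map of the torus to the sphere given by a rational function of the Weierstrass function. -/
def ellipticMap (μ : UpperHalfPlane) (c : OnePoint ℂ) (P Q : ℂ[X]) : Torus μ → OnePoint ℂ :=
  periodicLift μ fun z => sphereRat c P Q (sphereWp μ z)

variable {μ : UpperHalfPlane} {c : OnePoint ℂ} {P Q : ℂ[X]}

theorem sphereRat_sphereWp_add_mem (z l : ℂ) (hl : l ∈ periodLattice μ) :
    sphereRat c P Q (sphereWp μ (z + l)) = sphereRat c P Q (sphereWp μ z) := by
  rw [sphereWp_add_mem z l hl]

theorem ellipticMap_coe (z : ℂ) :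
    ellipticMap μ c P Q (z : Torus μ) = sphereRat c P Q (sphereWp μ z) :=
  periodicLift_coe sphereRat_sphereWp_add_mem z

theorem exists_injOn_ellipticMap {z : ℂ}
    (h : ∃ U ∈ 𝓝 z, Set.InjOn (fun w : ℂ => ellipticMap μ c P Q (w : Torus μ)) U) :
    ∃ U ∈ 𝓝 (z : Torus μ), Set.InjOn (ellipticMap μ c P Q) U := by
  simp only [ellipticMap_coe] at h
  exact exists_injOn_periodicLift (φ := fun w => sphereRat c P Q (sphereWp μ w))
    sphereRat_sphereWp_add_mem h

variable (hR : Continuous (sphereRat c P Q))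
include hR

theorem continuous_ellipticMap : Continuous (ellipticMap μ c P Q) :=
  continuous_periodicLift sphereRat_sphereWp_add_mem (hR.comp continuous_sphereWp)

variable (hfin : ∀ z, (sphereRat c P Q ⁻¹' {z}).Finite)
include hfin

theorem finite_ellipticMap_preimage (z : OnePoint ℂ) : (ellipticMap μ c P Q ⁻¹' {z}).Finite :=
  finite_preimage_singleton (continuous_ellipticMap hR)
    (eventually_periodicLift_ne sphereRat_sphereWp_add_mem fun u =>
      eventually_sphereWp_notMem u (hfin (sphereRat c P Q (sphereWp μ u)))) z

/-- Finite fibres of the rational map ensure nonconstancy near every point, and the fibre over ∞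
collects the punctures where the affine formula fails. -/
theorem isOpenMap_ellipticMap : IsOpenMap (ellipticMap μ c P Q) := by
  refine isOpenMap_periodicLift sphereRat_sphereWp_add_mem
    (isOpenMap_of_eventually_eq_coe (h := fun w => P.eval (wp μ w) / Q.eval (wp μ w))
      (hR.comp continuous_sphereWp) (fun u => ?_) fun u =>
      eventually_sphereWp_notMem u (hfin (sphereRat c P Q (sphereWp μ u))))
  filter_upwards [eventually_sphereWp_notMem u (hfin OnePoint.infty),
    (torusPeriods μ).eventually_notMem_lattice u] with w hw hwl
  rw [sphereWp_of_notMem hwl] at hw ⊢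
  rw [sphereRat_coe]
  have hQ : Q.eval (wp μ w) ≠ 0 := fun h => hw (by
    rw [Set.mem_preimage, sphereRat_coe, h, sphereQuot_zero]; rfl)
  have hwp := (hasDerivAt_wp hwl).differentiableAt
  exact ⟨(P.differentiable.differentiableAt.comp w hwp).div
    (Q.differentiable.differentiableAt.comp w hwp) hQ, sphereQuot_of_ne hQ⟩

theorem surjective_ellipticMap : Function.Surjective (ellipticMap μ c P Q) :=
  have : Nonempty (Torus μ) := ⟨((0 : ℂ) : Torus μ)⟩
  surjective_of_isOpenMap (continuous_ellipticMap hR) (isOpenMap_ellipticMap hR hfin)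

end EllipticMap

/-! ### The maps F and G and their ramification. -/

section Lemniscatic

open Polynomial

/-- The numerator of `F` as a polynomial in `℘`. -/
def coverPolyF (e : ℂ) : ℂ[X] := C (4 / e ^ 4) * X ^ 2 * (X ^ 2 - C (e ^ 2))

/-- The map `F` of the lemniscatic torus to the sphere. -/
def coverMapF (e : ℂ) : Torus UpperHalfPlane.I → OnePoint ℂ :=
  ellipticMap UpperHalfPlane.I OnePoint.infty (coverPolyF e) 1

variable {e : ℂ} (he : LemniscaticValue e)
include he

theorem eval_coverPolyF_wp (u : ℂ) : (coverPolyF e).eval (wp UpperHalfPlane.I u) = coverF e u := by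
  have := he.ne_zero
  simp only [coverPolyF, coverF, eval_mul, eval_C, eval_pow, eval_X, eval_sub]
  field_simp

theorem continuous_sphereRat_coverPolyF :
    Continuous (sphereRat OnePoint.infty (coverPolyF e) 1) := by
  have he0 := he.ne_zero
  refine continuous_sphereRat (fun z => Or.inr (by simp))
    (a := fun v => 4 * (1 - e ^ 2 * v ^ 2) / e ^ 4) (b := fun v => v ^ 4) (by fun_prop)
    (by fun_prop) (Or.inl (by simp [he0])) (by simp [sphereQuot_zero]) fun v hv => ?_
  rw [← sphereQuot_mul_left (pow_ne_zero 4 hv)]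
  congr 1
  · simp only [coverPolyF, eval_mul, eval_C, eval_pow, eval_X, eval_sub]
    field_simp
  · simp

theorem finite_sphereRat_coverPolyF (z : OnePoint ℂ) :
    (sphereRat OnePoint.infty (coverPolyF e) 1 ⁻¹' {z}).Finite := by
  have he0 := he.ne_zero
  refine finite_sphereRat_preimage one_ne_zero (fun c h => ?_) z
  -- The quartic vanishes at 0 and equals 48 at 2e, so it cannot be constant.
  have h0 := congrArg (eval 0) h
  have h1 := congrArg (eval (2 * e)) h
  simp only [coverPolyF, eval_mul, eval_C, eval_pow, eval_X, eval_sub, eval_one, eval_zero] at h0 h1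
  have hc : c = 0 := by linear_combination -h0
  rw [hc] at h1
  field_simp at h1
  norm_num at h1

theorem coverMapF_coe {u : ℂ} (hu : u ∉ periodLattice UpperHalfPlane.I) :
    coverMapF e (u : Torus UpperHalfPlane.I) = ((coverF e u : ℂ) : OnePoint ℂ) := by
  rw [coverMapF, ellipticMap_coe, sphereWp_of_notMem hu, sphereRat_coe, eval_coverPolyF_wp he,
    eval_one, sphereQuot_of_ne one_ne_zero, div_one]

theorem coverF_ne_zero {u : ℂ} (hu : 2 * u ∉ periodLattice UpperHalfPlane.I) :
    coverF e u ≠ 0 := by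
  have he0 := he.ne_zero
  have h : coverF e u = 4 / e ^ 4 * wp UpperHalfPlane.I u ^ 2 *
      (wp UpperHalfPlane.I u ^ 2 - e ^ 2) := by
    rw [coverF]
    field_simp
  rw [h]
  simp [he0, he.wp_ne_zero hu, he.wp_sq_sub_ne_zero hu]

/-- The excluded half-periods form a full union of fibres of F, and `coverMapG_mem_iff` says the
same of G; so either side of F = G detects regular points. -/
theorem coverMapF_mem_iff (u : ℂ) :
    coverMapF e (u : Torus UpperHalfPlane.I) ∈ ({OnePoint.infty, ((0 : ℂ) : OnePoint ℂ)} : Set _) ↔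
      2 * u ∈ periodLattice UpperHalfPlane.I := by
  constructor
  · intro h
    by_contra hu
    rw [coverMapF_coe he (notMem_of_two_mul_notMem hu)] at h
    rcases h with h | h
    · exact OnePoint.coe_ne_infty _ h
    · exact coverF_ne_zero he hu (OnePoint.coe_eq_coe.mp h)
  · intro hu
    by_cases hul : u ∈ periodLattice UpperHalfPlane.I
    · left
      rw [coverMapF, ellipticMap_coe, sphereWp_of_mem hul, sphereRat_infty]
    · right
      rw [Set.mem_singleton_iff, coverMapF_coe he hul, OnePoint.coe_eq_coe]
      have h := he.wpDeriv_sq hul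
      rw [show wpDeriv UpperHalfPlane.I u = 0 from
        (torusPeriods UpperHalfPlane.I).derivWeierstrassP_eq_zero_of_two_mul_mem hu] at h
      have he0 := he.ne_zero
      rw [coverF]
      field_simp
      linear_combination (-wp UpperHalfPlane.I u) * h

/-- F + 1 is the square of `coverA`, whose derivative has no zero at regular points. So F' vanishes
only where `coverA` does, that is over -1. -/
theorem exists_injOn_coverMapF (t : Torus UpperHalfPlane.I)
    (ht : coverMapF e t ∉
      ({OnePoint.infty, ((0 : ℂ) : OnePoint ℂ), ((-1 : ℂ) : OnePoint ℂ)} : Set _)) :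
    ∃ U ∈ 𝓝 t, Set.InjOn (coverMapF e) U := by
  obtain ⟨u, rfl⟩ := torus_coe_surjective _ t
  have hu : 2 * u ∉ periodLattice UpperHalfPlane.I := by
    rw [← coverMapF_mem_iff he u]
    exact fun h => ht (by rcases h with h | h; exacts [Or.inl h, Or.inr (Or.inl h)])
  have hA0 : coverA e u ≠ 0 := by
    intro h
    refine ht (Or.inr (Or.inr ?_))
    rw [Set.mem_singleton_iff]
    change coverMapF e (u : Torus UpperHalfPlane.I) = _
    rw [coverMapF_coe he (notMem_of_two_mul_notMem hu), OnePoint.coe_eq_coe]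
    have h1 := coverA_sq e u
    rw [h] at h1
    linear_combination -h1
  have hA := analyticAt_coverA he hu
  have hF : AnalyticAt ℂ (coverF e) u := by
    have h1 : coverF e = fun w => coverA e w ^ 2 - 1 := funext fun w => by rw [coverA_sq]; ring
    rw [h1]
    exact (hA.pow 2).sub analyticAt_const
  have hd : deriv (coverF e) u ≠ 0 := by
    have h1 : coverF e = fun w => coverA e w ^ 2 - 1 := funext fun w => by rw [coverA_sq]; ring
    have h2 := (hA.differentiableAt.hasDerivAt.pow 2).sub_const 1
    rw [h1]
    have h3 : deriv (fun w => coverA e w ^ 2 - 1) u = _ := h2.deriv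
    rw [h3]
    simp [hA0, deriv_coverA_ne_zero he hu]
  obtain ⟨U, hU, hinj⟩ := hF.hasStrictDerivAt.exists_injOn hd
  refine exists_injOn_ellipticMap
    ⟨_, inter_mem hU (periodLattice_compl_eventually hu), ?_⟩
  rintro x ⟨hx, hx'⟩ y ⟨hy, hy'⟩ hxy
  have h1 := coverMapF_coe he (notMem_of_two_mul_notMem hx')
  have h2 := coverMapF_coe he (notMem_of_two_mul_notMem hy')
  exact hinj hx hy (OnePoint.coe_eq_coe.mp (h1.symm.trans (Eq.trans hxy h2)))

end Lemniscatic

section Rho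

open Polynomial

/-- The numerator of `G` as a polynomial in `℘`. -/
def coverPolyG (k : ℂ) : ℂ[X] := C (k ^ 3) * (X + C (10 * k / 12))

/-- The denominator of `G` as a polynomial in `℘`. -/
def coverDenG (k : ℂ) : ℂ[X] := (X - C (17 * k / 12)) * (X + C (7 * k / 12)) ^ 3

/-- The map `G` of the torus of modulus `ϱ` to the sphere. -/
def coverMapG (ϱ : UpperHalfPlane) (k : ℂ) : Torus ϱ → OnePoint ℂ :=
  ellipticMap ϱ ((0 : ℂ) : OnePoint ℂ) (coverPolyG k) (coverDenG k)

theorem eval_coverPolyG (k z : ℂ) : (coverPolyG k).eval z = k ^ 3 * (z + 10 * k / 12) := by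
  simp only [coverPolyG, eval_mul, eval_C, eval_X, eval_add]

theorem eval_coverDenG (k z : ℂ) :
    (coverDenG k).eval z = (z - 17 * k / 12) * (z + 7 * k / 12) ^ 3 := by
  simp only [coverDenG, eval_mul, eval_C, eval_X, eval_add, eval_sub, eval_pow]

theorem continuous_sphereRat_coverPolyG {k : ℂ} (hk : k ≠ 0) :
    Continuous (sphereRat ((0 : ℂ) : OnePoint ℂ) (coverPolyG k) (coverDenG k)) := by
  refine continuous_sphereRat (fun z => ?_)
    (a := fun v => k ^ 3 * v ^ 3 * (1 + 10 * k / 12 * v))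
    (b := fun v => (1 - 17 * k / 12 * v) * (1 + 7 * k / 12 * v) ^ 3) (by fun_prop)
    (by fun_prop) (Or.inr (by simp)) ?_ fun v hv => ?_
  · rw [eval_coverPolyG, eval_coverDenG]
    by_contra! h
    have h1 : z = -(10 * k / 12) := by
      have := (mul_eq_zero.mp h.1).resolve_left (pow_ne_zero 3 hk)
      linear_combination this
    have h2 := h.2
    rw [h1] at h2
    -- This is the value of the denominator at the zero of the numerator, which shows that they have
    -- no common zero.
    have h3 : (9 / 256 : ℂ) * k ^ 4 = 0 := by linear_combination h2
    simp [hk] at h3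
  · rw [sphereQuot_of_ne (by simp)]
    simp
  · rw [← sphereQuot_mul_left (pow_ne_zero 4 hv), eval_coverPolyG, eval_coverDenG]
    congr 1 <;> field_simp

theorem finite_sphereRat_coverPolyG {k : ℂ} (hk : k ≠ 0) (z : OnePoint ℂ) :
    (sphereRat ((0 : ℂ) : OnePoint ℂ) (coverPolyG k) (coverDenG k) ⁻¹' {z}).Finite := by
  refine finite_sphereRat_preimage (fun h => ?_) (fun c h => ?_) z
  · have h1 := congrArg (eval (-(10 * k / 12))) h
    rw [eval_coverDenG, eval_zero] at h1
    have h3 : (9 / 256 : ℂ) * k ^ 4 = 0 := by linear_combination h1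
    simp [hk] at h3
  · have h1 := congrArg (eval (17 * k / 12)) h
    rw [eval_sub, eval_mul, eval_C, eval_coverDenG, eval_coverPolyG, eval_zero] at h1
    have h3 : (9 / 4 : ℂ) * k ^ 4 = 0 := by linear_combination h1
    simp [hk] at h3

theorem coverMapG_coe {ϱ : UpperHalfPlane} {k s : ℂ} (hs : s ∉ periodLattice ϱ) :
    coverMapG ϱ k (s : Torus ϱ) = sphereQuot (k ^ 3 * (wp ϱ s + 10 * k / 12))
      ((wp ϱ s - 17 * k / 12) * (wp ϱ s + 7 * k / 12) ^ 3) := by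
  rw [coverMapG, ellipticMap_coe, sphereWp_of_notMem hs, sphereRat_coe, eval_coverPolyG,
    eval_coverDenG]

variable {ϱ : UpperHalfPlane} {k : ℂ} (hk : TorusValue ϱ k)
include hk

theorem coverMapG_coe' {s : ℂ} (hs : 2 * s ∉ periodLattice ϱ) :
    coverMapG ϱ k (s : Torus ϱ) = ((coverG ϱ k s : ℂ) : OnePoint ℂ) := by
  obtain ⟨h1, h2, -⟩ := hk.factors_ne_zero hs
  rw [coverMapG_coe (notMem_of_two_mul_notMem hs),
    sphereQuot_of_ne (mul_ne_zero h1 (pow_ne_zero 3 h2)), coverG]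

theorem coverMapG_mem_iff (s : ℂ) :
    coverMapG ϱ k (s : Torus ϱ) ∈ ({OnePoint.infty, ((0 : ℂ) : OnePoint ℂ)} : Set _) ↔
      2 * s ∈ periodLattice ϱ := by
  constructor
  · intro h
    by_contra hs
    obtain ⟨h1, h2, h3⟩ := hk.factors_ne_zero hs
    rw [coverMapG_coe' hk hs] at h
    rcases h with h | h
    · exact OnePoint.coe_ne_infty _ h
    · have h4 := OnePoint.coe_eq_coe.mp h
      rw [coverG] at h4
      simp [h1, h2, h3, hk.ne_zero] at h4
  · intro hs
    by_cases hsl : s ∈ periodLattice ϱ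
    · right
      rw [coverMapG, ellipticMap_coe, sphereWp_of_mem hsl, sphereRat_infty]
      rfl
    · have h := hk.wpDeriv_sq hsl
      rw [show wpDeriv ϱ s = 0 from
        (torusPeriods ϱ).derivWeierstrassP_eq_zero_of_two_mul_mem hs] at h
      rw [coverMapG_coe hsl]
      by_cases h1 : (wp ϱ s - 17 * k / 12) * (wp ϱ s + 7 * k / 12) ^ 3 = 0
      · left
        rw [h1, sphereQuot_zero]
      · right
        have h2 : wp ϱ s + 10 * k / 12 = 0 := by
          have h3 : wp ϱ s - 17 * k / 12 ≠ 0 := left_ne_zero_of_mul h1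
          have h4 : wp ϱ s + 7 * k / 12 ≠ 0 := fun h => h1 (by rw [h]; ring)
          simpa [h3, h4] using h.symm
        rw [sphereQuot_of_ne h1, h2, mul_zero, zero_div]
        rfl

theorem exists_injOn_coverMapG (t : Torus ϱ)
    (ht : coverMapG ϱ k t ∉
      ({OnePoint.infty, ((0 : ℂ) : OnePoint ℂ), ((-1 : ℂ) : OnePoint ℂ)} : Set _)) :
    ∃ U ∈ 𝓝 t, Set.InjOn (coverMapG ϱ k) U := by
  obtain ⟨s, rfl⟩ := torus_coe_surjective _ t
  have hs : 2 * s ∉ periodLattice ϱ := by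
    rw [← coverMapG_mem_iff hk s]
    exact fun h => ht (by rcases h with h | h; exacts [Or.inl h, Or.inr (Or.inl h)])
  obtain ⟨h1, h2, h3⟩ := hk.factors_ne_zero hs
  have hH0 := coverH_ne_zero hk hs
  have hk0 := hk.ne_zero
  obtain ⟨c, hc⟩ := IsAlgClosed.exists_pow_nat_eq (coverH ϱ k s) two_pos
  obtain ⟨r, hra, hrs, hrh⟩ := (analyticAt_coverH hs).exists_sqrt hH0 hc
  have hc0 : c ≠ 0 := fun h => hH0 (by rw [← hc, h]; ring)
  have hb := hasDerivAt_coverB hk hs hra hrh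
  have hz := analyticAt_wp (notMem_of_two_mul_notMem hs)
  have hG : AnalyticAt ℂ (coverG ϱ k) s :=
    (analyticAt_const.mul (hz.add analyticAt_const)).div
      ((hz.sub analyticAt_const).mul ((hz.add analyticAt_const).pow 3))
      (mul_ne_zero h1 (pow_ne_zero 3 h2))
  have hsq : ∀ᶠ w in 𝓝 s, coverG ϱ k w =
      (coverN ϱ k w / (r w * (wp ϱ w + 7 * k / 12))) ^ 2 - 1 := by
    filter_upwards [hrh, periodLattice_compl_eventually hs] with w hw hw'
    rw [sq_eq_coverG_add_one hk hw' hw]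
    ring
  have hb0 : coverN ϱ k s / (r s * (wp ϱ s + 7 * k / 12)) ≠ 0 := by
    intro h
    refine ht (Or.inr (Or.inr ?_))
    rw [Set.mem_singleton_iff]
    change coverMapG ϱ k (s : Torus ϱ) = _
    rw [coverMapG_coe' hk hs, OnePoint.coe_eq_coe, hsq.self_of_nhds, h]
    ring
  have hd : deriv (coverG ϱ k) s ≠ 0 := by
    have h4 := ((hb.pow 2).sub_const 1).congr_of_eventuallyEq hsq
    rw [h4.deriv]
    simp only [Nat.cast_ofNat, Nat.reduceSub, pow_one]
    refine mul_ne_zero (mul_ne_zero two_ne_zero hb0) (div_ne_zero (neg_ne_zero.mpr ?_) ?_)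
    · simp [hk0, wpDeriv_ne_zero hs]
    · rw [hrs]
      exact mul_ne_zero (mul_ne_zero hc0 hH0) h2
  obtain ⟨U, hU, hinj⟩ := hG.hasStrictDerivAt.exists_injOn hd
  refine exists_injOn_ellipticMap
    ⟨_, inter_mem hU (periodLattice_compl_eventually hs), ?_⟩
  rintro x ⟨hx, hx'⟩ y ⟨hy, hy'⟩ hxy
  have h4 := coverMapG_coe' hk hx'
  have h5 := coverMapG_coe' hk hy'
  exact hinj hx hy (OnePoint.coe_eq_coe.mp (h4.symm.trans (Eq.trans hxy h5)))

end Rho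

/-! ### The curve as a fibre product, and the conclusion. -/

section Curve

variable {ϱ : UpperHalfPlane} {e k : ℂ} (he : LemniscaticValue e) (hk : TorusValue ϱ k)
include he hk

theorem transcendentalRelation_iff_coverMap (u s : ℂ) : transcendentalRelation ϱ u s ↔
    coverMapF e (u : Torus UpperHalfPlane.I) = coverMapG ϱ k (s : Torus ϱ) ∧
      coverMapF e (u : Torus UpperHalfPlane.I) ∉
        ({OnePoint.infty, ((0 : ℂ) : OnePoint ℂ)} : Set _) := by
  rw [transcendentalRelation_iff he hk]
  constructor
  · rintro ⟨hu, hs, h⟩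
    rw [coverMapF_mem_iff he]
    exact ⟨by rw [coverMapF_coe he (notMem_of_two_mul_notMem hu), coverMapG_coe' hk hs, h], hu⟩
  · rintro ⟨h, hu⟩
    have hs := hu
    rw [h, coverMapG_mem_iff hk] at hs
    rw [coverMapF_mem_iff he] at hu
    rw [coverMapF_coe he (notMem_of_two_mul_notMem hu), coverMapG_coe' hk hs,
      OnePoint.coe_eq_coe] at h
    exact ⟨hu, hs, h⟩

/-- One inclusion is closedness of F = G. For the other, the common value is an open map on the
fibre product, so the points whose value is neither 0 nor ∞, which are the regular ones, are dense.
-/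
theorem coverCurve_eq :
    coverCurve ϱ = {p | coverMapF e p.1 = coverMapG ϱ k p.2} := by
  have hF : Continuous (coverMapF e) := continuous_ellipticMap (continuous_sphereRat_coverPolyF he)
  have hG : Continuous (coverMapG ϱ k) :=
    continuous_ellipticMap (continuous_sphereRat_coverPolyG hk.ne_zero)
  refine subset_antisymm (closure_minimal ?_ (isClosed_eq (hF.comp continuous_fst)
    (hG.comp continuous_snd))) ?_
  · rintro _ ⟨u, s, h, rfl⟩
    exact ((transcendentalRelation_iff_coverMap he hk u s).mp h).1
  · have hp : IsOpenMap fun p : {p : Torus UpperHalfPlane.I × Torus ϱ |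
        coverMapF e p.1 = coverMapG ϱ k p.2} => p.1.1 :=
      isOpenMap_of_fibreProduct (q := fun p => p.1.2) (IsInducing.subtypeVal)
        (fun x y => ⟨fun h => ⟨⟨(x, y), h⟩, rfl, rfl⟩, by rintro ⟨p, rfl, rfl⟩; exact p.2⟩) hF
        (isOpenMap_ellipticMap (continuous_sphereRat_coverPolyG hk.ne_zero)
          (finite_sphereRat_coverPolyG hk.ne_zero))
    have hopen : IsOpenMap (coverMapF e) := isOpenMap_ellipticMap
      (continuous_sphereRat_coverPolyF he) (finite_sphereRat_coverPolyF he)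
    have hd : Dense (({OnePoint.infty, ((0 : ℂ) : OnePoint ℂ)} : Set (OnePoint ℂ))ᶜ) := by
      rw [Set.compl_eq_univ_sdiff]
      exact dense_univ.sdiff_finite (Set.toFinite _)
    -- The preimage of a dense set under an open map is dense.
    refine (Subtype.dense_iff.mp (hd.preimage (hopen.comp hp))).trans (closure_mono ?_)
    rintro _ ⟨⟨⟨x, y⟩, hxy⟩, h, rfl⟩
    obtain ⟨u, rfl⟩ := torus_coe_surjective _ x
    obtain ⟨s, rfl⟩ := torus_coe_surjective _ y
    exact ⟨u, s, (transcendentalRelation_iff_coverMap he hk u s).mpr ⟨hxy, h⟩, rfl⟩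

theorem isFinitelySheetedCover_coverCurve :
    IsFinitelySheetedCover (fun p : coverCurve ϱ => p.1.1) ∧
      IsFinitelySheetedCover (fun p : coverCurve ϱ => p.1.2) := by
  have hcompact : CompactSpace (coverCurve ϱ) := isCompact_iff_compactSpace.mp
    (isClosed_closure.isCompact)
  have hRF := continuous_sphereRat_coverPolyF he
  have hfF := finite_sphereRat_coverPolyF he
  have hRG := continuous_sphereRat_coverPolyG hk.ne_zero
  have hfG := finite_sphereRat_coverPolyG hk.ne_zero
  have hmem : ∀ x y, coverMapF e x = coverMapG ϱ k y ↔
      ∃ p : coverCurve ϱ, p.1.1 = x ∧ p.1.2 = y := fun x y => by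
    constructor
    · intro h
      exact ⟨⟨(x, y), by rw [coverCurve_eq he hk]; exact h⟩, rfl, rfl⟩
    · rintro ⟨⟨p, hp⟩, rfl, rfl⟩
      rw [coverCurve_eq he hk] at hp
      exact hp
  have hS : ({OnePoint.infty, ((0 : ℂ) : OnePoint ℂ), ((-1 : ℂ) : OnePoint ℂ)} :
    Set (OnePoint ℂ)).Finite := Set.toFinite _
  constructor
  · exact isFinitelySheetedCover_of_fibreProduct (f := coverMapF e) (g := coverMapG ϱ k)
      (q := fun p : coverCurve ϱ => p.1.2) IsEmbedding.subtypeVal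
      hmem (continuous_ellipticMap hRF) (finite_ellipticMap_preimage hRF hfF)
      (isOpenMap_ellipticMap hRG hfG) (surjective_ellipticMap hRG hfG)
      (finite_ellipticMap_preimage hRG hfG) hS (exists_injOn_coverMapG hk)
      fun B hB => isPreconnected_torus_compl _ hB
  · exact isFinitelySheetedCover_of_fibreProduct (f := coverMapG ϱ k) (g := coverMapF e)
      (q := fun p : coverCurve ϱ => p.1.1)
      ((Homeomorph.prodComm _ _).isEmbedding.comp IsEmbedding.subtypeVal)
      (fun x y => by rw [eq_comm, hmem]; simp only [and_comm])
      (continuous_ellipticMap hRG) (finite_ellipticMap_preimage hRG hfG)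
      (isOpenMap_ellipticMap hRF hfF) (surjective_ellipticMap hRF hfF)
      (finite_ellipticMap_preimage hRF hfF) hS (exists_injOn_coverMapF he)
      fun B hB => isPreconnected_torus_compl _ hB

end Curve

end

theorem proposition9 (ϱ : UpperHalfPlane) (hre : ϱ.re = 0) (him : 1 < ϱ.im)
    (hJ : kleinJ ϱ = 73 ^ 3 / (2 ^ 4 * 3 ^ 7)) :
    -- the relation is a relation between points of the two tori
    (∀ u s : ℂ, ∀ l ∈ periodLattice UpperHalfPlane.I, ∀ l' ∈ periodLattice ϱ,
      (transcendentalRelation ϱ (u + l) (s + l') ↔ transcendentalRelation ϱ u s)) ∧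
    -- it defines a finitely-sheeted mutual cover of the two tori
    IsFinitelySheetedCover (fun p : coverCurve ϱ => p.1.1) ∧
    IsFinitelySheetedCover (fun p : coverCurve ϱ => p.1.2) ∧
    -- a holomorphic branch `u(s)` passes through each of its regular points
    (∀ u₀ s₀ : ℂ, transcendentalRelation ϱ u₀ s₀ →
      ∃ (D : Set ℂ) (u : ℂ → ℂ), s₀ ∈ D ∧ u s₀ = u₀ ∧ IsBranchOn ϱ D u) ∧
    -- each branch, with `Ψ = √(du/ds) ψ`, transforms the two equations into each other
    (∀ (D : Set ℂ) (u : ℂ → ℂ), IsBranchOn ϱ D u →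
      (∀ s ∈ D, deriv u s ≠ 0) ∧
      ∀ m : ℂ → ℂ, DifferentiableOn ℂ m D → (∀ s ∈ D, m s ^ 2 = deriv u s) →
        ∀ Ψ ψ : ℂ → ℂ, (∀ s ∈ D, Ψ (u s) = m s * ψ s) →
          (IsSolutionOn (fun z => -wp UpperHalfPlane.I (2 * z)) (u '' D) Ψ ↔
            IsSolutionOn
              (fun s => -(wp ϱ (2 * s) + (Real.pi : ℂ) ^ 2 * thetaConst2 ϱ ^ 4 / 3)) D ψ)) := by
  obtain ⟨e, he⟩ := exists_lemniscaticValue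
  obtain ⟨k, hk⟩ := exists_torusValue hre him hJ
  refine ⟨fun u s l hl l' hl' => transcendentalRelation_add_iff he hk u s hl hl',
    (isFinitelySheetedCover_coverCurve he hk).1, (isFinitelySheetedCover_coverCurve he hk).2,
    fun u₀ s₀ h => exists_branch he hk h, fun D u hu =>
    ⟨fun s hs => (branch_derivative he hk hu hs).1, fun m hm hmu Ψ ψ hΨ => ?_⟩⟩
  -- The potentials enter the equations with a minus sign, so the Schwarzian term has the sign
  -- opposite to that in `branch_schwarzian`.
  refine isSolutionOn_iff_of_schwarzian hu.1 hu.2.1 (fun s hs => (branch_derivative he hk hu hs).1)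
    hm hmu hΨ fun s hs => ?_
  rw [thetaConst2_eq, ← hk.theta]
  linear_combination -branch_schwarzian he hk hu hs
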